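/- \textbf{Setting.} Let $\mathcal R^\kappa$ be a weighted combinatorial species: a species $\mathcal R$ assigns functorially to each finite set $U$ a finite set $\mathcal R[U]$ of structures and to each bijection $U\to V$ a bijection $\mathcal R[U]\to\mathcal R[V]$, and $\kappa$ assigns to each structure a weight in $[0,\infty)$ that is invariant under these bijections. Put $[k]=\{1,\dots,k\}$, $\mathcal R[k]=\mathcal R[[k]]$, $|\mathcal R[k]|_\kappa=\sum_{R\in\mathcal R[k]}\kappa(R)$ and $\omega_k=|\mathcal R[k]|_\kappa/k!$. Assume $\omega_0>0$ and $\omega_k>0$ for some $k\ge2$. \textbf{The random enriched plane trees $(\mathcal T_n,\beta_n)$.} For a finite plane tree $T$ let $d_T^+(v)$ denote the outdegree of the vertex $v$, and put $\omega(T)=\prod_{v\in T}\omega_{d_T^+(v)}$ and $Z_n=\sum_{|T|=n}\omega(T)$, where the sum runs over all plane trees with $n$ vertices. For $n$ with $Z_n>0$, let $\mathcal T_n$ be the simply generated tree: $\mathbb P(\mathcal T_n=T)=\omega(T)/Z_n$ for each plane tree $T$ with $n$ vertices. Given $\mathcal T_n$, draw for all its vertices $v$, independently, a structure $\beta_n(v)\in\mathcal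 R[d^+_{\mathcal T_n}(v)]$ with $$\mathbb P(\beta_n(v)=R\mid\mathcal T_n)=\kappa(R)/|\mathcal R[d^+_{\mathcal T_n}(v)]|_\kappa .$$ \textbf{The limit $(\hat{\mathcal T},\hat\beta)$.} Let $\phi(z)=\sum_k\omega_kz^k$ have radius of convergence $\rho\in[0,\infty]$, let $\psi(t)=t\phi'(t)/\phi(t)$ for $0\le t<\rho$, and let $\nu=\psi(\rho)=\lim_{t\uparrow\rho}\psi(t)\in(0,\infty]$ if $\rho>0$, and $\nu=\psi(0)=0$ if $\rho=0$. If $\nu\ge1$ let $\tau\in[0,\rho]$ be the unique number with $\psi(\tau)=1$; otherwise let $\tau=\rho$. Then $\tau<\infty$, and $\pi_k=\tau^k\omega_k/\phi(\tau)$ is a probability distribution on $\mathbb N_0$ with mean $\mu=\min(\nu,1)\le 1$. The modified Galton--Watson tree $\hat{\mathcal T}$ is built as follows. Vertices are normal or special, and the root is special. Independently of each other, normal vertices have $k$ children with probability $\pi_k$, and special vertices have $k<\infty$ children with probability $k\pi_k$ and infinitely many with probability $1-\mu$. All children of a normal vertex, and of a special vertex with infinitely many children, are normal. Of the children of a special vertex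 with finitely many children, one chosen uniformly at random is special and the others are normal. Given $\hat{\mathcal T}$, draw for all its vertices $v$ of finite outdegree, independently, a structure $\hat\beta(v)\in\mathcal R[d^+_{\hat{\mathcal T}}(v)]$ with probability $\kappa(R)/|\mathcal R[d^+_{\hat{\mathcal T}}(v)]|_\kappa$ for each $R$. Put $\hat\beta(v)=\infty$ for each vertex $v$ of infinite outdegree. \textbf{The space.} Let $X$ be the one-point compactification, with added point $\infty$, of the discrete set $\{*\}\sqcup\bigsqcup_{k\ge0}\mathcal R[k]$ if the sizes $k$ with $\mathcal R[k]\ne\emptyset$ are unbounded, and let $X$ be this finite discrete set itself otherwise. Let $\mathcal V_\infty$ be the set of all finite strings of positive integers, the vertex set of the Ulam--Harris tree, in which $vi$ is the $i$-th child of $v$. Plane trees, possibly with vertices of infinite degree, are regarded as subtrees of the Ulam--Harris tree. An $\mathcal R$-enriched plane tree $(T,\beta)$ is encoded as an element of the compact product space $X^{\mathcal V_\infty}$ by putting $\beta(v)=*$ for $v\notin T$, and $\beta(v)=\infty$ for vertices $v$ of $T$ of infinite degree. Let $\mathfrak A\subset X^{\mathcal V_\infty}$ be the subspace of all $\mathcal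 R$-enriched plane trees that may have vertices of infinite degree. \textbf{Theorem.} As $n\to\infty$ along the integers with $Z_n>0$, the random enriched plane tree $(\mathcal T_n,\beta_n)$ converges in distribution to $(\hat{\mathcal T},\hat\beta)$ in the space $\mathfrak A$. This holds for all weight sequences as above, whether of type I ($\nu\ge1$), II ($0<\nu<1$) or III ($\nu=0$). -/

import Mathlib

universe u

open scoped ENNReal NNReal Topology
open MeasureTheory

/-! ## Weighted combinatorial species -/

/-- A combinatorial species: a functor from finite (label) sets with bijections to finite sets
with bijections. -/
structure Species where
  /-- the set of structures on a finite set of labels -/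
  obj : (U : Type) → [Finite U] → Type u
  finite_obj : ∀ (U : Type) [Finite U], Finite (obj U)
  /-- transport of structures along a bijection -/
  transport : ∀ {U V : Type} [Finite U] [Finite V], U ≃ V → (obj U ≃ obj V)
  transport_refl : ∀ (U : Type) [Finite U], transport (Equiv.refl U) = Equiv.refl (obj U)
  transport_trans : ∀ {U V W : Type} [Finite U] [Finite V] [Finite W] (σ : U ≃ V) (σ' : V ≃ W),
    transport (σ.trans σ') = (transport σ).trans (transport σ')

/-- A species together with an isomorphism invariant non-negative weighting. -/
structure WeightedSpecies extends Species.{u} where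
  /-- the weight of a structure -/
  weight : ∀ {U : Type} [Finite U], obj U → ℝ≥0
  weight_transport : ∀ {U V : Type} [Finite U] [Finite V] (σ : U ≃ V) (F : obj U),
    weight (transport σ F) = weight F

instance (R : WeightedSpecies.{u}) (U : Type) [Finite U] : Finite (R.obj U) := R.finite_obj U

namespace WeightedSpecies

/-- The inventory `|R[k]|`: the total weight of all (finitely many) structures on a set of `k`
labels. -/
noncomputable def inventory (R : WeightedSpecies.{u}) (k : ℕ) : ℝ≥0 :=
  ∑' F : R.obj (Fin k), R.weight F

/-- The weight sequence `ω_k = |R[k]| / k!`. -/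
noncomputable def weightSeq (R : WeightedSpecies.{u}) (k : ℕ) : ℝ≥0 :=
  R.inventory k / (k.factorial : ℝ≥0)

end WeightedSpecies

/-! ## The offspring distribution associated with a weight sequence -/

namespace WeightSeq

/-- The power series `φ(t) = ∑ ω_k t^k`, with values in `[0, ∞]`. -/
noncomputable def phi (w : ℕ → ℝ≥0) (t : ℝ≥0∞) : ℝ≥0∞ := ∑' k : ℕ, (w k : ℝ≥0∞) * t ^ k

/-- `t φ'(t) = ∑ k ω_k t^k`. -/
noncomputable def tPhiDeriv (w : ℕ → ℝ≥0) (t : ℝ≥0∞) : ℝ≥0∞ :=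
  ∑' k : ℕ, (k : ℝ≥0∞) * ((w k : ℝ≥0∞) * t ^ k)

/-- The radius of convergence of `φ`. -/
noncomputable def radius (w : ℕ → ℝ≥0) : ℝ≥0∞ :=
  (FormalMultilinearSeries.ofScalars ℝ (fun k => (w k : ℝ))).radius

/-- `ψ(t) = t φ'(t) / φ(t)`, to be used on `[0, ρ)` only. -/
noncomputable def psi (w : ℕ → ℝ≥0) (t : ℝ≥0∞) : ℝ≥0∞ := tPhiDeriv w t / phi w t

/-- `ν`, the limit of `ψ(t)` as `t` increases to the radius of convergence `ρ`; since `ψ` is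
increasing on `[0, ρ)` this is a supremum. It is `0` if `ρ = 0`. -/
noncomputable def nu (w : ℕ → ℝ≥0) : ℝ≥0∞ := ⨆ t : {t : ℝ≥0∞ // t < radius w}, psi w t

open Classical in
/-- `ψ` on `[0, ρ]`, with the value `ψ(ρ) = ν` at the right end point. -/
noncomputable def psiExt (w : ℕ → ℝ≥0) (t : ℝ≥0∞) : ℝ≥0∞ :=
  if t < radius w then psi w t else nu w

open Classical in
/-- `τ`: the unique `t ∈ [0, ρ]` with `ψ(t) = 1` if `ν ≥ 1`, and `ρ` otherwise. -/
noncomputable def tau (w : ℕ → ℝ≥0) : ℝ≥0∞ :=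
  if 1 ≤ nu w then Classical.epsilon (fun t => t ≤ radius w ∧ psiExt w t = 1) else radius w

theorem exists_bound {w : ℕ → ℝ≥0} {t : ℝ≥0} (ht : (t : ℝ≥0∞) < radius w) :
    ∃ a : ℝ, 0 < a ∧ a < 1 ∧ ∃ C : ℝ, 0 < C ∧ ∀ k, (w k : ℝ) * (t : ℝ) ^ k ≤ C * a ^ k := by
  obtain ⟨a, ha, C, hC, h⟩ :=
    FormalMultilinearSeries.norm_mul_pow_le_mul_pow_of_lt_radius _ ht
  refine ⟨a, ha.1, ha.2, C, hC, fun k => ?_⟩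
  have hk := h k
  rw [FormalMultilinearSeries.ofScalars_norm, Real.norm_of_nonneg (NNReal.coe_nonneg _)] at hk
  exact hk

theorem summable_deriv {w : ℕ → ℝ≥0} {t : ℝ≥0} (ht : (t : ℝ≥0∞) < radius w) :
    Summable (fun k : ℕ => (k : ℝ) * ((w k : ℝ) * (t : ℝ) ^ k)) := by
  obtain ⟨a, ha0, ha1, C, hC, h⟩ := exists_bound ht
  have hs : Summable (fun k : ℕ => C * ((k : ℝ) ^ 1 * a ^ k)) :=
    (summable_pow_mul_geometric_of_norm_lt_one 1
      (by rw [Real.norm_eq_abs, abs_of_pos ha0]; exact ha1)).mul_left C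
  refine Summable.of_nonneg_of_le (fun k => by positivity) (fun k => ?_) hs
  calc (k : ℝ) * ((w k : ℝ) * (t : ℝ) ^ k) ≤ (k : ℝ) * (C * a ^ k) := 
        mul_le_mul_of_nonneg_left (h k) (by positivity)
    _ = C * ((k : ℝ) ^ 1 * a ^ k) := by ring

theorem summable_phi {w : ℕ → ℝ≥0} {t : ℝ≥0} (ht : (t : ℝ≥0∞) < radius w) :
    Summable (fun k : ℕ => (w k : ℝ) * (t : ℝ) ^ k) := by
  obtain ⟨a, ha0, ha1, C, hC, h⟩ := exists_bound ht
  exact Summable.of_nonneg_of_le (fun k => by positivity) h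
    ((summable_geometric_of_lt_one ha0.le ha1).mul_left C)

theorem phi_coe {w : ℕ → ℝ≥0} {t : ℝ≥0} (ht : (t : ℝ≥0∞) < radius w) :
    phi w t = ENNReal.ofReal (∑' k : ℕ, (w k : ℝ) * (t : ℝ) ^ k) := by
  rw [ENNReal.ofReal_tsum_of_nonneg (fun k => by positivity) (summable_phi ht), phi]
  refine tsum_congr fun k => ?_
  rw [ENNReal.ofReal_mul (by positivity), ENNReal.ofReal_pow (by positivity)]
  simp

theorem tPhiDeriv_coe {w : ℕ → ℝ≥0} {t : ℝ≥0} (ht : (t : ℝ≥0∞) < radius w) :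
    tPhiDeriv w t = ENNReal.ofReal (∑' k : ℕ, (k : ℝ) * ((w k : ℝ) * (t : ℝ) ^ k)) := by
  rw [ENNReal.ofReal_tsum_of_nonneg (fun k => by positivity) (summable_deriv ht), tPhiDeriv]
  refine tsum_congr fun k => ?_
  rw [ENNReal.ofReal_mul (by positivity), ENNReal.ofReal_mul (by positivity),
    ENNReal.ofReal_pow (by positivity)]
  simp

theorem phi_ne_top {w : ℕ → ℝ≥0} {t : ℝ≥0∞} (ht : t < radius w) : phi w t ≠ ∞ := by
  lift t to ℝ≥0 using ht.ne_top
  rw [phi_coe ht]; exact ENNReal.ofReal_ne_top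

theorem phi_ne_zero {w : ℕ → ℝ≥0} (h0 : 0 < w 0) (t : ℝ≥0∞) : phi w t ≠ 0 := by
  have h : (w 0 : ℝ≥0∞) * t ^ 0 ≤ phi w t := ENNReal.le_tsum 0
  intro h'
  rw [h', pow_zero, mul_one, nonpos_iff_eq_zero, ENNReal.coe_eq_zero] at h
  exact h0.ne' h

/-- There is a solution of `ψ(t) = 1` in `[0, ρ]` if `ν ≥ 1`. -/
theorem exists_tau {w : ℕ → ℝ≥0} (h0 : 0 < w 0) (hν : 1 ≤ nu w) :
    ∃ t, t ≤ radius w ∧ psiExt w t = 1 := by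
  rcases hν.eq_or_lt with h | h
  · exact ⟨radius w, le_rfl, by simp [psiExt, ← h]⟩
  obtain ⟨⟨t₀, ht₀⟩, ht₁⟩ := lt_iSup_iff.1 h
  lift t₀ to ℝ≥0 using ht₀.ne_top
  set f : ℝ → ℝ := fun t => ∑' k : ℕ, ((k : ℝ) * ((w k : ℝ) * t ^ k) - (w k : ℝ) * t ^ k) with hf
  have hle : ∀ {t : ℝ≥0}, t ≤ t₀ → (t : ℝ≥0∞) < radius w :=
    fun h => lt_of_le_of_lt (by exact_mod_cast h) ht₀
  have hfe : ∀ {t : ℝ≥0}, t ≤ t₀ → f t =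
      (∑' k : ℕ, (k : ℝ) * ((w k : ℝ) * (t : ℝ) ^ k)) - ∑' k : ℕ, (w k : ℝ) * (t : ℝ) ^ k :=
    fun h => (summable_deriv (hle h)).tsum_sub (summable_phi (hle h))
  have hcont : ContinuousOn f (Set.Icc 0 (t₀ : ℝ)) := by
    refine continuousOn_tsum (fun k => by fun_prop)
      ((summable_deriv ht₀).add (summable_phi ht₀)) (fun k t ht => ?_)
    have hp : t ^ k ≤ (t₀ : ℝ) ^ k := pow_le_pow_left₀ ht.1 ht.2 k
    have hp' : 0 ≤ t ^ k := pow_nonneg ht.1 k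
    refine (norm_sub_le _ _).trans ?_
    rw [Real.norm_of_nonneg (by positivity), Real.norm_of_nonneg (by positivity)]
    gcongr
  have hz : f 0 ≤ 0 := by
    have : f 0 = -(w 0 : ℝ) := by
      rw [hf]
      simp only
      rw [tsum_eq_single 0]
      · simp
      · intro k hk; simp [hk]
    rw [this]; simp
  have ht : 0 ≤ f t₀ := by
    rw [hfe le_rfl, sub_nonneg]
    simp only [psi] at ht₁
    rw [ENNReal.lt_div_iff_mul_lt (Or.inl (phi_ne_zero h0 _)) (Or.inl (phi_ne_top ht₀)), one_mul,
      phi_coe ht₀, tPhiDeriv_coe ht₀] at ht₁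
    exact (ENNReal.ofReal_lt_ofReal_iff_of_nonneg (tsum_nonneg fun k => by positivity)).1 ht₁ |>.le
  obtain ⟨t, ht, hft⟩ := intermediate_value_Icc (NNReal.coe_nonneg t₀) hcont ⟨hz, ht⟩
  lift t to ℝ≥0 using ht.1
  have ht' : t ≤ t₀ := by exact_mod_cast ht.2
  refine ⟨t, (hle ht').le, ?_⟩
  rw [hfe ht', sub_eq_zero] at hft
  rw [psiExt, if_pos (hle ht'), psi, tPhiDeriv_coe (hle ht'), hft, ← phi_coe (hle ht')]
  exact ENNReal.div_self (phi_ne_zero h0 _) (phi_ne_top (hle ht'))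

theorem phi_le_of_deriv_le {w : ℕ → ℝ≥0} {t : ℝ≥0∞} (ht : t < radius w)
    (h : tPhiDeriv w t ≤ phi w t) : phi w t ≤ 2 * w 0 + w 1 * t := by
  set c : ℕ → ℝ≥0∞ := fun k => if k = 0 then 2 * (w 0 : ℝ≥0∞) else if k = 1 then w 1 * t else 0
  have hc : ∑' k, c k = 2 * w 0 + w 1 * t := by
    rw [tsum_eq_sum (s := Finset.range 2)]
    · simp [Finset.sum_range_succ, c]
    · intro k hk
      have : 2 ≤ k := not_lt.1 fun h => hk (Finset.mem_range.2 h)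
      simp [c, show k ≠ 0 by omega, show k ≠ 1 by omega]
  have h2 : 2 * phi w t ≤ tPhiDeriv w t + ∑' k, c k := by
    rw [phi, tPhiDeriv, ← ENNReal.tsum_mul_left, ← ENNReal.tsum_add]
    refine ENNReal.tsum_le_tsum fun k => ?_
    rcases k with _ | _ | k
    · simp [c]
    · simp [c, two_mul]
    · simp only [c]
      refine le_trans ?_ le_self_add
      gcongr
      exact_mod_cast (by omega : 2 ≤ k + 1 + 1)
  rw [two_mul, hc] at h2
  have h3 := h2.trans (add_le_add_left h _)
  exact (ENNReal.add_le_add_iff_left (phi_ne_top ht)).1 h3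

/-- The boundary case: if `ψ ≤ 1` on `[0, ρ)` then `φ(ρ) < ∞` and `ρ φ'(ρ) ≤ φ(ρ)`. -/
theorem boundary {w : ℕ → ℝ≥0} (h0 : 0 < w 0) (h2 : ∃ k, 2 ≤ k ∧ 0 < w k) (hν : nu w ≤ 1) :
    phi w (radius w) ≠ ∞ ∧ tPhiDeriv w (radius w) ≤ phi w (radius w) := by
  have hD : ∀ t, t < radius w → tPhiDeriv w t ≤ phi w t := by
    intro t ht
    have h1 : psi w t ≤ 1 := (le_iSup (fun s : {t : ℝ≥0∞ // t < radius w} => psi w s) ⟨t, ht⟩).trans hν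
    rwa [psi, ENNReal.div_le_iff (phi_ne_zero h0 t) (phi_ne_top ht), one_mul] at h1
  rcases eq_or_ne (radius w) 0 with hρ | hρ
  · have e1 : phi w 0 = w 0 := by
      rw [phi, tsum_eq_single 0]
      · simp
      · intro k hk; simp [hk]
    have e2 : tPhiDeriv w 0 = 0 := by
      rw [tPhiDeriv, ENNReal.tsum_eq_zero]
      intro k
      rcases eq_or_ne k 0 with rfl | hk <;> simp [*]
    rw [hρ, e1, e2]
    exact ⟨ENNReal.coe_ne_top, zero_le⟩
  have hfin : radius w ≠ ∞ := by
    intro htop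
    obtain ⟨k, hk, hwk⟩ := h2
    set s : ℝ≥0 := 1 + (2 * w 0 + w 1) / w k
    have hs1 : 1 ≤ s := le_self_add
    have hs : (s : ℝ≥0∞) < radius w := by rw [htop]; exact ENNReal.coe_lt_top
    have h3 := phi_le_of_deriv_le hs (hD _ hs)
    have h4 : (w k : ℝ≥0∞) * (s : ℝ≥0∞) ^ k ≤ phi w s := ENNReal.le_tsum k
    have h5 : w k * s ^ k ≤ 2 * w 0 + w 1 * s := by exact_mod_cast h4.trans h3
    have h6 : w k * s ^ 2 ≤ (2 * w 0 + w 1) * s := by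
      calc w k * s ^ 2 ≤ w k * s ^ k := by gcongr
        _ ≤ 2 * w 0 + w 1 * s := h5
        _ ≤ 2 * w 0 * s + w 1 * s := by
            gcongr ?_ + _; exact le_mul_of_one_le_right zero_le hs1
        _ = _ := by ring
    have h7 : w k * s = w k + (2 * w 0 + w 1) := by
      simp only [s]; field_simp
    have h8 : (w k + (2 * w 0 + w 1)) * s ≤ (2 * w 0 + w 1) * s := by
      rw [← h7]; calc w k * s * s = w k * s ^ 2 := by ring
        _ ≤ _ := h6
    have h9 := le_of_mul_le_mul_right h8 (lt_of_lt_of_le one_pos hs1)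
    have : w k ≤ 0 := by simpa using h9
    exact absurd hwk (not_lt.2 this)
  have hbot : (𝓝[<] radius w).NeBot := nhdsLT_neBot_of_exists_lt ⟨0, pos_iff_ne_zero.2 hρ⟩
  have hpow : ∀ (k : ℕ) (c : ℝ≥0∞), c ≠ ∞ →
      Filter.Tendsto (fun t : ℝ≥0∞ => c * t ^ k) (𝓝[<] radius w) (𝓝 (c * radius w ^ k)) := by
    intro k c hc
    refine (ENNReal.Tendsto.const_mul ?_ (Or.inr hc)).mono_left nhdsWithin_le_nhds
    exact (ENNReal.continuous_pow k).tendsto _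
  constructor
  · have hb : phi w (radius w) ≤ 2 * w 0 + w 1 * radius w := by
      rw [phi, ENNReal.tsum_eq_iSup_nat]
      refine iSup_le fun N => ?_
      refine le_of_tendsto (tendsto_finsetSum (Finset.range N)
        (fun k _ => hpow k (w k) ENNReal.coe_ne_top)) ?_
      filter_upwards [self_mem_nhdsWithin] with t (ht : t < radius w)
      calc ∑ k ∈ Finset.range N, (w k : ℝ≥0∞) * t ^ k ≤ phi w t := ENNReal.sum_le_tsum _
        _ ≤ 2 * w 0 + w 1 * t := phi_le_of_deriv_le ht (hD t ht)
        _ ≤ 2 * w 0 + w 1 * radius w := by gcongr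
    refine ne_top_of_le_ne_top ?_ hb
    finiteness
  · rw [tPhiDeriv, ENNReal.tsum_eq_iSup_nat]
    refine iSup_le fun N => ?_
    simp only [← mul_assoc]
    refine le_of_tendsto (tendsto_finsetSum (Finset.range N)
      (fun k _ => hpow k (k * w k) (by finiteness))) ?_
    filter_upwards [self_mem_nhdsWithin] with t (ht : t < radius w)
    calc ∑ k ∈ Finset.range N, (k : ℝ≥0∞) * (w k : ℝ≥0∞) * t ^ k
        = ∑ k ∈ Finset.range N, (k : ℝ≥0∞) * ((w k : ℝ≥0∞) * t ^ k) := by simp only [mul_assoc]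
      _ ≤ tPhiDeriv w t := ENNReal.sum_le_tsum _
      _ ≤ phi w t := hD t ht
      _ ≤ phi w (radius w) := by unfold phi; gcongr

theorem tau_spec {w : ℕ → ℝ≥0} (h0 : 0 < w 0) (h2 : ∃ k, 2 ≤ k ∧ 0 < w k) :
    phi w (tau w) ≠ ∞ ∧ tPhiDeriv w (tau w) ≤ phi w (tau w) := by
  by_cases hν : 1 ≤ nu w
  · have hs : tau w ≤ radius w ∧ psiExt w (tau w) = 1 := by
      rw [tau, if_pos hν]
      exact Classical.epsilon_spec (p := fun t => t ≤ radius w ∧ psiExt w t = 1)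
        (exists_tau h0 hν)
    rcases hs.1.lt_or_eq with h | h
    · have h1 := hs.2
      rw [psiExt, if_pos h, psi] at h1
      refine ⟨phi_ne_top h, ?_⟩
      have := h1.le
      rwa [ENNReal.div_le_iff (phi_ne_zero h0 _) (phi_ne_top h), one_mul] at this
    · have h1 := hs.2
      rw [h, psiExt, if_neg (lt_irrefl _)] at h1
      rw [h]
      exact boundary h0 h2 h1.le
  · rw [tau, if_neg hν]
    exact boundary h0 h2 (not_le.1 hν).le

/-- The offspring distribution `π_k = ω_k τ^k / φ(τ)`. -/
noncomputable def offspring (w : ℕ → ℝ≥0) (h0 : 0 < w 0) (h2 : ∃ k, 2 ≤ k ∧ 0 < w k) : PMF ℕ :=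
  ⟨fun k => (w k : ℝ≥0∞) * tau w ^ k / phi w (tau w), by
    rw [ENNReal.summable.hasSum_iff]
    simp only [div_eq_mul_inv]
    rw [ENNReal.tsum_mul_right]
    exact ENNReal.mul_inv_cancel (phi_ne_zero h0 _) (tau_spec h0 h2).1⟩

theorem offspring_mean_le (w : ℕ → ℝ≥0) (h0 : 0 < w 0) (h2 : ∃ k, 2 ≤ k ∧ 0 < w k) :
    ∑' k : ℕ, (k : ℝ≥0∞) * offspring w h0 h2 k ≤ 1 := by
  have h : ∑' k : ℕ, (k : ℝ≥0∞) * offspring w h0 h2 k = tPhiDeriv w (tau w) / phi w (tau w) := by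
    rw [tPhiDeriv, div_eq_mul_inv, ← ENNReal.tsum_mul_right]
    refine tsum_congr fun k => ?_
    change (k : ℝ≥0∞) * ((w k : ℝ≥0∞) * tau w ^ k / phi w (tau w)) = _
    rw [div_eq_mul_inv, mul_assoc, mul_assoc, mul_assoc]
  rw [h, ENNReal.div_le_iff (phi_ne_zero h0 _) (tau_spec h0 h2).1, one_mul]
  exact (tau_spec h0 h2).2

end WeightSeq

/-! ## Plane trees in the Ulam-Harris tree, possibly with infinite degrees -/

/-- Vertices of the Ulam-Harris tree. The root is `[]`, and the offspring of `v` is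
`0 :: v, 1 :: v, 2 :: v, …` in this order (strings are read from right to left, and siblings are
counted from `0`). -/
abbrev UHVertex := List ℕ

/-- The space of plane trees, allowing infinite outdegrees, encoded by the family of outdegrees;
vertices of the Ulam-Harris tree outside of the tree have outdegree `0`. -/
def PlaneTree := {d : UHVertex → ℕ∞ // ∀ (v : UHVertex) (i : ℕ), d v ≤ i → d (i :: v) = 0}

instance : MeasurableSpace PlaneTree :=
  inferInstanceAs (MeasurableSpace
    {d : UHVertex → ℕ∞ // ∀ (v : UHVertex) (i : ℕ), d v ≤ i → d (i :: v) = 0})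

/-- The vertices that are reached from the root if every vertex `v` only keeps its first `d v`
offspring. -/
def Reachable (d : UHVertex → ℕ∞) : UHVertex → Prop
  | [] => True
  | i :: v => Reachable d v ∧ (i : ℕ∞) < d v

namespace PlaneTree

/-- The outdegree of a vertex. -/
def deg (T : PlaneTree) (v : UHVertex) : ℕ∞ := T.1 v

/-- The vertex set. -/
def verts (T : PlaneTree) : Set UHVertex := {v | Reachable T.deg v}

open Classical in
/-- The plane tree in which every vertex `v` has outdegree `d v`. -/
noncomputable def ofDegrees (d : UHVertex → ℕ∞) : PlaneTree :=
  ⟨fun v => if Reachable d v then d v else 0, by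
    intro v i h
    beta_reduce at h ⊢
    rw [if_neg]
    rintro ⟨hv, hi⟩
    rw [if_pos hv] at h
    exact absurd hi (not_lt.2 h)⟩

/-- The weight of a finite plane tree: the product of `ω_{deg v}` over all vertices `v`. -/
noncomputable def weight (w : ℕ → ℝ≥0) (T : PlaneTree) : ℝ≥0 :=
  ∏ᶠ v ∈ T.verts, w (T.deg v).toNat

/-- The plane trees with `n` vertices. -/
def ofSize (n : ℕ) : Set PlaneTree := {T | T.verts.encard = n}

/-- The partition function `Z_n`. -/
noncomputable def partitionFunction (w : ℕ → ℝ≥0) (n : ℕ) : ℝ≥0∞ :=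
  ∑' T : ofSize n, (weight w T.1 : ℝ≥0∞)

/-- The law of the simply generated tree with `n` vertices, for `Z_n > 0`. -/
noncomputable def simplyGenerated (w : ℕ → ℝ≥0) (n : ℕ) : Measure PlaneTree :=
  Measure.sum fun T : ofSize n =>
    ((weight w T.1 : ℝ≥0∞) / partitionFunction w n) • Measure.dirac T.1

end PlaneTree

/-! ## The modified Galton-Watson tree -/

namespace ModifiedGW

/-- The joint law of the number of children `ξ̂` of a special vertex and of its special child, where
`P(ξ̂ = k) = k π_k` and `P(ξ̂ = ∞) = 1 - μ` with `μ = ∑ k π_k`. Given `ξ̂ = k < ∞`, the special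
child is uniform among the `k` children; for `ξ̂ = ∞` there is none, and the second coordinate is
a placeholder. -/
noncomputable def specialLaw (π : PMF ℕ) : Measure (ℕ∞ × ℕ) :=
  Measure.sum (fun k : ℕ => ∑ j ∈ Finset.range k, π k • Measure.dirac ((k : ℕ∞), j)) +
    (1 - ∑' k : ℕ, (k : ℝ≥0∞) * π k) • Measure.dirac ((⊤ : ℕ∞), 0)

theorem isProbabilityMeasure_specialLaw (π : PMF ℕ) (hπ : ∑' k : ℕ, (k : ℝ≥0∞) * π k ≤ 1) :
    IsProbabilityMeasure (specialLaw π) := by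
  constructor
  simp [specialLaw, Measure.sum_apply _ MeasurableSet.univ, add_tsub_cancel_of_le hπ]

/-- For each vertex `v` of the Ulam-Harris tree: the offspring of `v` in case that it is normal, and
the offspring and the special child of `v` in case that it is special. -/
abbrev Sample := UHVertex → ℕ × (ℕ∞ × ℕ)

/-- The special vertices: the root is special, and a vertex is special if it is the special child
of a special vertex with finite outdegree. -/
def IsSpecial (s : Sample) : UHVertex → Prop
  | [] => True
  | i :: v => IsSpecial s v ∧ (s v).2.1 ≠ ⊤ ∧ i = (s v).2.2

open Classical in
/-- The tree built from the offspring choices `s`. -/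
noncomputable def tree (s : Sample) : PlaneTree :=
  PlaneTree.ofDegrees fun v => if IsSpecial s v then (s v).2.1 else ((s v).1 : ℕ∞)

/-- The law of the modified Galton-Watson tree with offspring distribution `π` (of mean at most
one): all offspring choices are independent. -/
noncomputable def law (π : PMF ℕ) : Measure PlaneTree :=
  (Measure.infinitePi fun _ : UHVertex => π.toMeasure.prod (specialLaw π)).map tree

end ModifiedGW

/-! ## Enriched plane trees -/

namespace WeightedSpecies

variable (R : WeightedSpecies.{u})

/-- The discrete set consisting of a placeholder `*`, which is `none`, and all structures on the
sets of labels `{0, …, k - 1}` for `k ≥ 0`. -/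
def Atom : Type u := Option (Σ k : ℕ, R.obj (Fin k))

instance : TopologicalSpace R.Atom := ⊥

instance : DiscreteTopology R.Atom := ⟨rfl⟩

instance : Countable R.Atom := inferInstanceAs (Countable (Option (Σ k : ℕ, R.obj (Fin k))))

/-- The one-point compactification of `Atom R`. -/
abbrev Label : Type u := OnePoint R.Atom

/-- The placeholder for vertices outside of the tree. -/
def star : R.Label := OnePoint.some (X := R.Atom) (none : Option (Σ k : ℕ, R.obj (Fin k)))

variable {R} in
/-- A structure on `k` labels as a point of the label space. -/
def toLabel {k : ℕ} (F : R.obj (Fin k)) : R.Label := 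
  OnePoint.some (X := R.Atom) (some ⟨k, F⟩ : Option (Σ k : ℕ, R.obj (Fin k)))

variable {R} in
/-- The size of a structure, with `|*| = 0` and `|∞| = ∞`. -/
def size (x : R.Label) : ℕ∞ :=
  x.elim ⊤ fun a => Option.elim a 0 fun F => (F.1 : ℕ∞)

instance : SecondCountableTopology R.Label := by
  have hc : (Set.range (fun a : R.Atom => ({(a : R.Label)} : Set R.Label)) ∪
      Set.range (fun s : Finset R.Atom => ((↑) '' (s : Set R.Atom) : Set R.Label)ᶜ)).Countable :=
    (Set.countable_range _).union (Set.countable_range _)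
  refine (TopologicalSpace.isTopologicalBasis_of_isOpen_of_nhds ?_ ?_).secondCountableTopology hc
  · rintro _ (⟨a, rfl⟩ | ⟨s, rfl⟩)
    · beta_reduce
      rw [← Set.image_singleton]
      exact OnePoint.isOpen_image_coe.2 (isOpen_discrete _)
    · exact OnePoint.isOpen_compl_image_coe.2 ⟨isClosed_discrete _, s.finite_toSet.isCompact⟩
  · intro x U hx hU
    induction x using OnePoint.rec with
    | infty =>
      obtain ⟨-, hK⟩ := (OnePoint.isOpen_iff_of_mem hx).1 hU
      have hfin : (((↑) : R.Atom → R.Label) ⁻¹' U)ᶜ.Finite := hK.finite_of_discrete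
      refine ⟨_, Or.inr ⟨hfin.toFinset, rfl⟩, by simp, ?_⟩
      intro y hy
      induction y using OnePoint.rec with
      | infty => exact hx
      | coe a =>
        by_contra h
        exact hy ⟨a, by simpa using h, rfl⟩
    | coe a => exact ⟨_, Or.inl ⟨a, rfl⟩, rfl, by simpa using hx⟩

instance : MeasurableSpace R.Label := borel _

instance : BorelSpace R.Label := ⟨rfl⟩

/-- The space of enriched plane trees that may have vertices of infinite degree, as a subspace of
the product space. A vertex `v` is in the tree if and only if `β v ≠ *`, and then it has `|β v|`
children. The label space has the point `∞` only if the sizes of structures are unbounded;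
otherwise the label space is the finite discrete space `Atom R`. -/
def EnrichedTree : Type u :=
  {β : UHVertex → R.Label // β [] ≠ R.star ∧
    (∀ (v : UHVertex) (i : ℕ), β (i :: v) ≠ R.star ↔ (i : ℕ∞) < size (β v)) ∧
    ∀ v, β v = OnePoint.infty → ∀ N : ℕ, ∃ k, N ≤ k ∧ Nonempty (R.obj (Fin k))}

instance : TopologicalSpace R.EnrichedTree := instTopologicalSpaceSubtype

instance : MeasurableSpace R.EnrichedTree := Subtype.instMeasurableSpace

instance : BorelSpace R.EnrichedTree := Subtype.borelSpace _

open Classical in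
/-- The law of a random structure on `k` labels, drawn with probability proportional to its weight.
(If the total weight is zero, which happens with probability zero where this is used, an
irrelevant value is assigned.) -/
noncomputable def structureLaw (k : ℕ) : Measure R.Label :=
  if R.inventory k = 0 then Measure.dirac R.star
  else Measure.sum fun F : R.obj (Fin k) =>
    ((R.weight F : ℝ≥0∞) / (R.inventory k : ℝ≥0∞)) • Measure.dirac (toLabel F)

open Classical in
/-- The conditional law of the label of the vertex `v`, given the plane tree `T`. -/
noncomputable def labelLaw (T : PlaneTree) (v : UHVertex) : Measure R.Label :=
  if v ∈ T.verts then
    if T.deg v = ⊤ then Measure.dirac OnePoint.infty else R.structureLaw (T.deg v).toNat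
  else Measure.dirac R.star

/-- The law of the family of labels obtained by first drawing a plane tree from `P`, and then, given
this tree, drawing the labels of all vertices independently. -/
noncomputable def enrichedLaw (P : Measure PlaneTree) : Measure (UHVertex → R.Label) :=
  P.bind fun T => Measure.infinitePi (R.labelLaw T)

end WeightedSpecies

/-!
Write `w` for the weight sequence and `π` for the offspring distribution of the limiting tree.

**Reduction to events of the tree.** The label space is countable, so almost all mass of an open set
for the limit law is carried by finitely many cylinders, which prescribe the labels of the vertices
in a finite set `F` closed under taking parents. By the portmanteau theorem it suffices to bound the
probability of neighbourhoods of such cylinders from below in the limit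
(`eventually_lt_measure_of_isOpen`). Given the tree, the labels are independent and depend only on
the outdegrees. A vertex of infinite outdegree carries the label `∞`, and each neighbourhood of `∞`
contains all structures of large size; so for such a vertex only a *large* outdegree has to be
produced in the finite trees (`eventually_lt_enrichedLaw_pi`).

What remains concerns patterns, which are finite sets `G` of vertices with prescribed outdegrees
`d`. Let the boundary `∂` of a pattern consist of the children of its vertices that do not belong to
it themselves (and of the root if the pattern is empty). As only lower bounds are needed for the
finite trees, upper bounds are sufficient for the limit.

**The limit.** The path of the special vertices leaves a pattern with finite outdegrees through a
boundary vertex, and a union bound over this vertex shows that the pattern has probability at most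
`#∂ * ∏ π (d v)` (`law_extending_le`). With an infinite outdegree at `v₀` and `μ` the mean of `π`,
the bound becomes `(1 - μ) * ∏_{v ≠ v₀} π (d v)` (`law_extending_top_le`).

**Finite trees as balls in boxes.** Exposing the vertices one by one expresses the total weight of
the trees extending a pattern by the weight of forests of `#∂` trees (`totalWeight_extending`). The
cycle lemma expresses the latter by partition functions of balls in boxes (`forest_succ`). Hence
the probability that a simply generated tree with `n + 1` vertices extends the pattern is, up to a
factor tending to one, `#∂` times the probability that the first boxes have contents `d v` when `n`
balls are placed into `n + 1` boxes.

**Balls in boxes.** The contents of the first boxes are asymptotically independent with law `π`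
(`tendsto_boxLaw`). Let `p` be the conditional probability that the next box has content `k`, given
the contents of the first ones. By exchangeability, `p` is the mean proportion of such boxes among
the remaining ones. After multiplying the weight of each box of content `k` by `exp s`, Jensen's
inequality bounds the resulting partition function from below by `exp (s * p * n)` times the original one
(`mul_exp_le_coeff`). Evaluation of the generating function at `τ` bounds it from above by
`φ(τ) ^ (n + 1) / τ ^ n * exp ((exp s - 1) * π k * n)`. As the original partition function is
`(φ(τ) / τ) ^ n` up to a subexponential factor, small positive and negative `s` give `p → π k`. The
growth rate follows from the functional equation `T(z) = z φ(T(z))` for the generating function of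
trees, because `φ(t) / t` is minimal at `τ` (`exists_pow_le_boxes`). If `φ` has radius of
convergence zero, then `τ = 0`; in this case extremely heavy large boxes beat any exponential
reward for boxes of content `k ≠ 0` (`exists_monomial_pow_coeffLE`), so that all of the first boxes
are empty with high probability.

**Large outdegrees.** The mean content of a box tends to one by exchangeability, also in the
presence of the other boxes of a pattern, while contents below a fixed bound contribute at most `μ`
to this mean. So boxes of content `D` larger than any constant contribute the missing `1 - μ`. As
the size of the boundary of a pattern with outdegree `D` at `v₀` is at least `D - #G`, this is
exactly the required lower bound (`eventually_lt_simplyGenerated_extendingGE`).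

No case distinction between the types of weight sequences is necessary, except for the separate
treatment of radius zero.
-/

/-! ### Power series with non-negative coefficients -/

namespace WeightSeq

open PowerSeries Finset

/-- Evaluation of a power series with non-negative coefficients at a point of `[0, ∞]`. With values
in `[0, ∞]` there are no questions of convergence, and evaluation is a ring homomorphism. -/
noncomputable def evalHom (t : ℝ≥0∞) : ℝ≥0⟦X⟧ →+* ℝ≥0∞ where
  toFun f := ∑' k : ℕ, ((coeff k f : ℝ≥0) : ℝ≥0∞) * t ^ k
  map_one' := by
    rw [tsum_eq_single 0]
    · simp
    · intro k hk; simp [coeff_one, hk]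
  map_zero' := by simp
  map_add' f g := by simp [add_mul, ENNReal.tsum_add]
  map_mul' f g := by
    have h1 : ∀ n : ℕ, ((coeff n (f * g) : ℝ≥0) : ℝ≥0∞) * t ^ n = ∑' p : antidiagonal n,
        (((coeff p.1.1 f : ℝ≥0) : ℝ≥0∞) * t ^ p.1.1) *
          (((coeff p.1.2 g : ℝ≥0) : ℝ≥0∞) * t ^ p.1.2) := by
      intro n
      rw [Finset.tsum_subtype (antidiagonal n) fun p : ℕ × ℕ =>
        (((coeff p.1 f : ℝ≥0) : ℝ≥0∞) * t ^ p.1) * (((coeff p.2 g : ℝ≥0) : ℝ≥0∞) * t ^ p.2),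
        coeff_mul]
      push_cast
      rw [Finset.sum_mul]
      refine Finset.sum_congr rfl fun p hp => ?_
      rw [← mem_antidiagonal.1 hp, pow_add]
      ring
    rw [tsum_congr h1, ← ENNReal.tsum_sigma' (fun p : Σ n : ℕ, antidiagonal n =>
        (((coeff p.2.1.1 f : ℝ≥0) : ℝ≥0∞) * t ^ p.2.1.1) *
          (((coeff p.2.1.2 g : ℝ≥0) : ℝ≥0∞) * t ^ p.2.1.2)),
      ← ENNReal.tsum_mul_right]
    simp_rw [← ENNReal.tsum_mul_left]
    rw [← ENNReal.tsum_prod, ← Finset.HasAntidiagonal.sigmaAntidiagonalEquivProd.tsum_eq]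
    rfl

theorem evalHom_apply (t : ℝ≥0∞) (f : ℝ≥0⟦X⟧) :
    evalHom t f = ∑' k : ℕ, ((coeff k f : ℝ≥0) : ℝ≥0∞) * t ^ k := rfl

theorem evalHom_mk (t : ℝ≥0∞) (w : ℕ → ℝ≥0) : evalHom t (mk w) = phi w t := by
  simp [evalHom_apply, phi]

theorem evalHom_monomial (t : ℝ≥0∞) (k : ℕ) (c : ℝ≥0) :
    evalHom t (monomial k c) = c * t ^ k := by
  rw [evalHom_apply, tsum_eq_single k]
  · simp
  · intro j hj; simp [coeff_monomial, hj]

theorem coeff_mul_pow_le_evalHom (t : ℝ≥0∞) (f : ℝ≥0⟦X⟧) (m : ℕ) :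
    ((coeff m f : ℝ≥0) : ℝ≥0∞) * t ^ m ≤ evalHom t f :=
  ENNReal.le_tsum (f := fun k : ℕ => ((coeff k f : ℝ≥0) : ℝ≥0∞) * t ^ k) m

/-- Coefficientwise comparison of power series. -/
def CoeffLE (f g : ℝ≥0⟦X⟧) : Prop := ∀ m, coeff m f ≤ coeff m g

theorem CoeffLE.refl (f : ℝ≥0⟦X⟧) : CoeffLE f f := fun _ => le_rfl

theorem CoeffLE.trans {f g h : ℝ≥0⟦X⟧} (h₁ : CoeffLE f g) (h₂ : CoeffLE g h) : CoeffLE f h :=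
  fun m => (h₁ m).trans (h₂ m)

theorem CoeffLE.mul {f g f' g' : ℝ≥0⟦X⟧} (h : CoeffLE f g) (h' : CoeffLE f' g') :
    CoeffLE (f * f') (g * g') := fun m => by
  rw [coeff_mul, coeff_mul]
  exact Finset.sum_le_sum fun p _ => mul_le_mul' (h _) (h' _)

theorem CoeffLE.pow {f g : ℝ≥0⟦X⟧} (h : CoeffLE f g) (n : ℕ) : CoeffLE (f ^ n) (g ^ n) := by
  induction n with
  | zero => simpa using CoeffLE.refl _
  | succ n ih => rw [pow_succ, pow_succ]; exact ih.mul h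

theorem CoeffLE.sum {ι : Type*} {s : Finset ι} {f g : ι → ℝ≥0⟦X⟧}
    (h : ∀ i ∈ s, CoeffLE (f i) (g i)) : CoeffLE (∑ i ∈ s, f i) (∑ i ∈ s, g i) := fun m => by
  rw [map_sum, map_sum]
  exact Finset.sum_le_sum fun i hi => h i hi m

theorem coeffLE_monomial (w : ℕ → ℝ≥0) (k : ℕ) : CoeffLE (monomial k (w k)) (mk w) := fun m => by
  rw [coeff_monomial, coeff_mk]
  split_ifs with h
  · rw [h]
  · exact zero_le

/-! ### The partition function of balls in boxes, and of planted forests -/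

/-- The partition function of `m` balls in `n` boxes, that is, the sum of `∏ w (y i)` over all
`y : Fin n → ℕ` with sum `m`. -/
noncomputable def boxes (w : ℕ → ℝ≥0) (m n : ℕ) : ℝ≥0 := coeff m (mk w ^ n)

theorem boxes_succ (w : ℕ → ℝ≥0) (m n : ℕ) :
    boxes w m (n + 1) = ∑ p ∈ antidiagonal m, w p.1 * boxes w p.2 n := by
  rw [boxes, pow_succ', coeff_mul]
  simp [boxes]

/-- By exchangeability, the expected content of one box is the average number of balls per box. In
terms of generating functions this is the derivative of a power. -/
theorem mul_boxes_succ (w : ℕ → ℝ≥0) (m n : ℕ) :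
    (m : ℝ≥0) * boxes w m (n + 1) =
      (n + 1) * ∑ p ∈ antidiagonal m, (p.1 * w p.1) * boxes w p.2 n := by
  have key : (n + 1 : ℝ≥0) * ∑ p ∈ antidiagonal m, (p.1 * w p.1) * boxes w p.2 n =
      (n + 1) * coeff m (mk (fun k : ℕ => (k : ℝ≥0) * w k) * mk w ^ n) := by
    rw [coeff_mul]
    simp [boxes]
  rw [key]
  have hX : mk (fun k : ℕ => (k : ℝ≥0) * w k) = X * PowerSeries.derivative ℝ≥0 (mk w) := by
    ext k
    rcases k with _ | k
    · simp
    · rw [coeff_succ_X_mul, PowerSeries.coeff_derivative]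
      simp [mul_comm]
  rw [hX]
  rcases m with _ | m
  · simp [mul_assoc]
  · rw [mul_assoc, coeff_succ_X_mul]
    have h := Derivation.leibniz_pow (PowerSeries.derivative ℝ≥0) (mk w) (n + 1)
    have h2 := congrArg (coeff m) h
    rw [PowerSeries.coeff_derivative, Nat.add_sub_cancel] at h2
    rw [boxes]
    push_cast
    rw [mul_comm, h2]
    rw [map_nsmul, nsmul_eq_mul, smul_eq_mul, mul_comm (mk w ^ n)]
    push_cast
    rfl

theorem boxes_mul_le (w : ℕ → ℝ≥0) (m₁ m₂ n₁ n₂ : ℕ) :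
    boxes w m₁ n₁ * boxes w m₂ n₂ ≤ boxes w (m₁ + m₂) (n₁ + n₂) := by
  rw [boxes, boxes, boxes, pow_add, coeff_mul]
  exact Finset.single_le_sum (f := fun p : ℕ × ℕ => coeff p.1 (mk w ^ n₁) * coeff p.2 (mk w ^ n₂))
    (fun _ _ => zero_le) (mem_antidiagonal.2 rfl : (m₁, m₂) ∈ antidiagonal (m₁ + m₂))

/-- The total weight of the plane forests that consist of `q` trees with `N` vertices in total. By
the cycle lemma this is `q / N` times a partition function of balls in boxes; this formula is taken
as the definition, and the decomposition of trees at the root is derived in `forest_succ`. -/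
noncomputable def forest (w : ℕ → ℝ≥0) (q N : ℕ) : ℝ≥0 :=
  if N = 0 then (if q = 0 then 1 else 0)
  else if q ≤ N then (q : ℝ≥0) / N * boxes w (N - q) N else 0

theorem forest_zero_left (w : ℕ → ℝ≥0) (N : ℕ) : forest w 0 N = if N = 0 then 1 else 0 := by
  simp [forest]

theorem forest_eq_zero (w : ℕ → ℝ≥0) {q N : ℕ} (h : N < q) : forest w q N = 0 := by
  rw [forest]
  split_ifs with h1 h2 h3
  · omega
  · rfl
  · omega
  · rfl

theorem forest_of_le (w : ℕ → ℝ≥0) {q N : ℕ} (hN : N ≠ 0) (h : q ≤ N) :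
    forest w q N = (q : ℝ≥0) / N * boxes w (N - q) N := by
  rw [forest, if_neg hN, if_pos h]

/-- The decomposition of a forest at the root of its first tree. -/
theorem forest_succ (w : ℕ → ℝ≥0) (q N L : ℕ) (hL : N < L) :
    forest w (q + 1) (N + 1) = ∑ k ∈ range L, w k * forest w (q + k) N := by
  rcases lt_or_ge N q with hq | hq
  · rw [forest_eq_zero w (by omega), Finset.sum_eq_zero]
    intro k _
    rw [forest_eq_zero w (by omega), mul_zero]
  obtain ⟨M, rfl⟩ := Nat.exists_eq_add_of_le hq
  have hsum : ∑ k ∈ range L, w k * forest w (q + k) (q + M) =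
      ∑ p ∈ antidiagonal M, w p.1 * forest w (q + p.1) (q + M) := by
    rw [Finset.Nat.sum_antidiagonal_eq_sum_range_succ_mk]
    symm
    refine Finset.sum_subset (fun k hk => ?_) fun k _ hk => ?_
    · simp only [Finset.mem_range] at hk ⊢; omega
    · rw [Finset.mem_range, not_lt] at hk
      simp only
      rw [forest_eq_zero w (by omega), mul_zero]
  rw [hsum]
  rcases Nat.eq_zero_or_pos (q + M) with h0 | h0
  · have hq0 : q = 0 := by omega
    have hM0 : M = 0 := by omega
    subst hq0 hM0
    simp [forest, boxes]
  have hN : ((q + M : ℕ) : ℝ≥0) ≠ 0 := by exact_mod_cast h0.ne'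
  have hterm : ∀ p ∈ antidiagonal M, w p.1 * forest w (q + p.1) (q + M) =
      (q * (w p.1 * boxes w p.2 (q + M)) + (p.1 * w p.1) * boxes w p.2 (q + M)) /
        ((q + M : ℕ) : ℝ≥0) := by
    intro p hp
    have hp' := mem_antidiagonal.1 hp
    rw [forest_of_le w h0.ne' (by omega), show q + M - (q + p.1) = p.2 by omega]
    push_cast
    ring
  rw [Finset.sum_congr rfl hterm, ← Finset.sum_div, Finset.sum_add_distrib, ← Finset.mul_sum,
    ← boxes_succ, forest_of_le w (Nat.succ_ne_zero _) (by omega),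
    show q + M + 1 - (q + 1) = M by omega]
  have hm := mul_boxes_succ w M (q + M)
  have hN1 : ((q + M : ℕ) : ℝ≥0) + 1 ≠ 0 := by positivity
  have hS : ∑ p ∈ antidiagonal M, (p.1 * w p.1) * boxes w p.2 (q + M) =
      (M : ℝ≥0) * boxes w M (q + M + 1) / (((q + M : ℕ) : ℝ≥0) + 1) := by
    rw [hm]; field_simp
  rw [hS]
  push_cast at hN hN1 ⊢
  field_simp
  ring

/-- A forest of `a + b` trees consists of a forest of `a` trees and one of `b` trees. -/
theorem forest_add (w : ℕ → ℝ≥0) (a b N : ℕ) :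
    forest w (a + b) N = ∑ p ∈ antidiagonal N, forest w a p.1 * forest w b p.2 := by
  induction N generalizing a b with
  | zero =>
    simp only [forest, Finset.Nat.antidiagonal_zero, sum_singleton]
    rcases a with _ | a <;> rcases b with _ | b <;> simp
  | succ N ih =>
    rcases a with _ | a
    · rw [Finset.Nat.antidiagonal_succ]
      simp [forest_zero_left]
    · rw [Finset.Nat.antidiagonal_succ, Finset.sum_cons, Finset.sum_map,
        forest_eq_zero w (by simp : (0, N + 1).1 < a + 1), zero_mul, zero_add,
        show a + 1 + b = a + b + 1 by ring, forest_succ w _ _ (N + 1) (by omega)]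
      have h1 : ∀ p ∈ antidiagonal N, forest w (a + 1) (p.1 + 1) * forest w b p.2 =
          ∑ k ∈ range (N + 1), w k * (forest w (a + k) p.1 * forest w b p.2) := by
        intro p hp
        have := mem_antidiagonal.1 hp
        rw [forest_succ w _ _ (N + 1) (by omega), Finset.sum_mul]
        simp only [mul_assoc]
      simp only [Function.Embedding.prodMap, Function.Embedding.coeFn_mk, Prod.map,
        Function.Embedding.refl_apply]
      rw [Finset.sum_congr rfl h1, Finset.sum_comm]
      refine Finset.sum_congr rfl fun k _ => ?_
      rw [← Finset.mul_sum, ← ih, show a + b + k = a + k + b by ring]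

theorem mk_forest_eq_pow (w : ℕ → ℝ≥0) (q : ℕ) :
    (mk (forest w q) : ℝ≥0⟦X⟧) = mk (forest w 1) ^ q := by
  induction q with
  | zero =>
    ext N
    simp [forest_zero_left, coeff_one]
  | succ q ih =>
    rw [pow_succ, ← ih]
    ext N
    rw [coeff_mul]
    simp [forest_add w q 1]

/-- The functional equation `T(z) = z φ(T(z))` of the generating function of weighted plane
trees. -/
theorem phi_forest (w : ℕ → ℝ≥0) (z : ℝ≥0∞) :
    phi (forest w 1) z = z * phi w (phi (forest w 1) z) := by
  have h : ∀ k : ℕ, phi (forest w 1) z ^ k = phi (forest w k) z := by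
    intro k
    rw [← evalHom_mk, ← evalHom_mk, mk_forest_eq_pow w k, map_pow]
  conv_rhs => rw [phi]
  simp_rw [h]
  conv_lhs => rw [phi, tsum_eq_zero_add' ENNReal.summable]
  rw [forest_eq_zero w one_pos]
  simp only [ENNReal.coe_zero, zero_mul, zero_add]
  simp_rw [phi, ← ENNReal.tsum_mul_left]
  rw [ENNReal.tsum_comm]
  refine tsum_congr fun N => ?_
  rw [← zero_add 1, forest_succ w 0 N (N + 1) (by omega), tsum_eq_sum (s := range (N + 1))]
  · push_cast
    rw [Finset.sum_mul]
    refine Finset.sum_congr rfl fun k _ => ?_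
    rw [pow_add, zero_add, pow_one]
    ring
  · intro k hk
    rw [Finset.mem_range, not_lt] at hk
    rw [forest_eq_zero w (by omega)]
    simp

end WeightSeq

/-! ### The point `τ` and the growth of the partition function -/

namespace WeightSeq

open PowerSeries Finset

section Tau

variable {w : ℕ → ℝ≥0}

theorem phi_top (h2 : ∃ k, 2 ≤ k ∧ 0 < w k) : phi w ∞ = ∞ := by
  obtain ⟨k, hk, hwk⟩ := h2
  have h : (w k : ℝ≥0∞) * ∞ ^ k ≤ phi w ∞ := ENNReal.le_tsum k
  rw [ENNReal.top_pow (by omega), ENNReal.mul_top (by simpa using hwk.ne')] at h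
  exact top_le_iff.1 h

theorem tau_ne_top (h0 : 0 < w 0) (h2 : ∃ k, 2 ≤ k ∧ 0 < w k) : tau w ≠ ∞ := fun h =>
  (tau_spec h0 h2).1 (h ▸ phi_top h2)

theorem tau_eq_radius_of_tPhiDeriv_lt (h0 : 0 < w 0)
    (h : tPhiDeriv w (tau w) < phi w (tau w)) : tau w = radius w := by
  by_cases hν : 1 ≤ nu w
  · have hs : tau w ≤ radius w ∧ psiExt w (tau w) = 1 := by
      rw [tau, if_pos hν]
      exact Classical.epsilon_spec (p := fun t => t ≤ radius w ∧ psiExt w t = 1)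
        (exists_tau h0 hν)
    refine hs.1.eq_or_lt.resolve_right fun hlt => ?_
    have h1 := hs.2
    rw [psiExt, if_pos hlt, psi, ENNReal.div_eq_one_iff (phi_ne_zero h0 _) (phi_ne_top hlt)] at h1
    exact h.ne h1
  · rw [tau, if_neg hν]

theorem radius_ge_of_summable {t : ℝ≥0} (h : Summable fun k : ℕ => w k * t ^ k) :
    (t : ℝ≥0∞) ≤ radius w := by
  refine FormalMultilinearSeries.le_radius_of_summable_norm _ ?_
  have h' : Summable fun k : ℕ => ((w k * t ^ k : ℝ≥0) : ℝ) := NNReal.summable_coe.2 h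
  refine h'.congr fun k => ?_
  rw [FormalMultilinearSeries.ofScalars_norm, Real.norm_of_nonneg (NNReal.coe_nonneg _)]
  push_cast
  rfl

theorem phi_eq_top_of_radius_lt {t : ℝ≥0} (ht : radius w < t) : phi w t = ∞ := by
  by_contra h
  refine not_lt.2 (radius_ge_of_summable ?_) ht
  rw [← ENNReal.tsum_coe_ne_top_iff_summable]
  simpa [phi] using h

/-- The graph of `t ↦ t ^ k` lies above its tangent at `s`, multiplied by `s` to avoid the exponent
`k - 1`. -/
theorem tangent_pow_le (s t : ℝ) (hs : 0 ≤ s) (ht : 0 ≤ t) (k : ℕ) :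
    s * s ^ k + k * (t * s ^ k) ≤ s * t ^ k + k * (s * s ^ k) := by
  induction k with
  | zero => simp
  | succ k ih =>
    have h1 := mul_le_mul_of_nonneg_left ih ht
    have h2 : 0 ≤ k * (s ^ k * (t - s) ^ 2) := by positivity
    push_cast
    rw [pow_succ, pow_succ]
    nlinarith

/-- The line through the origin and `(τ, φ(τ))` supports `φ` from below, so `φ(t) / t` is minimal at
`t = τ`. If the mean `τ φ'(τ) / φ(τ)` is one, then this line is the tangent at `τ`. If it is
smaller, then the line is steeper than the tangent, but `φ` is infinite to the right of `τ`. -/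
theorem phi_tau_mul_le (h0 : 0 < w 0) (h2 : ∃ k, 2 ≤ k ∧ 0 < w k) {t : ℝ≥0∞}
    (hφt : phi w t ≠ ∞) : phi w (tau w) * t ≤ phi w t * tau w := by
  have hD := (tau_spec h0 h2).2
  have hφ := (tau_spec h0 h2).1
  have hτ := tau_ne_top h0 h2
  have hD' : tPhiDeriv w (tau w) ≠ ∞ := ne_top_of_le_ne_top hφ hD
  have hrad := tau_eq_radius_of_tPhiDeriv_lt (w := w) h0
  have ht : t ≠ ∞ := fun h => hφt (h ▸ phi_top h2)
  generalize tau w = τ at *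
  lift t to ℝ≥0 using ht
  lift τ to ℝ≥0 using hτ
  have key : (τ : ℝ≥0∞) * phi w τ + t * tPhiDeriv w τ ≤ τ * phi w t + τ * tPhiDeriv w τ := by
    simp only [phi, tPhiDeriv, ← ENNReal.tsum_mul_left, ← ENNReal.tsum_add]
    refine ENNReal.tsum_le_tsum fun k => ?_
    have h : τ * τ ^ k + k * (t * τ ^ k) ≤ τ * t ^ k + k * (τ * τ ^ k) := by
      exact_mod_cast tangent_pow_le τ t τ.2 t.2 k
    have h' := mul_le_mul_right h (w k)
    calc (τ : ℝ≥0∞) * (w k * (τ : ℝ≥0∞) ^ k) + t * (k * (w k * (τ : ℝ≥0∞) ^ k))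
        = ((w k * (τ * τ ^ k + k * (t * τ ^ k)) : ℝ≥0) : ℝ≥0∞) := by push_cast; ring
      _ ≤ ((w k * (τ * t ^ k + k * (τ * τ ^ k)) : ℝ≥0) : ℝ≥0∞) := by exact_mod_cast h'
      _ = _ := by push_cast; ring
  have hsign : t ≤ τ ∨ phi w τ ≤ tPhiDeriv w τ := by
    by_contra! hcon
    refine hφt (phi_eq_top_of_radius_lt ?_)
    rw [← hrad hcon.2]
    exact_mod_cast hcon.1
  generalize phi w τ = a at *
  generalize phi w t = b at *
  generalize tPhiDeriv w τ = d at *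
  lift a to ℝ≥0 using hφ
  lift b to ℝ≥0 using hφt
  lift d to ℝ≥0 using hD'
  norm_cast at *
  rw [← NNReal.coe_le_coe] at key hD ⊢
  rw [← NNReal.coe_le_coe, ← NNReal.coe_le_coe] at hsign
  push_cast at key ⊢
  rcases hsign with h | h
  · nlinarith [mul_nonneg (sub_nonneg.2 h) (sub_nonneg.2 hD)]
  · have : (a : ℝ) = d := le_antisymm h hD
    nlinarith

/-- A configuration of `n` balls in `n + 1` boxes has an empty box. -/
theorem boxes_succ_le (w : ℕ → ℝ≥0) (n : ℕ) :
    boxes w n (n + 1) ≤ (n + 1) * (w 0 * boxes w n n) := by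
  have h1 := mul_boxes_succ w n n
  have h2 := boxes_succ w n n
  have h3 : ∑ p ∈ antidiagonal n, w p.1 * boxes w p.2 n ≤
      w 0 * boxes w n n + ∑ p ∈ antidiagonal n, (p.1 * w p.1) * boxes w p.2 n := by
    have h4 : w 0 * boxes w n n =
        ∑ p ∈ antidiagonal n, if p = (0, n) then w p.1 * boxes w p.2 n else 0 := by
      rw [Finset.sum_ite_eq' (antidiagonal n) (0, n)]
      simp
    rw [h4, ← Finset.sum_add_distrib]
    refine Finset.sum_le_sum fun p hp => ?_
    have hp' := mem_antidiagonal.1 hp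
    rcases Nat.eq_zero_or_pos p.1 with h | h
    · rw [if_pos (Prod.ext h (by simp; omega))]
      exact le_self_add
    · refine le_trans ?_ le_add_self
      rw [mul_assoc]
      exact le_mul_of_one_le_left zero_le (by exact_mod_cast h)
  rw [← h2] at h3
  have h5 := mul_le_mul_right h3 ((n : ℝ≥0) + 1)
  rw [mul_add, ← h1] at h5
  have h6 : boxes w n (n + 1) + n * boxes w n (n + 1) ≤
      (n + 1) * (w 0 * boxes w n n) + n * boxes w n (n + 1) := by
    calc _ = ((n : ℝ≥0) + 1) * boxes w n (n + 1) := by ring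
      _ ≤ _ := h5
  exact le_of_add_le_add_right h6

/-- The exponential growth rate of `boxes w n n` is at least `φ(τ) / τ`: otherwise the generating
function `T` of trees would be finite at some `z > τ / φ(τ)`, and `T(z) = z φ(T(z))` contradicts the
minimality of `φ(t) / t` at `τ`. -/
theorem exists_pow_le_boxes (h0 : 0 < w 0) (h2 : ∃ k, 2 ≤ k ∧ 0 < w k) {x : ℝ≥0}
    (hx : (x : ℝ≥0∞) * tau w < phi w (tau w)) : ∃ N, N ≠ 0 ∧ x ^ N ≤ boxes w N N := by
  by_contra! hcon
  have hle : ∀ N, boxes w N N ≤ x ^ N := fun N => by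
    rcases eq_or_ne N 0 with rfl | hN
    · simp [boxes]
    · exact (hcon N hN).le
  -- Choose `z` with `τ / φ(τ) < z < 1 / x`.
  obtain ⟨z, hz1, hz2⟩ : ∃ z : ℝ≥0, tau w < z * phi w (tau w) ∧ z * x < 1 := by
    have hφ := (tau_spec h0 h2).1
    have hφ0 := phi_ne_zero h0 (tau w)
    have hτ := tau_ne_top h0 h2
    generalize phi w (tau w) = a at *
    generalize tau w = τ at *
    lift a to ℝ≥0 using hφ
    lift τ to ℝ≥0 using hτ
    norm_cast at *
    have ha : 0 < a := pos_iff_ne_zero.2 hφ0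
    rcases eq_or_ne x 0 with rfl | hx0
    · refine ⟨τ / a + 1, ?_, by simp⟩
      rw [add_mul, div_mul_cancel₀ _ ha.ne']
      simpa using ha
    · have hx0 : 0 < x := pos_iff_ne_zero.2 hx0
      have : τ / a < 1 / x := by
        rw [div_lt_div_iff₀ ha hx0, one_mul, mul_comm]
        exact hx
      obtain ⟨z, hz, hz'⟩ := exists_between this
      exact ⟨z, (div_lt_iff₀ ha).1 hz, (lt_div_iff₀ hx0).1 hz'⟩
  have hz0 : z ≠ 0 := by rintro rfl; simp at hz1
  set T := phi (forest w 1) z with hT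
  have hTfin : T ≠ ∞ := by
    have hb : ∀ N : ℕ, (forest w 1 (N + 1) : ℝ≥0∞) * (z : ℝ≥0∞) ^ (N + 1) ≤
        ((w 0 * z * (z * x) ^ N : ℝ≥0) : ℝ≥0∞) := by
      intro N
      have h1 : forest w 1 (N + 1) ≤ w 0 * x ^ N := by
        rw [forest_of_le w (Nat.succ_ne_zero N) (by omega), Nat.succ_sub_one, Nat.cast_one,
          one_div, inv_mul_le_iff₀ (by positivity)]
        refine (boxes_succ_le w N).trans ?_
        push_cast
        gcongr
        exact hle N
      calc (forest w 1 (N + 1) : ℝ≥0∞) * (z : ℝ≥0∞) ^ (N + 1)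
          ≤ ((w 0 * x ^ N : ℝ≥0) : ℝ≥0∞) * (z : ℝ≥0∞) ^ (N + 1) := by gcongr
        _ = _ := by push_cast; ring
    rw [hT, phi, tsum_eq_zero_add' ENNReal.summable, forest_eq_zero w one_pos]
    simp only [ENNReal.coe_zero, zero_mul, zero_add]
    refine ne_top_of_le_ne_top ?_ (ENNReal.tsum_le_tsum hb)
    rw [ENNReal.tsum_coe_ne_top_iff_summable]
    exact (NNReal.summable_geometric hz2).mul_left _
  have hT0 : T ≠ 0 := by
    have h1 : (forest w 1 1 : ℝ≥0∞) * (z : ℝ≥0∞) ^ 1 ≤ T :=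
      ENNReal.le_tsum (f := fun k : ℕ => (forest w 1 k : ℝ≥0∞) * (z : ℝ≥0∞) ^ k) 1
    have h3 : forest w 1 1 = w 0 := by simp [forest, boxes]
    rw [h3] at h1
    intro h
    rw [h, nonpos_iff_eq_zero, pow_one, mul_eq_zero, ENNReal.coe_eq_zero, ENNReal.coe_eq_zero] at h1
    exact h1.elim h0.ne' hz0
  have hfun : T = z * phi w T := phi_forest w z
  have hφT : phi w T ≠ ∞ := by
    intro h
    rw [h, ENNReal.mul_top (by simpa using hz0)] at hfun
    exact hTfin hfun
  have h3 := mul_le_mul_right (phi_tau_mul_le h0 h2 hφT) (z : ℝ≥0∞)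
  rw [← mul_assoc, ← mul_assoc, ← hfun, mul_comm T] at h3
  exact not_lt.2 ((ENNReal.mul_le_mul_iff_left hT0 hTfin).1 h3) hz1

/-- A lower bound for the partition function. A configuration of `m` balls in `m + 1` boxes is
extended by many copies of configurations of `N` balls in `N` boxes, with one `m` for each residue
class modulo `N`. -/
theorem exists_mul_pow_le_boxes (h0 : 0 < w 0) (h2 : ∃ k, 2 ≤ k ∧ 0 < w k) {x : ℝ≥0} (hx0 : 0 < x)
    (hx : (x : ℝ≥0∞) * tau w < phi w (tau w)) :
    ∃ c : ℝ≥0, 0 < c ∧ ∀ n, 0 < boxes w n (n + 1) → c * x ^ n ≤ boxes w n (n + 1) := by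
  obtain ⟨N, hN, hxN⟩ := exists_pow_le_boxes h0 h2 hx
  have hpow : ∀ q, x ^ (N * q) ≤ boxes w (N * q) (N * q) := by
    intro q
    induction q with
    | zero => simp [boxes]
    | succ q ih =>
      rw [Nat.mul_succ, pow_add]
      exact (mul_le_mul' ih hxN).trans (boxes_mul_le w _ _ _ _)
  have hres : ∀ R, ∃ c : ℝ≥0, 0 < c ∧ ∀ n, n % N < R → 0 < boxes w n (n + 1) →
      c * x ^ n ≤ boxes w n (n + 1) := by
    intro R
    induction R with
    | zero => exact ⟨1, one_pos, fun n h => absurd h (Nat.not_lt_zero _)⟩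
    | succ R ih =>
      obtain ⟨c, hc, h⟩ := ih
      by_cases hex : ∃ n, n % N = R ∧ 0 < boxes w n (n + 1)
      · classical
        obtain ⟨hm1, hm2⟩ := Nat.find_spec hex
        set m := Nat.find hex
        refine ⟨min c (boxes w m (m + 1) / x ^ m), lt_min hc (by positivity), fun n hn hpos => ?_⟩
        rcases (Nat.lt_succ_iff.1 hn).lt_or_eq with hlt | heq
        · exact (mul_le_mul_left (min_le_left _ _) _).trans (h n hlt hpos)
        · have hmn : m ≤ n := Nat.find_min' hex ⟨heq, hpos⟩
          obtain ⟨q, hq⟩ : N ∣ n - m := (Nat.modEq_iff_dvd' hmn).1 (hm1.trans heq.symm)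
          obtain rfl : n = m + N * q := by omega
          calc min c (boxes w m (m + 1) / x ^ m) * x ^ (m + N * q)
              ≤ boxes w m (m + 1) / x ^ m * x ^ (m + N * q) :=
                mul_le_mul_left (min_le_right _ _) _
            _ = boxes w m (m + 1) * x ^ (N * q) := by rw [pow_add]; field_simp
            _ ≤ boxes w m (m + 1) * boxes w (N * q) (N * q) := mul_le_mul_right (hpow q) _
            _ ≤ _ := (boxes_mul_le w _ _ _ _).trans_eq (by congr 1; ring)
      · refine ⟨c, hc, fun n hn hpos => h n ?_ hpos⟩
        exact (Nat.lt_succ_iff.1 hn).lt_of_ne fun heq => hex ⟨n, heq, hpos⟩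
  obtain ⟨c, hc, h⟩ := hres N
  exact ⟨c, hc, fun n => h n (Nat.mod_lt n (Nat.pos_of_ne_zero hN))⟩

end Tau

end WeightSeq

/-! ### The law of the first boxes -/

namespace WeightSeq

open PowerSeries Finset Filter

theorem coeff_monomial_mul_eq (S n : ℕ) (c : ℝ≥0) (f : ℝ≥0⟦X⟧) :
    coeff n (monomial S c * f) = if S ≤ n then c * coeff (n - S) f else 0 := by
  have h : (monomial S c : ℝ≥0⟦X⟧) = C c * X ^ S := by
    rw [← monomial_zero_eq_C_apply, X_pow_eq, monomial_mul_monomial, zero_add, mul_one]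
  rw [h, mul_assoc, coeff_C_mul, coeff_X_pow_mul']
  split_ifs <;> simp

/-- For `n` balls in `n + 1` boxes, the total weight of the configurations in which the contents of
the first boxes are the entries of the list `l`. -/
noncomputable def boxNum (w : ℕ → ℝ≥0) (l : List ℕ) (n : ℕ) : ℝ≥0 :=
  coeff n (monomial l.sum (l.map w).prod * mk w ^ (n + 1 - l.length))

/-- For `n` balls in `n + 1` boxes, the probability that the contents of the first boxes are the
entries of the list `l`. -/
noncomputable def boxLaw (w : ℕ → ℝ≥0) (l : List ℕ) (n : ℕ) : ℝ≥0 :=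
  boxNum w l n / boxes w n (n + 1)

variable (w : ℕ → ℝ≥0)

theorem boxNum_nil (n : ℕ) : boxNum w [] n = boxes w n (n + 1) := by
  simp [boxNum, boxes]

theorem boxNum_eq (l : List ℕ) (n : ℕ) : boxNum w l n =
    if l.sum ≤ n then (l.map w).prod * boxes w (n - l.sum) (n + 1 - l.length) else 0 := by
  rw [boxNum, coeff_monomial_mul_eq, boxes]

/-- Summation over the content of the next box, with an arbitrary weight factor `g`. -/
theorem sum_mul_boxNum_cons (g : ℕ → ℝ≥0) (l : List ℕ) (n : ℕ) :
    ∑ j ∈ range (n + 1), g j * boxNum w (j :: l) n =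
      if l.sum ≤ n then (l.map w).prod *
        ∑ p ∈ antidiagonal (n - l.sum), g p.1 * w p.1 * boxes w p.2 (n - l.length) else 0 := by
  split_ifs with h
  · rw [Finset.Nat.sum_antidiagonal_eq_sum_range_succ_mk, Finset.mul_sum]
    symm
    rw [Finset.sum_congr rfl (g := fun j => g j * boxNum w (j :: l) n)]
    · refine Finset.sum_subset (fun k hk => ?_) fun k _ hk => ?_
      · simp only [Finset.mem_range] at hk ⊢; omega
      · rw [Finset.mem_range, not_lt] at hk
        rw [boxNum_eq, if_neg, mul_zero]
        rw [List.sum_cons]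
        omega
    · intro j hj
      rw [Finset.mem_range] at hj
      rw [boxNum_eq, if_pos (by rw [List.sum_cons]; omega)]
      simp only [List.sum_cons, List.map_cons, List.prod_cons, List.length_cons]
      rw [Nat.add_sub_add_right, show n - (j + l.sum) = n - l.sum - j by omega]
      ring
  · refine Finset.sum_eq_zero fun j _ => ?_
    rw [boxNum_eq, if_neg, mul_zero]
    rw [List.sum_cons]
    omega

theorem sum_boxNum_cons {l : List ℕ} {n : ℕ} (hl : l.length ≤ n) :
    ∑ j ∈ range (n + 1), boxNum w (j :: l) n = boxNum w l n := by
  have h := sum_mul_boxNum_cons w (fun _ => 1) l n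
  simp only [one_mul] at h
  rw [h, boxNum_eq, ← boxes_succ, show n + 1 - l.length = n - l.length + 1 by omega]

theorem sum_mul_boxNum_cons_self {l : List ℕ} {n : ℕ} (hl : l.length ≤ n) :
    ((n - l.length : ℕ) + 1 : ℝ≥0) * ∑ j ∈ range (n + 1), (j : ℝ≥0) * boxNum w (j :: l) n =
      (n - l.sum : ℕ) * boxNum w l n := by
  rw [sum_mul_boxNum_cons, boxNum_eq]
  split_ifs with h
  · rw [mul_left_comm, ← mul_boxes_succ, show n + 1 - l.length = n - l.length + 1 by omega]
    ring
  · simp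

theorem sum_boxLaw_cons {l : List ℕ} {n : ℕ} (hl : l.length ≤ n) :
    ∑ j ∈ range (n + 1), boxLaw w (j :: l) n = boxLaw w l n := by
  simp only [boxLaw]
  rw [← Finset.sum_div, sum_boxNum_cons w hl]

/-- The expected content of the next box, on the event that the first boxes are given by `l`. -/
theorem sum_mul_boxLaw_cons {l : List ℕ} {n : ℕ} (hl : l.length ≤ n) :
    ∑ j ∈ range (n + 1), (j : ℝ≥0) * boxLaw w (j :: l) n =
      (n - l.sum : ℕ) / ((n - l.length : ℕ) + 1 : ℝ≥0) * boxLaw w l n := by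
  simp only [boxLaw, ← mul_div_assoc]
  rw [← Finset.sum_div]
  congr 1
  rw [div_mul_eq_mul_div, ← sum_mul_boxNum_cons_self w hl]
  field_simp

theorem boxLaw_nil {n : ℕ} (hn : 0 < boxes w n (n + 1)) : boxLaw w [] n = 1 := by
  rw [boxLaw, boxNum_nil, div_self hn.ne']

/-- The boxes are exchangeable, so each entry of `l` may be moved to the first box. -/
theorem boxLaw_le_of_mem {l : List ℕ} {k n : ℕ} (hk : k ∈ l) (hl : l.length ≤ n + 1) :
    boxLaw w l n ≤ boxLaw w [k] n := by
  rw [boxLaw, boxLaw]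
  gcongr
  have hA : ∀ l : List ℕ, CoeffLE (monomial l.sum (l.map w).prod) (mk w ^ l.length) := by
    intro l
    induction l with
    | nil => simpa using CoeffLE.refl _
    | cons j l ih =>
      simp only [List.sum_cons, List.map_cons, List.prod_cons, List.length_cons]
      rw [← monomial_mul_monomial, pow_succ']
      exact (coeffLE_monomial w j).mul ih
  have hp := List.perm_cons_erase hk
  have h1 : monomial l.sum (l.map w).prod =
      monomial k (w k) * monomial (l.erase k).sum ((l.erase k).map w).prod := by
    rw [monomial_mul_monomial, hp.sum_eq, (hp.map w).prod_eq]
    simp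
  have hlen : l.length = (l.erase k).length + 1 := by rw [hp.length_eq]; simp
  rw [boxNum, boxNum, h1]
  have h2 := ((CoeffLE.refl (monomial k (w k))).mul (hA (l.erase k))).mul
    (CoeffLE.refl (mk w ^ (n + 1 - l.length))) n
  refine h2.trans_eq ?_
  rw [mul_assoc, ← pow_add]
  simp only [List.sum_cons, List.sum_nil, add_zero, List.map_cons, List.map_nil, List.prod_cons,
    List.prod_nil, mul_one, List.length_cons, List.length_nil, zero_add, Nat.add_sub_cancel]
  congr 3
  omega

end WeightSeq

/-! ### Exponential moments of the number of boxes with given content -/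

namespace WeightSeq

open PowerSeries Finset Filter

variable {w : ℕ → ℝ≥0}

theorem sum_mul_choose {S : Type*} [CommSemiring S] (a b : S) (N : ℕ) :
    ∑ j ∈ range (N + 2), (j : S) * (a ^ j * b ^ (N + 1 - j) * ((N + 1).choose j : S)) =
      (N + 1) * (a * (a + b) ^ N) := by
  rw [Finset.sum_range_succ', add_pow, Finset.mul_sum, Finset.mul_sum]
  simp only [Nat.cast_zero, zero_mul, add_zero]
  refine Finset.sum_congr rfl fun j _ => ?_
  have h : ((N + 1 : ℕ) : S) * (N.choose j : S) =
      ((N + 1).choose (j + 1) : S) * ((j + 1 : ℕ) : S) := by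
    rw [← Nat.cast_mul, ← Nat.cast_mul, Nat.add_one_mul_choose_eq]
  rw [show N + 1 - (j + 1) = N - j by omega]
  calc ((j + 1 : ℕ) : S) * (a ^ (j + 1) * b ^ (N - j) * ((N + 1).choose (j + 1) : S))
      = (((N + 1).choose (j + 1) : S) * ((j + 1 : ℕ) : S)) * (a ^ (j + 1) * b ^ (N - j)) := by ring
    _ = _ := by rw [← h]; push_cast; ring

/-- Jensen's inequality for the exponential function and a finite measure on `ℕ`. -/
theorem mul_exp_le_sum (s : ℝ) (t : Finset ℕ) (g : ℕ → ℝ) (hg : ∀ j, 0 ≤ g j)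
    (hpos : 0 < ∑ j ∈ t, g j) :
    (∑ j ∈ t, g j) * Real.exp (s * ((∑ j ∈ t, j * g j) / ∑ j ∈ t, g j)) ≤
      ∑ j ∈ t, Real.exp (s * j) * g j := by
  set P := ∑ j ∈ t, g j with hP
  set c := (∑ j ∈ t, j * g j) / P with hc
  have hcP : ∑ j ∈ t, (j : ℝ) * g j = c * P := by rw [hc]; field_simp
  have h1 : ∀ j ∈ t, Real.exp (s * c) * ((1 - s * c) * g j + s * (j * g j)) ≤
      Real.exp (s * j) * g j := by
    intro j _
    have h2 := Real.add_one_le_exp (s * j - s * c)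
    have h3 : Real.exp (s * j) = Real.exp (s * c) * Real.exp (s * j - s * c) := by
      rw [← Real.exp_add]; congr 1; ring
    rw [h3, mul_assoc]
    refine mul_le_mul_of_nonneg_left ?_ (Real.exp_pos _).le
    nlinarith [mul_le_mul_of_nonneg_right h2 (hg j)]
  refine le_trans (le_of_eq ?_) (Finset.sum_le_sum h1)
  rw [← Finset.mul_sum, Finset.sum_add_distrib, ← Finset.mul_sum, ← Finset.mul_sum, hcP, ← hP]
  ring

/-- The series `φ` with the term of degree `k` removed. -/
noncomputable def otherTerms (w : ℕ → ℝ≥0) (k : ℕ) : ℝ≥0⟦X⟧ := mk (Function.update w k 0)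

theorem monomial_add_otherTerms (w : ℕ → ℝ≥0) (k : ℕ) :
    monomial k (w k) + otherTerms w k = mk w := by
  ext m
  rw [map_add, coeff_monomial, otherTerms, coeff_mk, coeff_mk, Function.update_apply]
  split_ifs with h <;> simp [h]

/-- Weighting each box of content `k` by a factor `exp s` gives the exponential moment of the number
of such boxes, which is bounded from below by Jensen's inequality. -/
theorem mul_exp_le_coeff (k N m : ℕ) (s : ℝ) (A : ℝ≥0⟦X⟧)
    (hpos : 0 < coeff m (A * mk w ^ (N + 1))) :
    ((coeff m (A * mk w ^ (N + 1)) : ℝ≥0) : ℝ) * Real.exp (s * ((N + 1) *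
        (coeff m (A * (monomial k (w k) * mk w ^ N)) : ℝ≥0) /
          (coeff m (A * mk w ^ (N + 1)) : ℝ≥0))) ≤
      (coeff m (A * (C (Real.exp s).toNNReal * monomial k (w k) + otherTerms w k) ^ (N + 1)) :
        ℝ≥0) := by
  set a : ℝ≥0⟦X⟧ := monomial k (w k) with ha
  set b := otherTerms w k with hb
  set g : ℕ → ℝ≥0 := fun j => coeff m (A * (a ^ j * b ^ (N + 1 - j) * ((N + 1).choose j : ℝ≥0⟦X⟧)))
    with hg
  have e1 : coeff m (A * mk w ^ (N + 1)) = ∑ j ∈ range (N + 2), g j := by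
    rw [← monomial_add_otherTerms w k, add_pow, Finset.mul_sum, map_sum]
  have e2 : (N + 1) * coeff m (A * (a * mk w ^ N)) = ∑ j ∈ range (N + 2), (j : ℝ≥0) * g j := by
    have h := congrArg (fun f => coeff m (A * f)) (sum_mul_choose a b N)
    simp only [Finset.mul_sum, map_sum] at h
    rw [monomial_add_otherTerms] at h
    have h5 : ∀ (c : ℕ) (f : ℝ≥0⟦X⟧), coeff m (A * ((c : ℝ≥0⟦X⟧) * f)) = c * coeff m (A * f) := by
      intro c f
      rw [mul_left_comm, ← map_natCast (C (R := ℝ≥0)), coeff_C_mul]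
    have h6 := h5 (N + 1) (a * mk w ^ N)
    push_cast at h6
    rw [h6] at h
    rw [← h]
    exact Finset.sum_congr rfl fun j _ => h5 j _
  have e3 : coeff m (A * (C (Real.exp s).toNNReal * a + b) ^ (N + 1)) =
      ∑ j ∈ range (N + 2), (Real.exp s).toNNReal ^ j * g j := by
    rw [add_pow, Finset.mul_sum, map_sum]
    refine Finset.sum_congr rfl fun j _ => ?_
    rw [mul_pow, ← map_pow, ← coeff_C_mul]
    congr 1
    ring
  have hJ := mul_exp_le_sum s (range (N + 2)) (fun j => (g j : ℝ)) (fun j => (g j).2)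
    (by rw [e1] at hpos; exact_mod_cast hpos)
  have e1' : ((coeff m (A * mk w ^ (N + 1)) : ℝ≥0) : ℝ) = ∑ j ∈ range (N + 2), (g j : ℝ) := by
    rw [e1]; push_cast; rfl
  have e2' : ((N : ℝ) + 1) * (coeff m (A * (a * mk w ^ N)) : ℝ≥0) =
      ∑ j ∈ range (N + 2), (j : ℝ) * g j := by
    have := congrArg ((↑) : ℝ≥0 → ℝ) e2
    push_cast at this
    exact this
  rw [e1', e2', e3]
  refine hJ.trans_eq ?_
  push_cast
  refine Finset.sum_congr rfl fun j _ => ?_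
  rw [Real.coe_toNNReal _ (Real.exp_pos s).le, ← Real.exp_nat_mul, mul_comm s]

/-- `τ` as a real number. -/
noncomputable def tauR (w : ℕ → ℝ≥0) : ℝ≥0 := (tau w).toNNReal

/-- `φ(τ)` as a real number. -/
noncomputable def phiR (w : ℕ → ℝ≥0) : ℝ≥0 := (phi w (tau w)).toNNReal

/-- The offspring probabilities `π_k` as real numbers. -/
noncomputable def prob (w : ℕ → ℝ≥0) (k : ℕ) : ℝ≥0 := w k * tauR w ^ k / phiR w

section

variable (h0 : 0 < w 0) (h2 : ∃ k, 2 ≤ k ∧ 0 < w k)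
include h0 h2

theorem coe_tauR : (tauR w : ℝ≥0∞) = tau w := ENNReal.coe_toNNReal (tau_ne_top h0 h2)

theorem coe_phiR : (phiR w : ℝ≥0∞) = phi w (tau w) := ENNReal.coe_toNNReal (tau_spec h0 h2).1

theorem phiR_pos : 0 < phiR w := by
  have := phi_ne_zero h0 (tau w)
  rw [← coe_phiR h0 h2] at this
  exact pos_iff_ne_zero.2 (by exact_mod_cast this)

theorem coe_prob (k : ℕ) : (prob w k : ℝ≥0∞) = offspring w h0 h2 k := by
  change _ = (w k : ℝ≥0∞) * tau w ^ k / phi w (tau w)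
  rw [← coe_phiR h0 h2, ← coe_tauR h0 h2, prob, ENNReal.coe_div (phiR_pos h0 h2).ne']
  push_cast
  rfl

theorem prob_mul_phiR (k : ℕ) : prob w k * phiR w = w k * tauR w ^ k := by
  rw [prob, div_mul_cancel₀ _ (phiR_pos h0 h2).ne']

theorem prob_le_one (k : ℕ) : prob w k ≤ 1 := by
  have h := (offspring w h0 h2).coe_le_one k
  rw [← coe_prob h0 h2] at h
  exact_mod_cast h

/-- Upper bound for the exponential moment, by evaluation of the generating function at `τ`. -/
theorem coeff_mul_pow_le (k M n : ℕ) (l : List ℕ) (θ : ℝ≥0) (hM : l.length + M = n + 1) :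
    (coeff n (monomial l.sum (l.map w).prod *
        (C θ * monomial k (w k) + otherTerms w k) ^ M) : ℝ≥0) * (tauR w : ℝ) ^ n ≤
      (phiR w : ℝ) ^ (n + 1) * Real.exp (M * ((θ - 1) * prob w k)) := by
  have hC : evalHom (tau w) (C θ) = θ := by
    rw [← monomial_zero_eq_C_apply, evalHom_monomial, pow_zero, mul_one]
  have h1 := coeff_mul_pow_le_evalHom (tau w) (monomial l.sum (l.map w).prod *
        (C θ * monomial k (w k) + otherTerms w k) ^ M) n
  rw [map_mul (evalHom _), map_pow (evalHom _), map_add (evalHom _), map_mul (evalHom _),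
    evalHom_monomial, evalHom_monomial, hC] at h1
  have h3 : (w k : ℝ≥0∞) * tau w ^ k + evalHom (tau w) (otherTerms w k) = phi w (tau w) := by
    rw [← evalHom_monomial, ← map_add, monomial_add_otherTerms, evalHom_mk]
  rw [← coe_phiR h0 h2] at h3
  have hfin : evalHom (tau w) (otherTerms w k) ≠ ∞ := by
    intro h
    rw [h, add_top] at h3
    exact ENNReal.coe_ne_top h3.symm
  rw [← coe_tauR h0 h2] at h1 h3 hfin
  generalize evalHom (tauR w : ℝ≥0∞) (otherTerms w k) = β at *
  lift β to ℝ≥0 using hfin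
  norm_cast at h1 h3
  have hl : (l.map w).prod * tauR w ^ l.sum ≤ phiR w ^ l.length := by
    clear hM h1
    induction l with
    | nil => simp
    | cons j l ih =>
      simp only [List.sum_cons, List.map_cons, List.prod_cons, List.length_cons]
      have hj : w j * tauR w ^ j ≤ phiR w := by
        rw [← prob_mul_phiR h0 h2]
        exact mul_le_of_le_one_left zero_le (prob_le_one h0 h2 j)
      calc _ = (w j * tauR w ^ j) * ((l.map w).prod * tauR w ^ l.sum) := by ring
        _ ≤ phiR w * phiR w ^ l.length := mul_le_mul' hj ih
        _ = _ := by ring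
  have hexp : ((θ * (w k * tauR w ^ k) + β : ℝ≥0) : ℝ) ≤
      phiR w * Real.exp ((θ - 1) * prob w k) := by
    have h5 : ((θ * (w k * tauR w ^ k) + β : ℝ≥0) : ℝ) =
        phiR w * ((θ - 1) * prob w k + 1) := by
      have h6 := congrArg ((↑) : ℝ≥0 → ℝ) h3
      have h7 := congrArg ((↑) : ℝ≥0 → ℝ) (prob_mul_phiR h0 h2 k)
      push_cast at h6 h7 ⊢
      rw [← h7] at h6 ⊢
      linear_combination h6
    rw [h5]
    exact mul_le_mul_of_nonneg_left (Real.add_one_le_exp _) (NNReal.coe_nonneg _)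
  have h8 : (coeff n (monomial l.sum (l.map w).prod *
        (C θ * monomial k (w k) + otherTerms w k) ^ M) : ℝ≥0) * (tauR w : ℝ) ^ n ≤
      (((l.map w).prod * tauR w ^ l.sum : ℝ≥0) : ℝ) *
        ((θ * (w k * tauR w ^ k) + β : ℝ≥0) : ℝ) ^ M := by
    exact_mod_cast h1
  refine h8.trans ?_
  calc _ ≤ ((phiR w ^ l.length : ℝ≥0) : ℝ) * (phiR w * Real.exp ((θ - 1) * prob w k)) ^ M := by
        gcongr
    _ = _ := by rw [mul_pow, ← Real.exp_nat_mul, ← hM, pow_add]; push_cast; ring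

/-- The partition function is `φ(τ) ^ (n + 1) / τ ^ n` up to a subexponential factor. -/
theorem tau_mul_bound (hτ : 0 < tauR w) {s : ℝ} (hs : s ≠ 0) :
    ∃ K : ℝ, ∀ n, 0 < boxes w n (n + 1) →
      (phiR w : ℝ) ^ (n + 1) ≤ Real.exp (K + s ^ 2 * n) * (tauR w : ℝ) ^ n * boxes w n (n + 1) := by
  have hφ := phiR_pos h0 h2
  set x : ℝ≥0 := phiR w / tauR w * (Real.exp (-s ^ 2)).toNNReal with hx
  have he : (Real.exp (-s ^ 2)).toNNReal < 1 := by
    rw [Real.toNNReal_lt_one, Real.exp_lt_one_iff]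
    have : 0 < s ^ 2 := by positivity
    linarith
  have he0 : 0 < (Real.exp (-s ^ 2)).toNNReal := Real.toNNReal_pos.2 (Real.exp_pos _)
  have hxt : (x : ℝ≥0∞) * tau w < phi w (tau w) := by
    rw [← coe_phiR h0 h2, ← coe_tauR h0 h2]
    have : x * tauR w < phiR w := by
      have : x * tauR w = phiR w * (Real.exp (-s ^ 2)).toNNReal := by
        rw [hx]; field_simp
      rw [this]
      exact mul_lt_of_lt_one_right hφ he
    exact_mod_cast this
  obtain ⟨c, hc, hcn⟩ := exists_mul_pow_le_boxes h0 h2 (by positivity) hxt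
  refine ⟨Real.log (phiR w / c), fun n hn => ?_⟩
  have h1 : (c : ℝ) * (x : ℝ) ^ n ≤ boxes w n (n + 1) := by exact_mod_cast hcn n hn
  have hφ' : (0 : ℝ) < phiR w := hφ
  have hc' : (0 : ℝ) < c := hc
  have hτ' : (0 : ℝ) < tauR w := hτ
  have hxR : (x : ℝ) * tauR w = phiR w * Real.exp (-s ^ 2) := by
    rw [hx]
    push_cast
    rw [Real.coe_toNNReal _ (Real.exp_pos _).le]
    field_simp
  rw [Real.exp_add, Real.exp_log (by positivity)]
  calc (phiR w : ℝ) ^ (n + 1)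
      = phiR w / c * Real.exp (s ^ 2 * n) * (c * (phiR w * Real.exp (-s ^ 2)) ^ n) := by
        rw [mul_pow, ← Real.exp_nat_mul, show (n : ℝ) * -s ^ 2 = -(s ^ 2 * n) by ring, Real.exp_neg]
        field_simp
        ring
    _ = phiR w / c * Real.exp (s ^ 2 * n) * (tauR w : ℝ) ^ n * (c * (x : ℝ) ^ n) := by
        rw [← hxR, mul_pow]; ring
    _ ≤ _ := by gcongr

end

end WeightSeq

/-! ### Convergence of the law of the first boxes for `τ > 0` -/

namespace WeightSeq

open PowerSeries Finset Filter

variable {w : ℕ → ℝ≥0}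

theorem boxNum_cons (w : ℕ → ℝ≥0) (k : ℕ) (l : List ℕ) (n : ℕ) :
    boxNum w (k :: l) n = coeff n (monomial l.sum (l.map w).prod *
      (monomial k (w k) * mk w ^ (n - l.length))) := by
  rw [boxNum, List.sum_cons, List.map_cons, List.prod_cons, List.length_cons, ← mul_assoc,
    mul_comm (monomial l.sum _), monomial_mul_monomial, Nat.add_sub_add_right]

/-- The filter of those `n → ∞` for which there are plane trees with `n + 1` vertices and positive
weight. -/
def admissible (w : ℕ → ℝ≥0) : Filter ℕ := atTop ⊓ 𝓟 {n | 0 < boxes w n (n + 1)}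

theorem eventually_admissible {p : ℕ → Prop} (h : ∃ a, ∀ n, a ≤ n → 0 < boxes w n (n + 1) → p n) :
    ∀ᶠ n in admissible w, p n := by
  obtain ⟨a, ha⟩ := h
  rw [admissible, eventually_inf_principal]
  filter_upwards [eventually_ge_atTop a] with n hn hpos
  exact ha n hn hpos

section

variable (h0 : 0 < w 0) (h2 : ∃ k, 2 ≤ k ∧ 0 < w k)
include h0 h2

/-- The comparison of the lower and the upper bound for the exponential moment: with `r` the
conditional probability that the next box has content `k`, given the contents `l` of the first
boxes, `s * (r - π k)` is at most of order `s ^ 2`. -/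
theorem mul_boxLaw_div_sub_le (hτ : 0 < tauR w) {s : ℝ} (hs : s ≠ 0) (hs1 : |s| ≤ 1) (k : ℕ)
    (l : List ℕ) : ∃ K : ℝ, ∀ n, l.length ≤ n → 0 < boxes w n (n + 1) → 0 < boxLaw w l n →
      s * ((boxLaw w (k :: l) n : ℝ) / boxLaw w l n - prob w k) * ((n - l.length : ℕ) + 1) ≤
        K - Real.log (boxLaw w l n) + s ^ 2 * n + s ^ 2 * ((n - l.length : ℕ) + 1) := by
  obtain ⟨K, hK⟩ := tau_mul_bound h0 h2 hτ hs
  refine ⟨K, fun n hl hn hp => ?_⟩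
  set N := n - l.length with hN
  have hNl : n + 1 - l.length = N + 1 := by omega
  have hZ : (0 : ℝ) < boxes w n (n + 1) := hn
  have hnum : 0 < boxNum w l n := by
    rw [boxLaw] at hp
    by_contra h
    rw [not_lt, nonpos_iff_eq_zero] at h
    simp [h] at hp
  have h1 := mul_exp_le_coeff k N n s (monomial l.sum (l.map w).prod)
    (by rw [← hNl]; exact hnum)
  rw [hN, ← boxNum_cons w k, ← hN, ← hNl, ← boxNum, hNl] at h1
  have h3 := coeff_mul_pow_le h0 h2 k (N + 1) n l (Real.exp s).toNNReal (by omega)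
  have h4 := h3.trans (mul_le_mul_of_nonneg_right (hK n hn) (Real.exp_pos _).le)
  have ht : (0 : ℝ) < (tauR w : ℝ) ^ n := pow_pos hτ n
  have h5 := (mul_le_mul_of_nonneg_right h1 ht.le).trans h4
  have hr : (boxLaw w (k :: l) n : ℝ) / boxLaw w l n = boxNum w (k :: l) n / boxNum w l n := by
    rw [boxLaw, boxLaw]
    push_cast
    have : (0 : ℝ) < boxNum w l n := hnum
    field_simp
  have hpl : (boxNum w l n : ℝ) = boxLaw w l n * boxes w n (n + 1) := by
    rw [boxLaw]
    push_cast
    field_simp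
  set r := (boxLaw w (k :: l) n : ℝ) / boxLaw w l n with hrdef
  rw [mul_div_assoc, ← hr, hpl, Real.coe_toNNReal _ (Real.exp_pos _).le] at h5
  have hp' : (0 : ℝ) < boxLaw w l n := hp
  have h6 : (boxLaw w l n : ℝ) * Real.exp (s * ((N + 1) * r)) ≤
      Real.exp (K + s ^ 2 * n) * Real.exp ((N + 1 : ℕ) * ((Real.exp s - 1) * prob w k)) := by
    refine le_of_mul_le_mul_right ?_ (mul_pos ht hZ)
    calc _ = (boxLaw w l n : ℝ) * boxes w n (n + 1) * Real.exp (s * ((N + 1) * r)) *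
          (tauR w : ℝ) ^ n := by ring
      _ ≤ _ := h5
      _ = _ := by ring
  have h7 := Real.log_le_log (mul_pos hp' (Real.exp_pos _)) h6
  rw [← Real.exp_add, Real.log_exp, Real.log_mul hp'.ne' (Real.exp_pos _).ne', Real.log_exp] at h7
  have h8 : Real.exp s - 1 ≤ s + s ^ 2 := by
    have := (abs_le.1 (Real.abs_exp_sub_one_sub_id_le hs1)).2
    linarith
  have hπ0 : (0 : ℝ) ≤ prob w k := (prob w k).2
  have hπ1 : (prob w k : ℝ) ≤ 1 := prob_le_one h0 h2 k
  have h9 : (Real.exp s - 1) * prob w k ≤ s * prob w k + s ^ 2 := by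
    calc _ ≤ (s + s ^ 2) * prob w k := mul_le_mul_of_nonneg_right h8 hπ0
      _ ≤ _ := by nlinarith [sq_nonneg s]
  have h10 : ((N + 1 : ℕ) : ℝ) * ((Real.exp s - 1) * prob w k) ≤
      (N + 1) * (s * prob w k + s ^ 2) := by
    push_cast
    exact mul_le_mul_of_nonneg_left h9 (by positivity)
  nlinarith

/-- Given the contents of the first boxes, the content of the next box has approximately the
distribution `prob w`. The upper and the lower estimate follow from `mul_boxLaw_div_sub_le` with
small positive and negative `s`. -/
theorem tendsto_boxLaw_cons (hτ : 0 < tauR w) (k : ℕ) {l : List ℕ} {P : ℝ≥0} (hP : 0 < P)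
    (hl : Tendsto (boxLaw w l) (admissible w) (𝓝 P)) :
    Tendsto (boxLaw w (k :: l)) (admissible w) (𝓝 (prob w k * P)) := by
  have hP' : (0 : ℝ) < P := hP
  have hev : ∀ᶠ n in admissible w, P / 2 < boxLaw w l n :=
    hl.eventually_const_lt (half_lt_self hP)
  have hone : ∀ s : ℝ, s ≠ 0 → |s| ≤ 1 → ∀ᶠ n in admissible w,
      s * ((boxLaw w (k :: l) n : ℝ) / boxLaw w l n - prob w k) ≤ 4 * s ^ 2 := by
    intro s hs hs1
    obtain ⟨K, hK⟩ := mul_boxLaw_div_sub_le h0 h2 hτ hs hs1 k l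
    set K' := K - Real.log (P / 2) with hK'
    have hs2 : 0 < s ^ 2 := by positivity
    have hlarge : ∀ᶠ n in admissible w, 0 < boxes w n (n + 1) ∧ 2 * l.length ≤ n ∧
        K' / s ^ 2 ≤ (n - l.length : ℕ) := by
      obtain ⟨a, ha⟩ := exists_nat_ge (K' / s ^ 2)
      refine eventually_admissible ⟨a + 2 * l.length, fun n hn hpos => ⟨hpos, by omega, ?_⟩⟩
      exact ha.trans (by exact_mod_cast (by omega : a ≤ n - l.length))
    filter_upwards [hev, hlarge] with n hn ⟨hpos, h3, h4⟩
    have hp : 0 < boxLaw w l n := lt_of_le_of_lt zero_le hn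
    have h5 := hK n (by omega) hpos hp
    have h6 : Real.log (P / 2) ≤ Real.log (boxLaw w l n) := by
      refine Real.log_le_log (by positivity) ?_
      have := NNReal.coe_lt_coe.2 hn
      push_cast at this
      exact this.le
    have h7 : (n : ℝ) ≤ 2 * ((n - l.length : ℕ) : ℝ) := by
      exact_mod_cast (by omega : n ≤ 2 * (n - l.length))
    rw [div_le_iff₀ hs2] at h4
    have hM : (0 : ℝ) < (n - l.length : ℕ) + 1 := by positivity
    refine le_of_mul_le_mul_right ?_ hM
    nlinarith
  have hratio : Tendsto (fun n => (boxLaw w (k :: l) n : ℝ) / boxLaw w l n) (admissible w)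
      (𝓝 (prob w k)) := by
    rw [Metric.tendsto_nhds]
    intro ε hε
    set s := min 1 (ε / 8) with hs
    have hs0 : 0 < s := lt_min one_pos (by positivity)
    have hs1 : |s| ≤ 1 := by rw [abs_of_pos hs0]; exact min_le_left _ _
    have hs8 : s ≤ ε / 8 := min_le_right _ _
    filter_upwards [hone s hs0.ne' hs1, hone (-s) (neg_ne_zero.2 hs0.ne') (by rwa [abs_neg])]
      with n h3 h4
    have h5 : (boxLaw w (k :: l) n : ℝ) / boxLaw w l n - prob w k ≤ 4 * s :=
      le_of_mul_le_mul_left (by nlinarith) hs0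
    have h6 : -(4 * s) ≤ (boxLaw w (k :: l) n : ℝ) / boxLaw w l n - prob w k :=
      le_of_mul_le_mul_left (by nlinarith) hs0
    rw [Real.dist_eq]
    exact lt_of_le_of_lt (abs_le.2 ⟨h6, h5⟩) (by linarith)
  rw [← NNReal.tendsto_coe]
  push_cast
  refine (hratio.mul (NNReal.tendsto_coe.2 hl)).congr' ?_
  filter_upwards [hev] with n hn
  have hp : (boxLaw w l n : ℝ) ≠ 0 := by
    have : 0 < boxLaw w l n := lt_of_le_of_lt zero_le hn
    exact_mod_cast this.ne'
  exact div_mul_cancel₀ _ hp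

end

end WeightSeq

/-! ### Radius of convergence zero, and convergence in general -/

namespace WeightSeq

open PowerSeries Finset Filter

variable {w : ℕ → ℝ≥0}

theorem tPhiDeriv_zero (w : ℕ → ℝ≥0) : tPhiDeriv w 0 = 0 := by
  rw [tPhiDeriv, ENNReal.tsum_eq_zero]
  intro k
  rcases eq_or_ne k 0 with rfl | hk <;> simp [*]

/-- If the radius of convergence is zero, then the coefficients exceed any geometric sequence at
arbitrarily large indices. -/
theorem exists_pow_le_of_radius_eq_zero (h : radius w = 0) (c : ℝ≥0) (a : ℕ) :
    ∃ E, a ≤ E ∧ c ^ E ≤ w E := by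
  by_contra! hcon
  set r : ℝ≥0 := 1 / (2 * (c + 1)) with hr
  have hr0 : 0 < r := by positivity
  have hsum : Summable fun k : ℕ => w k * r ^ k := by
    rw [← NNReal.summable_nat_add_iff a]
    refine NNReal.summable_of_le (f := fun k => (1 / 2 : ℝ≥0) ^ k) (fun k => ?_)
      (NNReal.summable_geometric (by norm_num))
    calc w (k + a) * r ^ (k + a) ≤ c ^ (k + a) * r ^ (k + a) := by
          gcongr; exact (hcon _ (by omega)).le
      _ = (c * r) ^ (k + a) := (mul_pow _ _ _).symm
      _ ≤ (1 / 2) ^ (k + a) := by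
          gcongr
          rw [hr, mul_one_div, div_le_div_iff₀ (by positivity) (by positivity), one_mul, mul_comm]
          gcongr
          exact le_self_add
      _ ≤ (1 / 2) ^ k := pow_le_pow_of_le_one zero_le (by norm_num) (by omega)
  have := radius_ge_of_summable hsum
  rw [h, nonpos_iff_eq_zero, ENNReal.coe_eq_zero] at this
  exact hr0.ne' this

/-- If `φ` has radius of convergence zero, then large boxes have so much weight that `E` boxes of
content `k`, even with an additional factor `θ` for each, weigh less than `k` boxes of content `E`
and `E - k` empty boxes. -/
theorem exists_monomial_pow_coeffLE (h0 : 0 < w 0) (h : radius w = 0) {k : ℕ} (hk : k ≠ 0)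
    (θ : ℝ≥0) : ∃ E, E ≠ 0 ∧ CoeffLE ((C θ * monomial k (w k)) ^ E) (mk w ^ E) := by
  set c₀ := min 1 (w 0) with hc₀
  have hc0 : 0 < c₀ := lt_min one_pos h0
  set c := max 1 (θ * w k / c₀) with hc
  obtain ⟨E, hkE, hE⟩ := exists_pow_le_of_radius_eq_zero h c k
  refine ⟨E, by omega, ?_⟩
  have h1 : (C θ * monomial k (w k) : ℝ≥0⟦X⟧) ^ E = monomial (E * k) ((θ * w k) ^ E) := by
    rw [← monomial_zero_eq_C_apply, monomial_mul_monomial, monomial_pow, zero_add]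
  have h2 : CoeffLE (monomial (E * k) (w E ^ k * w 0 ^ (E - k))) (mk w ^ E) := by
    have h3 : (monomial (E * k) (w E ^ k * w 0 ^ (E - k)) : ℝ≥0⟦X⟧) =
        monomial E (w E) ^ k * monomial 0 (w 0) ^ (E - k) := by
      rw [monomial_pow, monomial_pow, monomial_mul_monomial, mul_zero, add_zero, mul_comm E k]
    rw [h3, show (mk w : ℝ≥0⟦X⟧) ^ E = mk w ^ k * mk w ^ (E - k) by rw [← pow_add]; congr 1; omega]
    exact ((coeffLE_monomial w E).pow k).mul ((coeffLE_monomial w 0).pow (E - k))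
  rw [h1]
  refine CoeffLE.trans (fun m => ?_) h2
  rw [coeff_monomial, coeff_monomial]
  split_ifs
  · calc (θ * w k) ^ E ≤ (c * c₀) ^ E := by
          refine pow_le_pow_left₀ zero_le ?_ E
          rw [← div_le_iff₀ hc0]
          exact le_max_right _ _
      _ = c ^ E * c₀ ^ E := mul_pow _ _ _
      _ ≤ w E ^ k * w 0 ^ (E - k) := by
          refine mul_le_mul' (hE.trans ?_) ?_
          · have h1E : 1 ≤ w E := (one_le_pow₀ (le_max_left _ _)).trans hE
            exact le_self_pow₀ h1E hk
          · calc c₀ ^ E ≤ c₀ ^ (E - k) :=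
                  pow_le_pow_of_le_one zero_le (min_le_left _ _) (by omega)
              _ ≤ _ := by gcongr; exact min_le_right _ _
  · exact le_rfl

theorem coeffLE_otherTerms (w : ℕ → ℝ≥0) (k : ℕ) : CoeffLE (otherTerms w k) (mk w) := fun m => by
  rw [otherTerms, coeff_mk, coeff_mk, Function.update_apply]
  split_ifs <;> simp

/-- If the radius of convergence is zero, then a reward `θ`, however large, for each box of content
`k ≠ 0` increases the partition function at most by a factor of order `2 ^ n`. -/
theorem exists_coeff_le_two_pow (h0 : 0 < w 0) (h : radius w = 0) {k : ℕ} (hk : k ≠ 0)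
    {θ : ℝ≥0} (hθ : 1 ≤ θ) : ∃ K : ℝ≥0, 0 < K ∧ ∀ m n,
      coeff m ((C θ * monomial k (w k) + otherTerms w k) ^ n) ≤ K * 2 ^ n * boxes w m n := by
  obtain ⟨E, hE0, hE⟩ := exists_monomial_pow_coeffLE h0 h hk θ
  refine ⟨θ ^ E, by positivity, fun m n => ?_⟩
  set a : ℝ≥0⟦X⟧ := C θ * monomial k (w k) with ha
  have h1 : CoeffLE a (C θ * mk w) := (CoeffLE.refl _).mul (coeffLE_monomial w k)
  have h3 : ∀ j, CoeffLE (a ^ j) (C (θ ^ E) * mk w ^ j) := by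
    intro j
    have h4 : a ^ j = (a ^ E) ^ (j / E) * a ^ (j % E) := by
      rw [← pow_mul, ← pow_add, Nat.div_add_mod]
    have h5 : CoeffLE (a ^ (j % E)) (C (θ ^ E) * mk w ^ (j % E)) := by
      refine (h1.pow (j % E)).trans ?_
      rw [mul_pow, ← map_pow]
      intro i
      rw [coeff_C_mul, coeff_C_mul]
      gcongr
      exact (Nat.mod_lt _ (Nat.pos_of_ne_zero hE0)).le
    rw [h4]
    refine ((hE.pow _).mul h5).trans ?_
    rw [mul_left_comm, ← pow_mul, ← pow_add, Nat.div_add_mod]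
    exact CoeffLE.refl _
  have h6 : CoeffLE ((a + otherTerms w k) ^ n) (C (θ ^ E) * (mk w + mk w) ^ n) := by
    rw [add_pow, add_pow, Finset.mul_sum]
    refine CoeffLE.sum fun j _ => ?_
    rw [← mul_assoc, ← mul_assoc]
    exact ((h3 j).mul ((coeffLE_otherTerms w k).pow _)).mul (CoeffLE.refl _)
  refine (h6 m).trans_eq ?_
  rw [coeff_C_mul, ← two_mul, mul_pow, boxes, mul_assoc]
  congr 1
  have : (2 : ℝ≥0⟦X⟧) ^ n = C (2 ^ n) := by rw [map_pow, map_ofNat]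
  rw [this, coeff_C_mul]

theorem tendsto_boxLaw_singleton_zero (h0 : 0 < w 0) (h : radius w = 0) {k : ℕ} (hk : k ≠ 0) :
    Tendsto (boxLaw w [k]) (admissible w) (𝓝 0) := by
  rw [← NNReal.tendsto_coe, Metric.tendsto_nhds]
  intro ε hε
  set s : ℝ := 2 / ε with hs
  have hs0 : 0 < s := by positivity
  obtain ⟨K, hK0, hK⟩ := exists_coeff_le_two_pow h0 h hk (θ := (Real.exp s).toNNReal)
    (by rw [Real.one_le_toNNReal]; exact Real.one_le_exp hs0.le)
  obtain ⟨a, ha⟩ := exists_nat_ge (Real.log K)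
  refine eventually_admissible ⟨a, fun n hn hpos => ?_⟩
  have hZ : (0 : ℝ) < boxes w n (n + 1) := hpos
  have h1 := mul_exp_le_coeff k n n s 1 (by simpa [boxes] using hpos)
  simp only [one_mul] at h1
  have e1 : coeff n (monomial k (w k) * mk w ^ n) = boxNum w [k] n := by
    rw [boxNum_cons]; simp
  rw [← boxes, e1] at h1
  have h2 : ((coeff n ((C (Real.exp s).toNNReal * monomial k (w k) + otherTerms w k) ^ (n + 1)) :
      ℝ≥0) : ℝ) ≤ K * 2 ^ (n + 1) * boxes w n (n + 1) := by exact_mod_cast hK n (n + 1)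
  have h3 := h1.trans h2
  rw [mul_comm, mul_le_mul_iff_left₀ hZ] at h3
  have h4 := Real.log_le_log (Real.exp_pos _) h3
  have hK0' : (0 : ℝ) < K := hK0
  rw [Real.log_exp, Real.log_mul hK0'.ne' (by positivity), Real.log_pow, mul_div_assoc] at h4
  have e2 : (boxNum w [k] n : ℝ) / boxes w n (n + 1) = boxLaw w [k] n := by
    rw [boxLaw]; push_cast; rfl
  rw [e2] at h4
  have h5 : Real.log 2 < 1 := by
    have := Real.log_two_lt_d9; linarith
  have h6 : Real.log K ≤ n := ha.trans (by exact_mod_cast hn)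
  have hn0 : (0 : ℝ) < n + 1 := by positivity
  have h7 : s * boxLaw w [k] n < 2 := by
    refine lt_of_mul_lt_mul_right ?_ hn0.le
    push_cast at h4
    nlinarith
  have hp : (0 : ℝ) ≤ boxLaw w [k] n := (boxLaw w [k] n).2
  rw [Real.dist_eq, NNReal.coe_zero, sub_zero, abs_of_nonneg hp]
  rw [hs, div_mul_eq_mul_div, div_lt_iff₀ hε] at h7
  linarith

/-- If the content of a single box tends to zero in probability, then all boxes among the first
few are empty with high probability. Large contents are excluded by the mean. -/
theorem tendsto_boxLaw_zero_cons (h : ∀ k, k ≠ 0 → Tendsto (boxLaw w [k]) (admissible w) (𝓝 0))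
    {l : List ℕ} {P : ℝ≥0} (hl : Tendsto (boxLaw w l) (admissible w) (𝓝 P)) :
    Tendsto (boxLaw w (0 :: l)) (admissible w) (𝓝 P) := by
  have hsum : Tendsto (fun n => ∑ j ∈ Ico 1 (n + 1), boxLaw w [j] n) (admissible w) (𝓝 0) := by
    rw [← NNReal.bot_eq_zero, tendsto_order]
    refine ⟨fun a ha => absurd ha not_lt_bot, fun ε hε => ?_⟩
    rw [NNReal.bot_eq_zero] at hε
    obtain ⟨L, hL⟩ := exists_nat_gt (2 / ε)
    have hL0 : (0 : ℝ≥0) < L := lt_of_le_of_lt zero_le hL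
    have h1 : Tendsto (fun n => ∑ j ∈ Ico 1 L, boxLaw w [j] n) (admissible w) (𝓝 0) := by
      have := tendsto_finsetSum (f := fun j n => boxLaw w [j] n) (x := admissible w)
        (a := fun _ => 0) (Ico 1 L) fun j hj => h j (by have := Finset.mem_Ico.1 hj; omega)
      simpa using this
    filter_upwards [h1.eventually_lt_const (half_pos hε),
      eventually_admissible (w := w) (p := fun n => 0 < boxes w n (n + 1)) ⟨0, fun _ _ h => h⟩]
      with n hn hpos
    have hmean : ∑ j ∈ range (n + 1), (j : ℝ≥0) * boxLaw w [j] n ≤ 1 := by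
      rw [sum_mul_boxLaw_cons w (Nat.zero_le n), boxLaw_nil w hpos, mul_one]
      simp only [List.sum_nil, List.length_nil, Nat.sub_zero]
      exact div_le_one_of_le₀ le_self_add zero_le
    have h3 : ∑ j ∈ Ico 1 (n + 1), boxLaw w [j] n ≤
        ∑ j ∈ Ico 1 L, boxLaw w [j] n +
          ∑ j ∈ range (n + 1), (j : ℝ≥0) * boxLaw w [j] n / L := by
      calc ∑ j ∈ Ico 1 (n + 1), boxLaw w [j] n
          ≤ ∑ j ∈ Ico 1 L ∪ (range (n + 1)).filter (L ≤ ·), boxLaw w [j] n := by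
            refine Finset.sum_le_sum_of_subset fun j hj => ?_
            simp only [Finset.mem_Ico, Finset.mem_union, Finset.mem_filter,
              Finset.mem_range] at hj ⊢
            omega
        _ ≤ ∑ j ∈ Ico 1 L, boxLaw w [j] n +
            ∑ j ∈ (range (n + 1)).filter (L ≤ ·), boxLaw w [j] n := by
            rw [← Finset.sum_union_inter]; exact le_self_add
        _ ≤ _ := by
            refine add_le_add le_rfl ?_
            refine le_trans (Finset.sum_le_sum (g := fun j : ℕ => (j : ℝ≥0) * boxLaw w [j] n / L)
              fun j hj => ?_) (Finset.sum_le_sum_of_subset (Finset.filter_subset _ _))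
            rw [le_div_iff₀ hL0, mul_comm]
            gcongr
            exact (Finset.mem_filter.1 hj).2
    rw [← Finset.sum_div] at h3
    have h4 : (∑ j ∈ range (n + 1), (j : ℝ≥0) * boxLaw w [j] n) / L < ε / 2 := by
      refine lt_of_le_of_lt (div_le_div_of_nonneg_right hmean zero_le) ?_
      rw [div_lt_iff₀ hL0]
      rw [div_lt_iff₀ hε] at hL
      calc (1 : ℝ≥0) = 2 / 2 := by simp
        _ < L * ε / 2 := by gcongr
        _ = _ := by ring
    calc _ ≤ _ := h3
      _ < ε / 2 + ε / 2 := add_lt_add hn h4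
      _ = ε := add_halves ε
  have hlow : Tendsto (fun n => boxLaw w l n - ∑ j ∈ Ico 1 (n + 1), boxLaw w [j] n)
      (admissible w) (𝓝 P) := by
    simpa using hl.sub hsum
  have hev : ∀ᶠ n in admissible w, boxLaw w (0 :: l) n ≤ boxLaw w l n ∧
      boxLaw w l n - ∑ j ∈ Ico 1 (n + 1), boxLaw w [j] n ≤ boxLaw w (0 :: l) n := by
    refine eventually_admissible ⟨l.length, fun n hn _ => ?_⟩
    have h1 := sum_boxLaw_cons w hn
    rw [Finset.range_eq_Ico, Finset.sum_eq_sum_Ico_succ_bot (by omega), zero_add] at h1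
    rw [← h1]
    refine ⟨le_self_add, ?_⟩
    rw [tsub_le_iff_right]
    gcongr with j hj
    exact boxLaw_le_of_mem w (by simp) (by simpa using hn)
  exact tendsto_of_tendsto_of_tendsto_of_le_of_le' hlow hl (hev.mono fun n hn => hn.2)
    (hev.mono fun n hn => hn.1)

/-- The contents of the first boxes are asymptotically independent with distribution `prob w`. -/
theorem tendsto_boxLaw (h0 : 0 < w 0) (h2 : ∃ k, 2 ≤ k ∧ 0 < w k) (l : List ℕ) :
    Tendsto (boxLaw w l) (admissible w) (𝓝 (l.map (prob w)).prod) := by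
  have hev0 : ∀ᶠ n in admissible w, 0 < boxes w n (n + 1) :=
    eventually_admissible ⟨0, fun _ _ h => h⟩
  induction l with
  | nil =>
    refine (tendsto_const_nhds (x := (1 : ℝ≥0))).congr' ?_
    filter_upwards [hev0] with n hn
    rw [boxLaw_nil w hn]
  | cons k l ih =>
    rw [List.map_cons, List.prod_cons]
    rcases eq_or_ne (tauR w) 0 with hτ | hτ
    · have hτ' : tau w = 0 := by rw [← coe_tauR h0 h2, hτ, ENNReal.coe_zero]
      have hrad : radius w = 0 := by
        rw [← tau_eq_radius_of_tPhiDeriv_lt h0, hτ']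
        rw [hτ', tPhiDeriv_zero]
        exact pos_iff_ne_zero.2 (phi_ne_zero h0 0)
      have hsing := fun k (hk : k ≠ 0) => tendsto_boxLaw_singleton_zero h0 hrad hk
      have hphi : phiR w = w 0 := by
        rw [phiR, hτ', phi, tsum_eq_single 0]
        · simp
        · intro k hk; simp [hk]
      rcases eq_or_ne k 0 with rfl | hk
      · have : prob w 0 = 1 := by rw [prob, hphi, pow_zero, mul_one, div_self h0.ne']
        rw [this, one_mul]
        exact tendsto_boxLaw_zero_cons hsing ih
      · have : prob w k = 0 := by rw [prob, hτ, zero_pow hk, mul_zero, zero_div]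
        rw [this, zero_mul]
        refine tendsto_of_tendsto_of_tendsto_of_le_of_le' tendsto_const_nhds (hsing k hk)
          (Eventually.of_forall fun _ => zero_le) ?_
        refine eventually_admissible ⟨l.length, fun n hn _ => ?_⟩
        exact boxLaw_le_of_mem w (by simp) (by simpa using hn)
    · rcases eq_or_ne ((l.map (prob w)).prod) 0 with hP | hP
      · -- Some weight vanishes, and then the probability is zero for every `n`.
        have hw : ((k :: l).map w).prod = 0 := by
          rw [List.prod_eq_zero_iff, List.mem_map] at hP
          obtain ⟨j, hj, hj0⟩ := hP
          rw [List.prod_eq_zero_iff, List.mem_map]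
          refine ⟨j, List.mem_cons_of_mem _ hj, ?_⟩
          have := prob_mul_phiR h0 h2 j
          rw [hj0, zero_mul, eq_comm, mul_eq_zero] at this
          exact this.resolve_right (pow_ne_zero _ hτ)
        rw [hP, mul_zero]
        refine tendsto_const_nhds.congr fun n => ?_
        rw [boxLaw, boxNum_eq, hw]
        simp
      · exact tendsto_boxLaw_cons h0 h2 (pos_iff_ne_zero.2 hτ) k (pos_iff_ne_zero.2 hP) ih

end WeightSeq

/-! ### Finite plane trees that extend a pattern -/

namespace PlaneTree

open WeightSeq Finset

theorem nil_mem_verts (T : PlaneTree) : [] ∈ T.verts := trivial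

theorem cons_mem_verts {T : PlaneTree} {i : ℕ} {v : UHVertex} :
    i :: v ∈ T.verts ↔ v ∈ T.verts ∧ (i : ℕ∞) < T.deg v := Iff.rfl

theorem deg_eq_zero_of_notMem {T : PlaneTree} {v : UHVertex} (h : v ∉ T.verts) : T.deg v = 0 := by
  induction v with
  | nil => exact absurd T.nil_mem_verts h
  | cons i u ih =>
    refine T.2 u i (not_lt.1 fun hi => ?_)
    by_cases hu : u ∈ T.verts
    · exact h (cons_mem_verts.2 ⟨hu, hi⟩)
    · exact absurd hi (by simp [deg] at ih; simp [ih hu])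

theorem ext_deg {T T' : PlaneTree} (h : ∀ v, T.deg v = T'.deg v) : T = T' :=
  Subtype.ext (funext h)

theorem deg_ne_top_of_finite {T : PlaneTree} (h : T.verts.Finite) (v : UHVertex) :
    T.deg v ≠ ⊤ := by
  intro htop
  by_cases hv : v ∈ T.verts
  · refine Set.infinite_of_injective_forall_mem (f := fun i : ℕ => i :: v)
      (fun i j hij => (List.cons.inj hij).1) (fun i => ?_) h
    exact cons_mem_verts.2 ⟨hv, by rw [htop]; exact ENat.natCast_lt_top i⟩
  · rw [deg_eq_zero_of_notMem hv] at htop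
    exact absurd htop (by simp)

theorem finite_of_mem_ofSize {T : PlaneTree} {n : ℕ} (h : T ∈ ofSize n) : T.verts.Finite :=
  Set.finite_of_encard_eq_coe h

/-- The root, and the first `d v` children of each vertex `v` in `G`. -/
def hull (G : Finset UHVertex) (d : UHVertex → ℕ) : Finset UHVertex :=
  insert [] (G.biUnion fun v => (range (d v)).image (· :: v))

/-- A pattern: a finite set `G` of vertices with prescribed outdegrees `d` such that each vertex of
`G` is the root or a child of a vertex of `G`. -/
def IsPattern (G : Finset UHVertex) (d : UHVertex → ℕ) : Prop := G ⊆ hull G d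

/-- The plane trees in which the vertices of `G` have outdegrees `d`. -/
def extending (G : Finset UHVertex) (d : UHVertex → ℕ) : Set PlaneTree :=
  {T | ∀ v ∈ G, T.deg v = d v}

variable {G : Finset UHVertex} {d : UHVertex → ℕ}

theorem nil_mem_hull : [] ∈ hull G d := Finset.mem_insert_self _ _

theorem cons_mem_hull {i : ℕ} {v : UHVertex} : i :: v ∈ hull G d ↔ v ∈ G ∧ i < d v := by
  simp only [hull, Finset.mem_insert, Finset.mem_biUnion, Finset.mem_image, Finset.mem_range]
  constructor
  · rintro (h | ⟨u, hu, j, hj, h⟩)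
    · exact absurd h (by simp)
    · obtain ⟨rfl, rfl⟩ := List.cons.inj h
      exact ⟨hu, hj⟩
  · rintro ⟨h1, h2⟩
    exact Or.inr ⟨v, h1, i, h2, rfl⟩

theorem card_hull : (hull G d).card = 1 + ∑ v ∈ G, d v := by
  rw [hull, Finset.card_insert_of_notMem, Finset.card_biUnion, add_comm]
  · congr 1
    refine Finset.sum_congr rfl fun v _ => ?_
    rw [Finset.card_image_of_injective _ fun i j hij => (List.cons.inj hij).1, Finset.card_range]
  · intro u _ v _ huv
    rw [Function.onFun, Finset.disjoint_left]
    intro x hx hx'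
    obtain ⟨i, _, rfl⟩ := Finset.mem_image.1 hx
    obtain ⟨j, _, h⟩ := Finset.mem_image.1 hx'
    exact huv (List.cons.inj h).2.symm
  · simp

theorem card_boundary (h : IsPattern G d) :
    (hull G d \ G).card + G.card = 1 + ∑ v ∈ G, d v := by
  rw [Finset.card_sdiff_add_card_eq_card h, card_hull]

theorem IsPattern.hull_subset_verts_of_le (h : IsPattern G d) {T : PlaneTree}
    (hT : ∀ v ∈ G, (d v : ℕ∞) ≤ T.deg v) : (hull G d : Set UHVertex) ⊆ T.verts := by
  intro v hv
  rw [Finset.mem_coe] at hv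
  induction v with
  | nil => exact T.nil_mem_verts
  | cons i u ih =>
    obtain ⟨hu, hi⟩ := cons_mem_hull.1 hv
    exact cons_mem_verts.2 ⟨ih (h hu), lt_of_lt_of_le (by exact_mod_cast hi) (hT u hu)⟩

theorem IsPattern.hull_subset_verts (h : IsPattern G d) {T : PlaneTree} (hT : T ∈ extending G d) :
    (hull G d : Set UHVertex) ⊆ T.verts :=
  h.hull_subset_verts_of_le fun v hv => (hT v hv).ge

theorem IsPattern.mem_verts (h : IsPattern G d) {T : PlaneTree} (hT : T ∈ extending G d)
    {v : UHVertex} (hv : v ∈ G) : v ∈ T.verts :=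
  h.hull_subset_verts hT (Finset.mem_coe.2 (h hv))

/-- Adding a vertex of the boundary, with an arbitrary outdegree, to a pattern. -/
theorem IsPattern.insert (h : IsPattern G d) {v : UHVertex} (hv : v ∈ hull G d \ G) (k : ℕ) :
    IsPattern (insert v G) (Function.update d v k) := by
  obtain ⟨hv1, hv2⟩ := Finset.mem_sdiff.1 hv
  have key : ∀ u, u ∈ hull G d → u ∈ hull (Insert.insert v G) (Function.update d v k) := by
    intro u hu
    rcases u with _ | ⟨i, u⟩
    · exact nil_mem_hull
    · obtain ⟨h1, h2⟩ := cons_mem_hull.1 hu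
      refine cons_mem_hull.2 ⟨Finset.mem_insert_of_mem h1, ?_⟩
      rwa [Function.update_of_ne (fun e => hv2 (by rwa [e] at h1))]
  intro u hu
  rcases Finset.mem_insert.1 hu with rfl | hu
  · exact key _ hv1
  · exact key _ (h hu)

theorem card_boundary_insert (h : IsPattern G d) {v : UHVertex} (hv : v ∈ hull G d \ G) (k : ℕ) :
    (hull (insert v G) (Function.update d v k) \ insert v G).card + 1 =
      (hull G d \ G).card + k := by
  have h1 := card_boundary (h.insert hv k)
  have h2 := card_boundary h
  have hv2 := (Finset.mem_sdiff.1 hv).2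
  rw [Finset.card_insert_of_notMem hv2, Finset.sum_insert hv2, Function.update_self,
    Finset.sum_congr rfl fun u hu => Function.update_of_ne (fun e => hv2 (by rwa [e] at hu)) k d]
    at h1
  omega

theorem extending_insert {v : UHVertex} (hv : v ∉ G) (k : ℕ) :
    extending (insert v G) (Function.update d v k) = {T | T ∈ extending G d ∧ T.deg v = k} := by
  ext T
  simp only [extending, Set.mem_ofPred_eq, Finset.forall_mem_insert, Function.update_self]
  rw [and_comm]
  refine and_congr_left fun _ => forall₂_congr fun u hu => ?_
  rw [Function.update_of_ne (fun e => hv (by rwa [e] at hu))]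

open Classical in
/-- The total weight of the plane trees with `n` vertices in the set `E`. -/
noncomputable def totalWeight (w : ℕ → ℝ≥0) (n : ℕ) (E : Set PlaneTree) : ℝ≥0∞ :=
  ∑' T : PlaneTree, if T ∈ E ∧ T ∈ ofSize n then (weight w T : ℝ≥0∞) else 0

theorem totalWeight_eq_tsum (w : ℕ → ℝ≥0) (n : ℕ) (E : Set PlaneTree) {v : UHVertex} :
    totalWeight w n E = ∑' k : ℕ, totalWeight w n {T | T ∈ E ∧ T.deg v = k} := by
  simp only [totalWeight]
  rw [ENNReal.tsum_comm]
  refine tsum_congr fun T => ?_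
  by_cases h : T ∈ E ∧ T ∈ ofSize n
  · have htop := deg_ne_top_of_finite (finite_of_mem_ofSize h.2) v
    obtain ⟨m, hm⟩ := ENat.ne_top_iff_exists.1 htop
    rw [if_pos h, tsum_eq_single m]
    · rw [if_pos ⟨⟨h.1, hm.symm⟩, h.2⟩]
    · intro k hk
      rw [if_neg]
      rintro ⟨⟨_, h2⟩, _⟩
      rw [← hm] at h2
      exact hk (by exact_mod_cast h2.symm)
  · rw [if_neg h]
    symm
    rw [ENNReal.tsum_eq_zero]
    intro k
    rw [if_neg]
    rintro ⟨⟨h1, _⟩, h2⟩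
    exact h ⟨h1, h2⟩

theorem IsPattern.verts_eq (h : IsPattern G d) (hb : hull G d \ G = ∅) {T : PlaneTree}
    (hT : T ∈ extending G d) : T.verts = G := by
  have hsub : hull G d ⊆ G := Finset.sdiff_eq_empty_iff_subset.1 hb
  refine Set.Subset.antisymm (fun v hv => ?_) fun v hv => h.mem_verts hT hv
  induction v with
  | nil => exact hsub nil_mem_hull
  | cons i u ih =>
    obtain ⟨h1, h2⟩ := cons_mem_verts.1 hv
    refine hsub (cons_mem_hull.2 ⟨ih h1, ?_⟩)
    rw [hT u (ih h1)] at h2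
    exact_mod_cast h2

open Classical in
/-- A pattern without boundary determines a finite tree. -/
theorem IsPattern.extending_eq_singleton (h : IsPattern G d) (hb : hull G d \ G = ∅) :
    ∃ T, extending G d = {T} := by
  refine ⟨⟨fun v => if v ∈ G then (d v : ℕ∞) else 0, fun v i hi => ?_⟩, ?_⟩
  · beta_reduce at hi ⊢
    rw [if_neg]
    intro hmem
    obtain ⟨h1, h2⟩ := cons_mem_hull.1 (h hmem)
    rw [if_pos h1] at hi
    exact absurd (by exact_mod_cast hi : d v ≤ i) (not_le.2 h2)
  · refine Set.eq_singleton_iff_unique_mem.2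
      ⟨fun v hv => if_pos hv, fun T hT => ext_deg fun v => ?_⟩
    by_cases hv : v ∈ G
    · rw [hT v hv]
      exact (if_pos hv).symm
    · rw [deg_eq_zero_of_notMem (by rw [h.verts_eq hb hT]; exact hv)]
      exact (if_neg hv).symm

/-- Exposing the vertices of a plane tree one after the other shows that the vertices outside of a
pattern form a forest, with one tree for each vertex of the boundary. -/
theorem totalWeight_extending (w : ℕ → ℝ≥0) (h : IsPattern G d) (N : ℕ) :
    totalWeight w (G.card + N) (extending G d) =
      ((∏ v ∈ G, w (d v)) * forest w (hull G d \ G).card N : ℝ≥0) := by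
  induction N generalizing G d with
  | zero =>
    rcases Finset.eq_empty_or_nonempty (hull G d \ G) with hb | hb
    · obtain ⟨T, hT⟩ := h.extending_eq_singleton hb
      have hTmem : T ∈ extending G d := by rw [hT]; exact Set.mem_singleton T
      have hv := h.verts_eq hb hTmem
      have hsize : T ∈ ofSize (G.card + 0) := by
        rw [ofSize, Set.mem_ofPred_eq, hv, Set.encard_coe_eq_coe_finsetCard, add_zero]
      rw [totalWeight, tsum_eq_single T, if_pos ⟨hTmem, hsize⟩, hb, Finset.card_empty,
        forest_zero_left, if_pos rfl, mul_one, weight, hv, finprod_mem_coe_finset]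
      · congr 1
        refine Finset.prod_congr rfl fun v hv => ?_
        rw [hTmem v hv, ENat.toNat_natCast]
      · intro T' hne
        rw [if_neg]
        rintro ⟨h1, _⟩
        rw [hT] at h1
        exact hne h1
    · rw [forest_eq_zero w (Finset.card_pos.2 hb), mul_zero, ENNReal.coe_zero, totalWeight,
        ENNReal.tsum_eq_zero]
      intro T
      rw [if_neg]
      rintro ⟨h1, h2⟩
      have h3 := Set.encard_le_encard (h.hull_subset_verts h1)
      rw [h2, Set.encard_coe_eq_coe_finsetCard] at h3
      have h4 := Finset.card_sdiff_add_card_eq_card h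
      have h5 := Finset.card_pos.2 hb
      have h6 : (hull G d).card ≤ G.card + 0 := by exact_mod_cast h3
      omega
  | succ N ih =>
    rcases Finset.eq_empty_or_nonempty (hull G d \ G) with hb | ⟨v, hv⟩
    · rw [hb, Finset.card_empty, forest_zero_left, if_neg (Nat.succ_ne_zero N), mul_zero,
        ENNReal.coe_zero, totalWeight, ENNReal.tsum_eq_zero]
      intro T
      rw [if_neg]
      rintro ⟨h1, h2⟩
      rw [ofSize, Set.mem_ofPred_eq, h.verts_eq hb h1, Set.encard_coe_eq_coe_finsetCard] at h2
      have h3 : G.card = G.card + (N + 1) := by exact_mod_cast h2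
      omega
    · have hvG := (Finset.mem_sdiff.1 hv).2
      obtain ⟨q, hq⟩ := Nat.exists_eq_add_of_lt (Finset.card_pos.2 ⟨v, hv⟩)
      rw [zero_add] at hq
      have hterm : ∀ k : ℕ, totalWeight w (G.card + (N + 1))
          {T | T ∈ extending G d ∧ T.deg v = k} =
          (((∏ v ∈ G, w (d v)) * (w k * forest w (q + k) N) : ℝ≥0) : ℝ≥0∞) := by
        intro k
        have h1 := ih (h.insert hv k)
        have h2 := card_boundary_insert h hv k
        rw [show (hull (insert v G) (Function.update d v k) \ insert v G).card = q + k by omega,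
          extending_insert hvG, Finset.card_insert_of_notMem hvG, Finset.prod_insert hvG,
          Function.update_self,
          Finset.prod_congr rfl fun u hu => by
            rw [Function.update_of_ne (fun e => hvG (by rwa [e] at hu))]] at h1
        rw [show G.card + (N + 1) = G.card + 1 + N by ring, h1]
        congr 1
        ring
      rw [totalWeight_eq_tsum w _ _ (v := v), tsum_congr hterm, tsum_eq_sum (s := range (N + 1)),
        hq, forest_succ w q N (N + 1) (by omega), Finset.mul_sum]
      · push_cast
        rfl
      · intro k hk
        rw [Finset.mem_range, not_lt] at hk
        rw [forest_eq_zero w (by omega)]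
        simp

theorem isPattern_empty : IsPattern ∅ d := Finset.empty_subset _

theorem partitionFunction_eq (w : ℕ → ℝ≥0) (n : ℕ) :
    partitionFunction w n = forest w 1 n := by
  have h := totalWeight_extending w (isPattern_empty (d := fun _ => 0)) n
  have hb : hull ∅ (fun _ => 0) \ ∅ = {[]} := by
    rw [Finset.sdiff_empty]
    simp [hull]
  rw [hb, Finset.card_singleton, Finset.prod_empty, one_mul, Finset.card_empty, zero_add] at h
  rw [← h, partitionFunction, totalWeight,
    tsum_subtype (ofSize n) fun T => (weight w T : ℝ≥0∞)]
  refine tsum_congr fun T => ?_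
  by_cases hT : T ∈ ofSize n <;> simp [hT, extending]

theorem partitionFunction_succ (w : ℕ → ℝ≥0) (n : ℕ) :
    partitionFunction w (n + 1) = ((boxes w n (n + 1) / (n + 1) : ℝ≥0) : ℝ≥0∞) := by
  rw [partitionFunction_eq, forest_of_le w (Nat.succ_ne_zero n) (by omega)]
  congr 1
  rw [Nat.succ_sub_one]
  push_cast
  ring

theorem simplyGenerated_apply (w : ℕ → ℝ≥0) (n : ℕ) {E : Set PlaneTree} (hE : MeasurableSet E) :
    simplyGenerated w n E = totalWeight w n E / partitionFunction w n := by
  rw [simplyGenerated, Measure.sum_apply _ hE, totalWeight, div_eq_mul_inv,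
    ← ENNReal.tsum_mul_right,
    ← tsum_subtype_eq_of_support_subset (s := ofSize n)]
  · refine tsum_congr fun T => ?_
    rw [Measure.smul_apply, Measure.dirac_apply' _ hE, smul_eq_mul]
    by_cases h : T.1 ∈ E
    · simp [h, div_eq_mul_inv]
    · simp [h]
  · intro T hT
    by_contra hcon
    exact hT (by simp [hcon])

theorem measurable_deg (v : UHVertex) : Measurable fun T : PlaneTree => T.deg v :=
  (measurable_pi_apply v).comp measurable_subtype_coe

theorem measurableSet_extending : MeasurableSet (extending G d) := by
  have : extending G d = ⋂ v ∈ G, (fun T : PlaneTree => T.deg v) ⁻¹' {(d v : ℕ∞)} := by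
    ext T
    simp [extending]
  rw [this]
  exact G.measurableSet_biInter fun v _ => measurable_deg v (measurableSet_singleton _)

/-- The probability that a simply generated tree extends a pattern, in terms of balls in boxes. -/
theorem simplyGenerated_extending (w : ℕ → ℝ≥0) (h : IsPattern G d) {n : ℕ} (hn : G.card ≤ n)
    (hpos : 0 < boxes w n (n + 1)) :
    simplyGenerated w (n + 1) (extending G d) =
      ((n + 1) * (hull G d \ G).card / ((n - G.card : ℕ) + 1) * boxLaw w (G.toList.map d) n :
        ℝ≥0) := by
  have h1 := totalWeight_extending w h (n - G.card + 1)
  rw [show G.card + (n - G.card + 1) = n + 1 by omega] at h1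
  have hn0 : (boxes w n (n + 1) / (n + 1) : ℝ≥0) ≠ 0 := by positivity
  rw [simplyGenerated_apply w _ measurableSet_extending, h1, partitionFunction_succ,
    ← ENNReal.coe_div hn0]
  congr 1
  have hb := card_boundary h
  have hsum : (G.toList.map d).sum = ∑ v ∈ G, d v := Finset.sum_map_toList G d
  have hprod : ((G.toList.map d).map w).prod = ∏ v ∈ G, w (d v) := by
    rw [List.map_map]
    exact Finset.prod_map_toList G _
  rw [boxLaw, boxNum_eq, hsum, hprod, List.length_map, Finset.length_toList]
  set q := (hull G d \ G).card
  by_cases hs : ∑ v ∈ G, d v ≤ n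
  · rw [if_pos hs, forest_of_le w (Nat.succ_ne_zero _) (by omega),
      show n - G.card + 1 - q = n - ∑ v ∈ G, d v by omega,
      show n + 1 - G.card = n - G.card + 1 by omega]
    push_cast
    field_simp
  · rw [if_neg hs, forest_eq_zero w (by omega)]
    simp

end PlaneTree

/-! ### Limits of pattern probabilities in simply generated trees -/

namespace PlaneTree

open WeightSeq Finset Filter

variable {w : ℕ → ℝ≥0} {G : Finset UHVertex} {d : UHVertex → ℕ}

theorem boxLaw_perm (w : ℕ → ℝ≥0) {l l' : List ℕ} (h : l.Perm l') (n : ℕ) :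
    boxLaw w l n = boxLaw w l' n := by
  rw [boxLaw, boxLaw, boxNum, boxNum, h.sum_eq, (h.map w).prod_eq, h.length_eq]

theorem tendsto_succ_div_sub (ℓ : ℕ) :
    Tendsto (fun n : ℕ => ((n : ℝ) + 1) / ((n - ℓ : ℕ) + 1)) atTop (𝓝 1) := by
  have h1 : Tendsto (fun n : ℕ => ((n : ℝ) + (1 + ℓ)) / (n + 1)) atTop (𝓝 1) := by
    have := tendsto_add_mul_div_add_mul_atTop_nhds (𝕜 := ℝ) (1 + ℓ) 1 1 (d := 1) one_ne_zero
    simpa [add_comm, add_left_comm, add_assoc] using this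
  rw [← tendsto_add_atTop_iff_nat ℓ]
  refine h1.congr fun n => ?_
  rw [Nat.add_sub_cancel]
  push_cast
  ring

theorem tendsto_sub_div_sub (ℓ m : ℕ) :
    Tendsto (fun n : ℕ => ((n - m : ℕ) : ℝ) / ((n - ℓ : ℕ) + 1)) atTop (𝓝 1) := by
  have h1 : Tendsto (fun n : ℕ => ((n - m : ℕ) : ℝ) / (n + 1)) atTop (𝓝 1) := by
    rw [← tendsto_add_atTop_iff_nat m]
    have := tendsto_add_mul_div_add_mul_atTop_nhds (𝕜 := ℝ) 0 (1 + m) 1 (d := 1) one_ne_zero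
    refine (by simpa using this : Tendsto _ _ _).congr fun n => ?_
    rw [Nat.add_sub_cancel]
    push_cast
    ring_nf
  have h2 := h1.mul (tendsto_succ_div_sub ℓ)
  rw [one_mul] at h2
  refine h2.congr fun n => ?_
  have : (n : ℝ) + 1 ≠ 0 := by positivity
  field_simp

section

variable (h0 : 0 < w 0) (h2 : ∃ k, 2 ≤ k ∧ 0 < w k)
include h0 h2

/-- The asymptotic probability of a pattern with finite outdegrees. -/
theorem tendsto_simplyGenerated_extending (h : IsPattern G d) :
    Tendsto (fun n => simplyGenerated w (n + 1) (extending G d)) (admissible w)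
      (𝓝 ((hull G d \ G).card * ∏ v ∈ G, offspring w h0 h2 (d v))) := by
  have hlim : ((hull G d \ G).card * ∏ v ∈ G, offspring w h0 h2 (d v) : ℝ≥0∞) =
      ((1 * (hull G d \ G).card * ∏ v ∈ G, prob w (d v) : ℝ≥0) : ℝ≥0∞) := by
    push_cast
    rw [one_mul]
    congr 1
    exact Finset.prod_congr rfl fun v _ => (coe_prob h0 h2 _).symm
  rw [hlim]
  have h1 := tendsto_boxLaw h0 h2 (G.toList.map d)
  rw [List.map_map, Finset.prod_map_toList G] at h1
  have h3 : Tendsto (fun n : ℕ => ((n : ℝ≥0) + 1) / ((n - G.card : ℕ) + 1)) (admissible w)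
      (𝓝 1) := by
    rw [← NNReal.tendsto_coe]
    have := (tendsto_succ_div_sub G.card).mono_left (inf_le_left : admissible w ≤ atTop)
    simp only [NNReal.coe_div, NNReal.coe_add, NNReal.coe_natCast, NNReal.coe_one]
    exact this
  refine (ENNReal.tendsto_coe.2 ((h3.mul_const ((hull G d \ G).card : ℝ≥0)).mul h1)).congr' ?_
  refine eventually_admissible ⟨G.card, fun n hn hpos => ?_⟩
  beta_reduce
  rw [simplyGenerated_extending w h hn hpos]
  congr 2
  ring

/-- The plane trees in which `v₀` has outdegree at least `K` and the other vertices of `G` have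
outdegrees `d`. -/
def extendingGE (G : Finset UHVertex) (d : UHVertex → ℕ) (v₀ : UHVertex) (K : ℕ) :
    Set PlaneTree :=
  {T | (∀ v ∈ G.erase v₀, T.deg v = d v) ∧ (K : ℕ∞) ≤ T.deg v₀}

omit h0 h2 in
/-- Summation over the outdegree `D` of `v₀`. The size of the boundary is at least `D - #G`. -/
theorem sum_le_simplyGenerated_extendingGE {v₀ : UHVertex} (hv₀ : v₀ ∈ G) {K : ℕ}
    (hpat : ∀ D, K ≤ D → IsPattern G (Function.update d v₀ D)) {n : ℕ} (hn : G.card ≤ n)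
    (hpos : 0 < boxes w n (n + 1)) :
    ((∑ D ∈ Ico K (n + 1), ((D - G.card : ℕ) : ℝ≥0) *
      boxLaw w (D :: (G.erase v₀).toList.map d) n : ℝ≥0) : ℝ≥0∞) ≤
      simplyGenerated w (n + 1) (extendingGE G d v₀ K) := by
  have hins : insert v₀ (G.erase v₀) = G := Finset.insert_erase hv₀
  have hnot : v₀ ∉ G.erase v₀ := Finset.notMem_erase _ _
  have hmem : ∀ D, extending G (Function.update d v₀ D) =
      {T | T ∈ extending (G.erase v₀) d ∧ T.deg v₀ = D} := fun D => by
    rw [← extending_insert hnot, hins]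
  have hsub : ⋃ D ∈ Ico K (n + 1), extending G (Function.update d v₀ D) ⊆
      extendingGE G d v₀ K := by
    intro T hT
    simp only [Set.mem_iUnion] at hT
    obtain ⟨D, hD, hT⟩ := hT
    rw [hmem] at hT
    refine ⟨hT.1, ?_⟩
    rw [hT.2]
    exact_mod_cast (Finset.mem_Ico.1 hD).1
  refine le_trans ?_ (measure_mono hsub)
  rw [measure_biUnion_finset ?_ fun D _ => measurableSet_extending]
  · rw [ENNReal.ofNNReal_finsetSum]
    refine Finset.sum_le_sum fun D hD => ?_
    have hp := hpat D (Finset.mem_Ico.1 hD).1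
    rw [simplyGenerated_extending w hp hn hpos, ENNReal.coe_le_coe]
    have hperm : (G.toList.map (Function.update d v₀ D)).Perm
        (D :: (G.erase v₀).toList.map d) := by
      have h1 : G.toList.Perm (v₀ :: (G.erase v₀).toList) := by
        conv_lhs => rw [← hins]
        exact Finset.toList_insert hnot
      refine (h1.map _).trans ?_
      rw [List.map_cons, Function.update_self]
      refine List.Perm.of_eq ?_
      congr 1
      refine List.map_congr_left fun u hu => ?_
      rw [Function.update_of_ne]
      rintro rfl
      exact hnot (Finset.mem_toList.1 hu)
    rw [boxLaw_perm w hperm]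
    gcongr
    have hcard : D - G.card ≤ (hull G (Function.update d v₀ D) \ G).card := by
      have h1 := card_boundary hp
      have h3 := Finset.single_le_sum (f := Function.update d v₀ D) (fun _ _ => Nat.zero_le _) hv₀
      rw [Function.update_self] at h3
      omega
    calc ((D - G.card : ℕ) : ℝ≥0) ≤ (hull G (Function.update d v₀ D) \ G).card := by
          exact_mod_cast hcard
      _ ≤ _ := by
          rw [mul_comm, mul_div_assoc]
          refine le_mul_of_one_le_right zero_le ?_
          rw [one_le_div (by positivity)]
          gcongr
          exact Nat.sub_le _ _
  · intro D _ D' _ hne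
    rw [Function.onFun, Set.disjoint_left]
    intro T hT hT'
    rw [hmem] at hT hT'
    exact hne (by exact_mod_cast hT.2.symm.trans hT'.2)

/-- The asymptotic probability of a pattern with one large outdegree. By exchangeability, the mean
content of a box is one also in the presence of the other boxes of the pattern; the contents below
`K` contribute only `∑_{k < K} k π_k` to this mean, so the rest is due to large contents. -/
theorem eventually_lt_simplyGenerated_extendingGE {v₀ : UHVertex} (hv₀ : v₀ ∈ G) {K : ℕ}
    (hpat : ∀ D, K ≤ D → IsPattern G (Function.update d v₀ D)) {c : ℝ≥0∞}
    (hc : c < (1 - ∑' k : ℕ, (k : ℝ≥0∞) * offspring w h0 h2 k) *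
      ∏ v ∈ G.erase v₀, offspring w h0 h2 (d v)) :
    ∀ᶠ n in admissible w, c < simplyGenerated w (n + 1) (extendingGE G d v₀ K) := by
  have hmean := offspring_mean_le w h0 h2
  have hpart : ∀ L : ℕ, ((∑ k ∈ range L, (k : ℝ≥0) * prob w k : ℝ≥0) : ℝ≥0∞) ≤
      ∑' k : ℕ, (k : ℝ≥0∞) * offspring w h0 h2 k := by
    intro L
    push_cast
    simp only [coe_prob h0 h2]
    exact ENNReal.sum_le_tsum _
  generalize ∑' k : ℕ, (k : ℝ≥0∞) * offspring w h0 h2 k = μ at *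
  lift μ to ℝ≥0 using ne_top_of_le_ne_top ENNReal.one_ne_top hmean
  set l := (G.erase v₀).toList.map d with hl
  set Q := (l.map (prob w)).prod with hQ
  have hQ' : ∏ v ∈ G.erase v₀, offspring w h0 h2 (d v) = Q := by
    rw [hQ, hl, List.map_map, Finset.prod_map_toList]
    push_cast
    exact Finset.prod_congr rfl fun v _ => (coe_prob h0 h2 _).symm
  rw [hQ'] at hc
  lift c to ℝ≥0 using hc.ne_top
  have hμ1 : μ ≤ 1 := by exact_mod_cast hmean
  have hcR : (c : ℝ) < (1 - μ) * Q := by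
    have h3 : c < (1 - μ) * Q := by exact_mod_cast hc
    have h4 := NNReal.coe_lt_coe.2 h3
    rwa [NNReal.coe_mul, NNReal.coe_sub hμ1] at h4
  -- Choose `L ≥ K` so large that replacing outdegrees `D ≥ L` by `D - #G` does not matter.
  obtain ⟨L, hLK, hL0, hL⟩ : ∃ L : ℕ, K ≤ L ∧ G.card + 1 ≤ L ∧
      (c : ℝ) < (1 - G.card / L) * ((1 - μ) * Q) := by
    have h3 : Tendsto (fun L : ℕ => (1 - (G.card : ℝ) / L) * ((1 - μ) * Q)) atTop
        (𝓝 ((1 - 0) * ((1 - μ) * Q))) :=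
      ((tendsto_const_nhds).sub (tendsto_const_div_atTop_nhds_zero_nat _)).mul_const _
    rw [sub_zero, one_mul] at h3
    obtain ⟨L, hL⟩ := ((h3.eventually_const_lt hcR).and
      ((eventually_ge_atTop K).and (eventually_ge_atTop (G.card + 1)))).exists
    exact ⟨L, hL.2.1, hL.2.2, hL.1⟩
  have hL0' : (0 : ℝ) < L := by exact_mod_cast (by omega : 0 < L)
  have hfac : (0 : ℝ) ≤ 1 - G.card / L := by
    rw [sub_nonneg, div_le_one hL0']
    exact_mod_cast (by omega : G.card ≤ L)
  have hlim : Tendsto (fun n : ℕ => (1 - (G.card : ℝ) / L) *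
      (((n - l.sum : ℕ) : ℝ) / ((n - l.length : ℕ) + 1) * boxLaw w l n -
        ∑ D ∈ range L, (D : ℝ) * boxLaw w (D :: l) n)) (admissible w)
      (𝓝 ((1 - (G.card : ℝ) / L) * (1 * Q - ∑ D ∈ range L, (D : ℝ) * (prob w D * Q)))) := by
    refine Tendsto.const_mul _ (Tendsto.sub ?_ (tendsto_finsetSum _ fun D _ => ?_))
    · exact ((tendsto_sub_div_sub _ _).mono_left inf_le_left).mul
        (NNReal.tendsto_coe.2 (tendsto_boxLaw h0 h2 l))
    · refine Tendsto.const_mul _ ?_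
      have := NNReal.tendsto_coe.2 (tendsto_boxLaw h0 h2 (D :: l))
      rwa [List.map_cons, List.prod_cons, NNReal.coe_mul] at this
  have hlt : (c : ℝ) <
      (1 - (G.card : ℝ) / L) * (1 * Q - ∑ D ∈ range L, (D : ℝ) * (prob w D * Q)) := by
    refine hL.trans_le (mul_le_mul_of_nonneg_left ?_ hfac)
    have h3 : ∑ k ∈ range L, (k : ℝ≥0) * prob w k ≤ μ := by exact_mod_cast hpart L
    have h4 := NNReal.coe_le_coe.2 h3
    push_cast at h4
    simp_rw [← mul_assoc]
    rw [← Finset.sum_mul, ← sub_mul]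
    gcongr
  filter_upwards [hlim.eventually_const_lt hlt,
    eventually_admissible (p := fun n => 0 < boxes w n (n + 1) ∧ G.card + L ≤ n)
      ⟨G.card + L, fun n hn hpos => ⟨hpos, hn⟩⟩] with n hn ⟨hpos, hnL⟩
  have hlen : l.length ≤ n := by
    rw [hl, List.length_map, Finset.length_toList]
    have := Finset.card_le_card (Finset.erase_subset v₀ G)
    omega
  have hsub : extendingGE G d v₀ L ⊆ extendingGE G d v₀ K := fun T hT =>
    ⟨hT.1, le_trans (by exact_mod_cast hLK) hT.2⟩
  refine lt_of_lt_of_le ?_ ((sum_le_simplyGenerated_extendingGE hv₀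
    (fun D hD => hpat D (hLK.trans hD)) (by omega) hpos).trans (measure_mono hsub))
  rw [ENNReal.coe_lt_coe, ← NNReal.coe_lt_coe]
  refine hn.trans_le ?_
  have hm := congrArg ((↑) : ℝ≥0 → ℝ) (sum_mul_boxLaw_cons w hlen)
  simp only [NNReal.coe_sum, NNReal.coe_mul, NNReal.coe_div, NNReal.coe_add, NNReal.coe_natCast,
    NNReal.coe_one] at hm
  rw [← hm, Finset.range_eq_Ico, ← Finset.sum_Ico_consecutive _ (Nat.zero_le L) (by omega :
    L ≤ n + 1), Finset.range_eq_Ico, add_sub_cancel_left, Finset.mul_sum, NNReal.coe_sum]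
  refine Finset.sum_le_sum fun D hD => ?_
  rw [← mul_assoc, NNReal.coe_mul, NNReal.coe_natCast]
  refine mul_le_mul_of_nonneg_right ?_ (NNReal.coe_nonneg _)
  have hD' := (Finset.mem_Ico.1 hD).1
  rw [Nat.cast_sub (by omega), sub_mul, one_mul]
  have : (G.card : ℝ) ≤ G.card / L * D := by
    rw [div_mul_eq_mul_div, le_div_iff₀ hL0']
    gcongr
  linarith

end

end PlaneTree

/-! ### The modified Galton-Watson tree -/

namespace PlaneTree

theorem reachable_ofDegrees (d : UHVertex → ℕ∞) (v : UHVertex) :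
    v ∈ (ofDegrees d).verts ↔ Reachable d v := by
  induction v with
  | nil => exact Iff.rfl
  | cons i u ih =>
    rw [cons_mem_verts, ih]
    refine and_congr_right fun hu => ?_
    rw [show (ofDegrees d).deg u = d u from if_pos hu]

theorem deg_ofDegrees (d : UHVertex → ℕ∞) {v : UHVertex} (hv : v ∈ (ofDegrees d).verts) :
    (ofDegrees d).deg v = d v :=
  if_pos ((reachable_ofDegrees d v).1 hv)

theorem mem_verts_of_deg_ne_zero {T : PlaneTree} {v : UHVertex} (h : T.deg v ≠ 0) : v ∈ T.verts :=
  by_contra fun hv => h (deg_eq_zero_of_notMem hv)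

theorem measurableSet_mem_verts (v : UHVertex) : MeasurableSet {T : PlaneTree | v ∈ T.verts} := by
  induction v with
  | nil => exact MeasurableSet.univ
  | cons i u ih =>
    exact ih.inter (measurable_deg u (MeasurableSet.of_discrete (s := Set.Ioi (i : ℕ∞))))

end PlaneTree

namespace ModifiedGW

open PlaneTree Finset

open Classical in
/-- The outdegree that the sample `s` assigns to the vertex `v`, if `v` belongs to the tree. -/
noncomputable def sampleDeg (s : Sample) (v : UHVertex) : ℕ∞ :=
  if IsSpecial s v then (s v).2.1 else ((s v).1 : ℕ∞)

theorem deg_tree {s : Sample} {v : UHVertex} (hv : v ∈ (tree s).verts) :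
    (tree s).deg v = sampleDeg s v := deg_ofDegrees _ hv

theorem measurableSet_isSpecial (v : UHVertex) : MeasurableSet {s : Sample | IsSpecial s v} := by
  induction v with
  | nil => exact MeasurableSet.univ
  | cons i u ih =>
    have hm : MeasurableSet {x : ℕ × (ℕ∞ × ℕ) | x.2.1 ≠ ⊤ ∧ i = x.2.2} := MeasurableSet.of_discrete
    have hu : Measurable fun s : Sample => s u := measurable_pi_apply u
    exact ih.inter (hu hm)

theorem measurable_sampleDeg (v : UHVertex) : Measurable fun s : Sample => sampleDeg s v := by
  classical
  refine Measurable.ite (measurableSet_isSpecial v) ?_ ?_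
  · exact (measurable_pi_apply v).snd.fst
  · exact Measurable.of_discrete.comp (measurable_pi_apply v).fst

theorem measurableSet_reachable (v : UHVertex) :
    MeasurableSet {s : Sample | Reachable (sampleDeg s) v} := by
  induction v with
  | nil => exact MeasurableSet.univ
  | cons i u ih =>
    exact ih.inter (measurable_sampleDeg u (MeasurableSet.of_discrete (s := Set.Ioi (i : ℕ∞))))

theorem measurable_tree : Measurable tree := by
  classical
  refine Measurable.subtype_mk (measurable_pi_lambda _ fun v => ?_)
  exact Measurable.ite (measurableSet_reachable v) (measurable_sampleDeg v) measurable_const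

theorem IsSpecial.of_suffix {s : Sample} {u v : UHVertex} (h : IsSpecial s v) (huv : u <:+ v) :
    IsSpecial s u := by
  obtain ⟨l, rfl⟩ := huv
  induction l with
  | nil => exact h
  | cons i l ih => exact ih h.1

theorem IsSpecial.eq_of_length {s : Sample} {u v : UHVertex} (hu : IsSpecial s u)
    (hv : IsSpecial s v) (h : u.length = v.length) : u = v := by
  induction u generalizing v with
  | nil => exact (List.length_eq_zero_iff.1 h.symm).symm
  | cons i u ih =>
    rcases v with _ | ⟨j, v⟩
    · simp at h
    · obtain rfl := ih hu.1 hv.1 (by simpa using h)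
      rw [hu.2.2, hv.2.2]

/-- The special vertices form a path. -/
theorem IsSpecial.suffix {s : Sample} {u v : UHVertex} (hu : IsSpecial s u) (hv : IsSpecial s v)
    (h : u.length ≤ v.length) : u <:+ v := by
  have h1 : v.drop (v.length - u.length) <:+ v := List.drop_suffix _ _
  rwa [← hu.eq_of_length (hv.of_suffix h1) (by simp; omega)] at h1

theorem exists_cons_suffix {u v : UHVertex} (h : u <:+ v) (hne : u ≠ v) : ∃ j, (j :: u) <:+ v := by
  obtain ⟨l, rfl⟩ := h
  rcases List.eq_nil_or_concat l with rfl | ⟨l', j, rfl⟩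
  · simp at hne
  · exact ⟨j, l', by simp⟩

theorem IsSpecial.of_deg_eq_top {s : Sample} {v : UHVertex} (h : (tree s).deg v = ⊤) :
    IsSpecial s v ∧ (s v).2.1 = ⊤ := by
  have hv : v ∈ (tree s).verts := mem_verts_of_deg_ne_zero (by rw [h]; simp)
  rw [deg_tree hv, sampleDeg] at h
  split_ifs at h with hs
  · exact ⟨hs, h⟩
  · exact absurd h (ENat.natCast_ne_top _)

/-- A special vertex with infinitely many children is the last special vertex. -/
theorem IsSpecial.suffix_of_eq_top {s : Sample} {u v : UHVertex} (hu : IsSpecial s u)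
    (hv : IsSpecial s v) (htop : (s v).2.1 = ⊤) : u <:+ v := by
  rcases le_total u.length v.length with h | h
  · exact hu.suffix hv h
  · by_contra hcon
    obtain ⟨j, hj⟩ := exists_cons_suffix (hv.suffix hu h) (fun e => hcon (e ▸ List.suffix_rfl))
    exact (hu.of_suffix hj).2.1 htop

theorem eq_of_deg_eq_top {s : Sample} {u v : UHVertex} (hu : (tree s).deg u = ⊤)
    (hv : (tree s).deg v = ⊤) : u = v := by
  obtain ⟨hu1, hu2⟩ := IsSpecial.of_deg_eq_top hu
  obtain ⟨hv1, hv2⟩ := IsSpecial.of_deg_eq_top hv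
  exact (hu1.suffix_of_eq_top hv1 hv2).eq_of_length
    (le_antisymm (hu1.suffix_of_eq_top hv1 hv2).length_le
      (hv1.suffix_of_eq_top hu1 hu2).length_le)

section

variable (π : PMF ℕ)

theorem specialLaw_singleton_le (k j : ℕ) : specialLaw π {((k : ℕ∞), j)} ≤ π k := by
  rw [specialLaw, Measure.add_apply, Measure.sum_apply _ (measurableSet_singleton _),
    tsum_eq_single k, Measure.finsetSum_apply, Measure.smul_apply,
    Measure.dirac_apply' _ (measurableSet_singleton _)]
  · have h1 : ∀ i ∈ range k, (π k • Measure.dirac ((k : ℕ∞), i)) {((k : ℕ∞), j)} =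
        if i = j then π k else 0 := by
      intro i _
      rw [Measure.smul_apply, Measure.dirac_apply' _ (measurableSet_singleton _)]
      by_cases h : i = j <;> simp [h]
    rw [Finset.sum_congr rfl h1, Finset.sum_ite_eq']
    simp only [smul_eq_mul]
    rw [Set.indicator_of_notMem (by simp), mul_zero, add_zero]
    split_ifs
    · exact le_rfl
    · exact zero_le
  · intro k' hk'
    rw [Measure.finsetSum_apply]
    refine Finset.sum_eq_zero fun i _ => ?_
    rw [Measure.smul_apply, Measure.dirac_apply' _ (measurableSet_singleton _),
      Set.indicator_of_notMem, smul_zero]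
    simp [hk']

theorem specialLaw_top : specialLaw π {x | x.1 = ⊤} = 1 - ∑' k : ℕ, (k : ℝ≥0∞) * π k := by
  have hm : MeasurableSet {x : ℕ∞ × ℕ | x.1 = ⊤} := MeasurableSet.of_discrete
  rw [specialLaw, Measure.add_apply, Measure.sum_apply _ hm, ENNReal.tsum_eq_zero.2, zero_add,
    Measure.smul_apply, Measure.dirac_apply' _ hm]
  · simp
  · intro k
    rw [Measure.finsetSum_apply]
    refine Finset.sum_eq_zero fun i _ => ?_
    rw [Measure.smul_apply, Measure.dirac_apply' _ hm, Set.indicator_of_notMem, smul_zero]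
    simp

theorem ae_specialLaw : ∀ᵐ x ∂specialLaw π,
    (x.1 = ⊤ ∧ ∑' k : ℕ, (k : ℝ≥0∞) * π k ≠ 1) ∨
      ∃ k : ℕ, x.1 = (k : ℕ∞) ∧ x.2 < k ∧ π k ≠ 0 := by
  rw [specialLaw, ae_add_measure_iff]
  constructor
  · rw [Measure.ae_sum_iff' MeasurableSet.of_discrete]
    intro k
    rw [ae_iff, Measure.finsetSum_apply]
    refine Finset.sum_eq_zero fun j hj => ?_
    rw [Measure.smul_apply, Measure.dirac_apply' _ MeasurableSet.of_discrete, smul_eq_mul]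
    by_cases hk : π k = 0
    · rw [hk, zero_mul]
    · rw [Set.indicator_of_notMem, mul_zero]
      simp only [Set.mem_ofPred_eq, not_not]
      exact Or.inr ⟨k, rfl, Finset.mem_range.1 hj, hk⟩
  · rw [ae_iff, Measure.smul_apply, Measure.dirac_apply' _ MeasurableSet.of_discrete, smul_eq_mul]
    by_cases hk : ∑' k : ℕ, (k : ℝ≥0∞) * π k = 1
    · rw [hk, tsub_self, zero_mul]
    · rw [Set.indicator_of_notMem, mul_zero]
      simp only [Set.mem_ofPred_eq, not_not]
      exact Or.inl ⟨trivial, hk⟩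

variable {π} (hπ : ∑' k : ℕ, (k : ℝ≥0∞) * π k ≤ 1)
include hπ

theorem isProbabilityMeasure_law : IsProbabilityMeasure (law π) := by
  have := isProbabilityMeasure_specialLaw π hπ
  exact Measure.isProbabilityMeasure_map measurable_tree.aemeasurable

/-- The almost sure properties of the tree follow from those of the single samples. -/
theorem ae_law {p : PlaneTree → Prop} (hp : MeasurableSet {T | p T})
    (h : ∀ s : Sample, (∀ v, π (s v).1 ≠ 0 ∧
      (((s v).2.1 = ⊤ ∧ ∑' k : ℕ, (k : ℝ≥0∞) * π k ≠ 1) ∨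
        ∃ k : ℕ, (s v).2.1 = (k : ℕ∞) ∧ (s v).2.2 < k ∧ π k ≠ 0)) → p (tree s)) :
    ∀ᵐ T ∂law π, p T := by
  have := isProbabilityMeasure_specialLaw π hπ
  rw [law, ae_map_iff measurable_tree.aemeasurable hp]
  have h1 : ∀ᵐ s ∂(Measure.infinitePi fun _ : UHVertex => π.toMeasure.prod (specialLaw π)),
      ∀ v, π (s v).1 ≠ 0 ∧
      (((s v).2.1 = ⊤ ∧ ∑' k : ℕ, (k : ℝ≥0∞) * π k ≠ 1) ∨
        ∃ k : ℕ, (s v).2.1 = (k : ℕ∞) ∧ (s v).2.2 < k ∧ π k ≠ 0) := by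
    rw [ae_all_iff]
    intro v
    refine (measurePreserving_eval_infinitePi
      (fun _ : UHVertex => π.toMeasure.prod (specialLaw π)) v).quasiMeasurePreserving.ae
      (p := fun x : ℕ × (ℕ∞ × ℕ) => π x.1 ≠ 0 ∧
      ((x.2.1 = ⊤ ∧ ∑' k : ℕ, (k : ℝ≥0∞) * π k ≠ 1) ∨
        ∃ k : ℕ, x.2.1 = (k : ℕ∞) ∧ x.2.2 < k ∧ π k ≠ 0)) ?_
    refine Filter.Eventually.and ?_ ?_
    · refine Measure.quasiMeasurePreserving_fst.ae (p := fun k => π k ≠ 0) ?_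
      rw [ae_iff, PMF.toMeasure_apply_eq_zero_iff _ MeasurableSet.of_discrete,
        Set.disjoint_left]
      intro k hk hk'
      exact hk' ((PMF.mem_support_iff _ _).1 hk)
    · exact Measure.quasiMeasurePreserving_snd.ae (ae_specialLaw π)
  exact h1.mono h

/-- A union bound: if the tree can only belong to `E` when the samples at the vertices of `G` lie in
one of finitely many boxes, then independence bounds the probability of `E`. The special child may
be assumed to be one of the children, which holds almost surely. -/
theorem law_le_prod {E : Set PlaneTree} (hE : MeasurableSet E) (G : Finset UHVertex)
    {ι : Type*} (B : Finset ι) (A : ι → UHVertex → Set (ℕ × (ℕ∞ × ℕ)))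
    (h : ∀ s : Sample, (∀ v, ((s v).2.1 ≠ ⊤ → ((s v).2.2 : ℕ∞) < (s v).2.1)) → tree s ∈ E →
      ∃ b ∈ B, ∀ v ∈ G, s v ∈ A b v) :
    law π E ≤ ∑ b ∈ B, ∏ v ∈ G, (π.toMeasure.prod (specialLaw π)) (A b v) := by
  have := isProbabilityMeasure_specialLaw π hπ
  set P := Measure.infinitePi fun _ : UHVertex => π.toMeasure.prod (specialLaw π) with hP
  have hae : ∀ᵐ s ∂P, ∀ v, (s v).2.1 ≠ ⊤ → ((s v).2.2 : ℕ∞) < (s v).2.1 := by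
    rw [ae_all_iff]
    intro v
    refine (measurePreserving_eval_infinitePi
      (fun _ : UHVertex => π.toMeasure.prod (specialLaw π)) v).quasiMeasurePreserving.ae
      (p := fun x : ℕ × (ℕ∞ × ℕ) => x.2.1 ≠ ⊤ → (x.2.2 : ℕ∞) < x.2.1) ?_
    refine Measure.quasiMeasurePreserving_snd.ae
      (p := fun x : ℕ∞ × ℕ => x.1 ≠ ⊤ → (x.2 : ℕ∞) < x.1) ?_
    filter_upwards [ae_specialLaw π] with x hx htop
    obtain ⟨k, h1, h2, _⟩ := hx.resolve_left fun hx => htop hx.1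
    rw [h1]
    exact_mod_cast h2
  rw [law, Measure.map_apply measurable_tree hE]
  calc P (tree ⁻¹' E) ≤ P (⋃ b ∈ B, Set.pi G (A b)) := by
        refine measure_mono_ae ?_
        filter_upwards [hae] with s hs hsE
        obtain ⟨b, hb, hA⟩ := h s hs hsE
        exact Set.mem_biUnion (Finset.mem_coe.2 hb) hA
    _ ≤ ∑ b ∈ B, P (Set.pi G (A b)) := measure_biUnion_finset_le _ _
    _ = _ := Finset.sum_congr rfl fun b _ =>
        Measure.infinitePi_pi _ fun v _ => MeasurableSet.of_discrete

/-- The samples at `v` with outdegree `k`, if the last special vertex among those considered is `b`.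
If `v` is a proper ancestor of `b` then it is special, and its special child is the next vertex on
the path to `b`; if `v` is not an ancestor of `b` then it is normal. -/
def spineBox (b v : UHVertex) (k : ℕ) : Set (ℕ × (ℕ∞ × ℕ)) :=
  {x | (v <:+ b → ∃ j, (j :: v) <:+ b ∧ x.2 = ((k : ℕ∞), j)) ∧ (¬ v <:+ b → x.1 = k)}

omit hπ in
theorem cons_suffix_unique {i j : ℕ} {v b : UHVertex} (hi : (i :: v) <:+ b) (hj : (j :: v) <:+ b) :
    i = j := by
  have := (List.suffix_of_suffix_length_le hi hj (by simp)).eq_of_length (by simp)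
  exact (List.cons.inj this).1

theorem measure_spineBox_le (b v : UHVertex) (k : ℕ) :
    (π.toMeasure.prod (specialLaw π)) (spineBox b v k) ≤ π k := by
  have := isProbabilityMeasure_specialLaw π hπ
  by_cases h : v <:+ b
  · by_cases h' : ∃ j, (j :: v) <:+ b
    · obtain ⟨j, hj⟩ := h'
      calc _ ≤ (π.toMeasure.prod (specialLaw π)) (Set.univ ×ˢ {((k : ℕ∞), j)}) := by
            refine measure_mono fun x hx => ?_
            obtain ⟨i, hi, hx⟩ := hx.1 h
            rw [cons_suffix_unique hi hj] at hx
            exact ⟨trivial, hx⟩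
        _ ≤ π k := by
            rw [Measure.prod_prod, measure_univ, one_mul]
            exact specialLaw_singleton_le π k j
    · have : spineBox b v k = ∅ := Set.eq_empty_of_forall_notMem fun x hx => by
        obtain ⟨j, hj, _⟩ := hx.1 h
        exact h' ⟨j, hj⟩
      rw [this, measure_empty]
      exact zero_le
  · calc _ ≤ (π.toMeasure.prod (specialLaw π)) ({k} ×ˢ Set.univ) :=
          measure_mono fun x hx => ⟨hx.2 h, trivial⟩
      _ ≤ π k := by
          rw [Measure.prod_prod, measure_univ, mul_one,
            PMF.toMeasure_apply_singleton _ _ (measurableSet_singleton _)]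

omit hπ in
/-- The sample at a vertex `v` of the tree with finite outdegree, if the special vertices under
consideration are the ancestors of `b`. -/
theorem mem_spineBox {s : Sample} {b v : UHVertex} {k : ℕ} (hb : IsSpecial s b) (hne : v ≠ b)
    (hv : v ∈ (tree s).verts) (hk : (tree s).deg v = k) (hs : IsSpecial s v → v <:+ b) :
    s v ∈ spineBox b v k := by
  rw [deg_tree hv, sampleDeg] at hk
  constructor
  · intro hsuf
    obtain ⟨j, hj⟩ := exists_cons_suffix hsuf hne
    refine ⟨j, hj, ?_⟩
    rw [if_pos (hb.of_suffix hsuf)] at hk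
    exact Prod.ext hk (hb.of_suffix hj).2.2.symm
  · intro hsuf
    rw [if_neg fun h => hsuf (hs h)] at hk
    exact_mod_cast hk

/-- An upper bound for the probability of a pattern with finite outdegrees, by a union bound over
the boundary vertex through which the path of the special vertices leaves the pattern. -/
theorem law_extending_le {G : Finset UHVertex} {d : UHVertex → ℕ} (h : IsPattern G d) :
    law π (extending G d) ≤ (hull G d \ G).card * ∏ v ∈ G, π (d v) := by
  refine (law_le_prod hπ measurableSet_extending G (hull G d \ G)
    (fun b v => spineBox b v (d v)) fun s hs hT => ?_).trans ?_
  · classical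
    obtain ⟨b, hb, hmax⟩ := Finset.exists_max_image ((hull G d).filter fun v => IsSpecial s v)
      List.length ⟨[], Finset.mem_filter.2 ⟨nil_mem_hull, trivial⟩⟩
    obtain ⟨hbH, hbS⟩ := Finset.mem_filter.1 hb
    have hbG : b ∉ G := by
      intro hbG
      have hdeg := hT b hbG
      rw [deg_tree (h.mem_verts hT hbG), sampleDeg, if_pos hbS] at hdeg
      have htop : (s b).2.1 ≠ ⊤ := by rw [hdeg]; exact ENat.natCast_ne_top _
      have hlt := hs b htop
      rw [hdeg] at hlt
      have hc : (s b).2.2 :: b ∈ (hull G d).filter fun v => IsSpecial s v :=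
        Finset.mem_filter.2 ⟨cons_mem_hull.2 ⟨hbG, by exact_mod_cast hlt⟩, hbS, htop, rfl⟩
      have := hmax _ hc
      simp at this
    refine ⟨b, Finset.mem_sdiff.2 ⟨hbH, hbG⟩, fun v hv => ?_⟩
    exact mem_spineBox hbS (fun e => hbG (e ▸ hv)) (h.mem_verts hT hv) (hT v hv) fun hvS =>
      hvS.suffix hbS (hmax v (Finset.mem_filter.2 ⟨h hv, hvS⟩))
  · calc _ ≤ ∑ b ∈ hull G d \ G, ∏ v ∈ G, π (d v) := by
          gcongr with b _ v _
          exact measure_spineBox_le hπ b v (d v)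
      _ = _ := by rw [Finset.sum_const, nsmul_eq_mul]

/-- An upper bound for the probability of a pattern with one infinite outdegree, at which the path
of the special vertices ends. -/
theorem law_extending_top_le {G : Finset UHVertex} {d : UHVertex → ℕ} (h : IsPattern G d)
    {v₀ : UHVertex} (hv₀ : v₀ ∈ G) :
    law π {T | T ∈ extending (G.erase v₀) d ∧ T.deg v₀ = ⊤} ≤
      (1 - ∑' k : ℕ, (k : ℝ≥0∞) * π k) * ∏ v ∈ G.erase v₀, π (d v) := by
  classical
  have := isProbabilityMeasure_specialLaw π hπ
  refine (law_le_prod hπ (measurableSet_extending.inter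
    (measurable_deg v₀ (measurableSet_singleton ⊤))) G {v₀}
    (fun b v => if v = v₀ then {x | x.2.1 = ⊤} else spineBox b v (d v)) fun s hs hT => ?_).trans ?_
  · obtain ⟨hT, htop⟩ := hT
    replace htop : (tree s).deg v₀ = ⊤ := htop
    obtain ⟨hS, hS'⟩ := IsSpecial.of_deg_eq_top htop
    refine ⟨v₀, Finset.mem_singleton_self _, fun v hv => ?_⟩
    have hsub := h.hull_subset_verts_of_le (T := tree s) fun u hu => by
      by_cases e : u = v₀
      · rw [e, htop]; exact le_top
      · exact (hT u (Finset.mem_erase.2 ⟨e, hu⟩)).ge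
    split_ifs with e
    · rw [e]; exact hS'
    · exact mem_spineBox hS e (hsub (Finset.mem_coe.2 (h hv))) (hT v (Finset.mem_erase.2 ⟨e, hv⟩))
        fun hvS => hvS.suffix_of_eq_top hS hS'
  · rw [Finset.sum_singleton, ← Finset.mul_prod_erase G _ hv₀, if_pos rfl]
    refine mul_le_mul' ?_ (Finset.prod_le_prod' fun v hv => ?_)
    · have h1 : {x : ℕ × (ℕ∞ × ℕ) | x.2.1 = ⊤} = Set.univ ×ˢ {x | x.1 = ⊤} := by ext; simp
      rw [h1, Measure.prod_prod, measure_univ, one_mul, specialLaw_top]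
    · rw [if_neg (Finset.ne_of_mem_erase hv)]
      exact measure_spineBox_le hπ v₀ v (d v)

end

end ModifiedGW

/-! ### The labels of an enriched tree -/

namespace WeightedSpecies

open PlaneTree

variable (R : WeightedSpecies.{u})

instance : Countable R.Label := inferInstanceAs (Countable (Option R.Atom))

theorem weightSeq_eq_zero_iff {k : ℕ} : R.weightSeq k = 0 ↔ R.inventory k = 0 := by
  rw [weightSeq, div_eq_zero_iff, or_iff_left (by exact_mod_cast k.factorial_ne_zero)]

theorem nonempty_of_weightSeq_ne_zero {k : ℕ} (h : R.weightSeq k ≠ 0) :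
    Nonempty (R.obj (Fin k)) := by
  by_contra hne
  rw [not_nonempty_iff] at hne
  refine h (R.weightSeq_eq_zero_iff.2 ?_)
  rw [inventory, tsum_empty]

instance (k : ℕ) : IsProbabilityMeasure (R.structureLaw k) := by
  rw [structureLaw]
  split_ifs with h
  · infer_instance
  · constructor
    rw [Measure.sum_apply _ MeasurableSet.univ]
    simp only [Measure.smul_apply, measure_univ, smul_eq_mul, mul_one, div_eq_mul_inv]
    rw [ENNReal.tsum_mul_right, ← ENNReal.coe_tsum Summable.of_finite, ← inventory]
    exact ENNReal.mul_inv_cancel (by exact_mod_cast h) ENNReal.coe_ne_top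

instance (T : PlaneTree) (v : UHVertex) : IsProbabilityMeasure (R.labelLaw T v) := by
  rw [labelLaw]
  split_ifs <;> infer_instance

theorem labelLaw_congr {T T' : PlaneTree} {v : UHVertex} (h : v ∈ T.verts ↔ v ∈ T'.verts)
    (hd : T.deg v = T'.deg v) : R.labelLaw T v = R.labelLaw T' v := by
  rw [labelLaw, labelLaw, hd]
  by_cases hv : v ∈ T.verts
  · rw [if_pos hv, if_pos (h.1 hv)]
  · rw [if_neg hv, if_neg (fun hv' => hv (h.2 hv'))]

theorem measurable_labelLaw_apply (v : UHVertex) (A : Set R.Label) :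
    Measurable fun T => R.labelLaw T v A := by
  classical
  have h : (fun T => R.labelLaw T v A) =
      (fun p : Prop × ℕ∞ => if p.1 then
        (if p.2 = ⊤ then (Measure.dirac OnePoint.infty : Measure R.Label)
          else R.structureLaw p.2.toNat) A
        else (Measure.dirac R.star : Measure R.Label) A) ∘ fun T => (v ∈ T.verts, T.deg v) := by
    funext T
    rw [labelLaw]
    by_cases hv : v ∈ T.verts <;> simp [hv]
  rw [h]
  exact Measurable.of_discrete.comp
    ((measurable_to_prop (by simpa [Set.preimage] using! measurableSet_mem_verts v)).prodMk
      (measurable_deg v))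

theorem measurable_infinitePi_labelLaw :
    Measurable fun T => Measure.infinitePi (R.labelLaw T) := by
  refine Measurable.measure_of_isPiSystem_of_isProbabilityMeasure generateFrom_squareCylinders.symm
    (isPiSystem_squareCylinders (fun _ => MeasurableSpace.isPiSystem_measurableSet)
      fun _ => (MeasurableSet.univ : MeasurableSet (Set.univ : Set R.Label))) ?_
  rintro _ ⟨s, t, ht, rfl⟩
  have h : (fun T => Measure.infinitePi (R.labelLaw T) ((s : Set UHVertex).pi t)) =
      fun T => ∏ v ∈ s, R.labelLaw T v (t v) := by
    funext T
    exact Measure.infinitePi_pi _ fun v _ => MeasurableSet.of_discrete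
  rw [h]
  exact Finset.measurable_prod _ fun v _ => R.measurable_labelLaw_apply v _

theorem enrichedLaw_apply (P : Measure PlaneTree) {A : Set (UHVertex → R.Label)}
    (hA : MeasurableSet A) :
    R.enrichedLaw P A = ∫⁻ T, Measure.infinitePi (R.labelLaw T) A ∂P :=
  Measure.bind_apply hA R.measurable_infinitePi_labelLaw.aemeasurable

theorem measurableSet_pi_finset (F : Finset UHVertex) (A : UHVertex → Set R.Label) :
    MeasurableSet ((F : Set UHVertex).pi A) :=
  MeasurableSet.pi F.countable_toSet fun _ _ => MeasurableSet.of_discrete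

theorem enrichedLaw_pi (P : Measure PlaneTree) (F : Finset UHVertex)
    (A : UHVertex → Set R.Label) :
    R.enrichedLaw P ((F : Set UHVertex).pi A) = ∫⁻ T, ∏ v ∈ F, R.labelLaw T v (A v) ∂P := by
  rw [enrichedLaw_apply _ _ (R.measurableSet_pi_finset F A)]
  exact lintegral_congr fun T => Measure.infinitePi_pi _ fun v _ => MeasurableSet.of_discrete

/-- The properties that the random trees have almost surely: finite outdegrees have positive weight,
at most one outdegree is infinite, and infinite outdegrees occur only if the sizes of structures are
unbounded. -/
structure IsTypical (T : PlaneTree) : Prop where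
  weight_ne_zero : ∀ v ∈ T.verts, T.deg v ≠ ⊤ → R.weightSeq (T.deg v).toNat ≠ 0
  eq_of_deg_eq_top : ∀ u v, T.deg u = ⊤ → T.deg v = ⊤ → u = v
  unbounded : ∀ v, T.deg v = ⊤ → ∀ N : ℕ, ∃ k, N ≤ k ∧ Nonempty (R.obj (Fin k))

theorem measurableSet_isTypical : MeasurableSet {T | R.IsTypical T} := by
  have h : {T | R.IsTypical T} =
      ((⋂ v, {T : PlaneTree | v ∈ T.verts}ᶜ ∪
          (fun T : PlaneTree => T.deg v) ⁻¹' {x | x ≠ ⊤ → R.weightSeq x.toNat ≠ 0}) ∩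
        ⋂ u, ⋂ v, (fun T : PlaneTree => (T.deg u, T.deg v)) ⁻¹'
          {x | x.1 = ⊤ → x.2 = ⊤ → u = v}) ∩
        ⋂ v, (fun T : PlaneTree => T.deg v) ⁻¹'
          {x | x = ⊤ → ∀ N : ℕ, ∃ k, N ≤ k ∧ Nonempty (R.obj (Fin k))} := by
    ext T
    simp only [Set.mem_ofPred_eq, Set.mem_inter_iff, Set.mem_iInter, Set.mem_union,
      Set.mem_compl_iff, Set.mem_preimage]
    constructor
    · exact fun h => ⟨⟨fun v => (em (v ∈ T.verts)).symm.imp_right (h.1 v), h.2⟩, h.3⟩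
    · exact fun h => ⟨fun v hv => (h.1.1 v).resolve_left (not_not.2 hv), h.1.2, h.2⟩
  rw [h]
  refine ((MeasurableSet.iInter fun v => ?_).inter (MeasurableSet.iInter fun u =>
    MeasurableSet.iInter fun v => ?_)).inter (MeasurableSet.iInter fun v => ?_)
  · exact (measurableSet_mem_verts v).compl.union (measurable_deg v MeasurableSet.of_discrete)
  · exact ((measurable_deg u).prodMk (measurable_deg v)) MeasurableSet.of_discrete
  · exact measurable_deg v MeasurableSet.of_discrete

variable {R}

theorem size_coe_ne_top (a : R.Atom) : size (a : R.Label) ≠ ⊤ := by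
  rcases a with _ | F
  · exact ENat.zero_ne_top
  · exact ENat.natCast_ne_top _

theorem size_eq_top_iff {x : R.Label} : size x = ⊤ ↔ x = OnePoint.infty := by
  induction x using OnePoint.rec with
  | infty => exact iff_of_true rfl rfl
  | coe a => exact iff_of_false (size_coe_ne_top a) (OnePoint.coe_ne_infty a)

theorem size_star : size R.star = 0 := rfl

theorem size_toLabel {k : ℕ} (F : R.obj (Fin k)) : size (toLabel F) = k := rfl

theorem infty_ne_star : (OnePoint.infty : R.Label) ≠ R.star := OnePoint.infty_ne_coe _

theorem toLabel_ne_star {k : ℕ} (F : R.obj (Fin k)) : toLabel F ≠ R.star := by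
  intro h
  exact Option.some_ne_none _ (OnePoint.coe_injective h)

/-- The label of a vertex of a typical tree is a structure whose size is the outdegree. -/
theorem IsTypical.ae_labelLaw {T : PlaneTree} (hT : R.IsTypical T) (v : UHVertex) :
    ∀ᵐ x ∂(R.labelLaw T v), (x ≠ R.star ↔ v ∈ T.verts) ∧ size x = T.deg v := by
  rw [labelLaw]
  split_ifs with hv htop
  · rw [ae_dirac_iff MeasurableSet.of_discrete]
    exact ⟨iff_of_true infty_ne_star hv, htop.symm⟩
  · rw [structureLaw, if_neg fun h => hT.1 v hv htop (R.weightSeq_eq_zero_iff.2 h),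
      Measure.ae_sum_iff' MeasurableSet.of_discrete]
    intro F
    refine Measure.ae_smul_measure ?_ _
    rw [ae_dirac_iff MeasurableSet.of_discrete]
    exact ⟨iff_of_true (toLabel_ne_star F) hv, by rw [size_toLabel, ENat.natCast_toNat htop]⟩
  · rw [ae_dirac_iff MeasurableSet.of_discrete]
    exact ⟨iff_of_false (by simp) hv, by rw [size_star, deg_eq_zero_of_notMem hv]⟩

theorem IsTypical.of_labelLaw_ne_zero {T : PlaneTree} (hT : R.IsTypical T) {v : UHVertex}
    {x : R.Label} (h : R.labelLaw T v {x} ≠ 0) : (x ≠ R.star ↔ v ∈ T.verts) ∧ size x = T.deg v := by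
  by_contra hcon
  refine h (measure_mono_null ?_ (ae_iff.1 (hT.ae_labelLaw v)))
  rintro _ rfl
  exact hcon

theorem measurableSet_enrichedTree :
    MeasurableSet {β : UHVertex → R.Label | β [] ≠ R.star ∧
      (∀ (v : UHVertex) (i : ℕ), β (i :: v) ≠ R.star ↔ (i : ℕ∞) < size (β v)) ∧
      ∀ v, β v = OnePoint.infty → ∀ N : ℕ, ∃ k, N ≤ k ∧ Nonempty (R.obj (Fin k))} := by
  have h : {β : UHVertex → R.Label | β [] ≠ R.star ∧
      (∀ (v : UHVertex) (i : ℕ), β (i :: v) ≠ R.star ↔ (i : ℕ∞) < size (β v)) ∧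
      ∀ v, β v = OnePoint.infty → ∀ N : ℕ, ∃ k, N ≤ k ∧ Nonempty (R.obj (Fin k))} =
      ((fun β : UHVertex → R.Label => β []) ⁻¹' {R.star}ᶜ) ∩
      ((⋂ v : UHVertex, ⋂ i : ℕ, (fun β : UHVertex → R.Label => (β (i :: v), β v)) ⁻¹'
        {x | x.1 ≠ R.star ↔ (i : ℕ∞) < size x.2}) ∩
      ⋂ v : UHVertex, (fun β : UHVertex → R.Label => β v) ⁻¹'
        {x | x = OnePoint.infty → ∀ N : ℕ, ∃ k, N ≤ k ∧ Nonempty (R.obj (Fin k))}) := by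
    ext β
    simp
  rw [h]
  refine (measurable_pi_apply _ MeasurableSet.of_discrete).inter
    ((MeasurableSet.iInter fun v => MeasurableSet.iInter fun i => ?_).inter
      (MeasurableSet.iInter fun v => measurable_pi_apply v MeasurableSet.of_discrete))
  exact ((measurable_pi_apply (i :: v)).prodMk (measurable_pi_apply v)) MeasurableSet.of_discrete

theorem IsTypical.ae_infinitePi {T : PlaneTree} (hT : R.IsTypical T) :
    ∀ᵐ β ∂Measure.infinitePi (R.labelLaw T), β [] ≠ R.star ∧
      (∀ (v : UHVertex) (i : ℕ), β (i :: v) ≠ R.star ↔ (i : ℕ∞) < size (β v)) ∧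
      ∀ v, β v = OnePoint.infty → ∀ N : ℕ, ∃ k, N ≤ k ∧ Nonempty (R.obj (Fin k)) := by
  have h1 : ∀ᵐ β ∂Measure.infinitePi (R.labelLaw T), ∀ v,
      (β v ≠ R.star ↔ v ∈ T.verts) ∧ size (β v) = T.deg v := by
    rw [ae_all_iff]
    intro v
    exact (measurePreserving_eval_infinitePi (R.labelLaw T) v).quasiMeasurePreserving.ae
      (hT.ae_labelLaw v)
  filter_upwards [h1] with β hβ
  refine ⟨(hβ []).1.2 T.nil_mem_verts, fun v i => ?_, fun v hv => ?_⟩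
  · rw [(hβ (i :: v)).1, (hβ v).2, cons_mem_verts]
    refine ⟨fun h => h.2, fun h => ⟨?_, h⟩⟩
    exact mem_verts_of_deg_ne_zero (ne_bot_of_gt h)
  · exact hT.3 v (by rw [← (hβ v).2, hv, size_eq_top_iff.2 rfl])

/-- If the plane tree is almost surely typical, then the enriched tree is a random element of the
space of enriched trees. -/
theorem exists_map_eq_enrichedLaw (P : Measure PlaneTree) [IsProbabilityMeasure P]
    (hP : ∀ᵐ T ∂P, R.IsTypical T) : ∃ Q : ProbabilityMeasure R.EnrichedTree,
      (Q : Measure R.EnrichedTree).map Subtype.val = R.enrichedLaw P := by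
  have hmap : ((R.enrichedLaw P).comap (Subtype.val : R.EnrichedTree → _)).map Subtype.val =
      R.enrichedLaw P := by
    refine (map_comap_subtype_coe measurableSet_enrichedTree (R.enrichedLaw P)).trans ?_
    refine Measure.restrict_eq_self_of_ae_mem ?_
    rw [ae_iff]
    refine (R.enrichedLaw_apply P measurableSet_enrichedTree.compl).trans ?_
    refine (lintegral_congr_ae (g := fun _ => 0) ?_).trans lintegral_zero
    filter_upwards [hP] with T hT
    exact ae_iff.1 hT.ae_infinitePi
  have huniv : R.enrichedLaw P Set.univ = 1 := by
    rw [enrichedLaw_apply _ _ MeasurableSet.univ]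
    simp
  refine ⟨⟨(R.enrichedLaw P).comap Subtype.val, ⟨?_⟩⟩, hmap⟩
  rw [← huniv]
  conv_rhs => rw [← hmap, Measure.map_apply measurable_subtype_coe MeasurableSet.univ]
  rfl

/-! ### The random trees are typical -/

theorem isProbabilityMeasure_simplyGenerated (w : ℕ → ℝ≥0) {n : ℕ}
    (hn : 0 < partitionFunction w n) : IsProbabilityMeasure (simplyGenerated w n) := by
  constructor
  rw [simplyGenerated, Measure.sum_apply _ MeasurableSet.univ]
  simp only [Measure.smul_apply, measure_univ, smul_eq_mul, mul_one, div_eq_mul_inv]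
  rw [ENNReal.tsum_mul_right, ← partitionFunction]
  exact ENNReal.mul_inv_cancel hn.ne' (by rw [partitionFunction_eq]; exact ENNReal.coe_ne_top)

theorem ae_isTypical_simplyGenerated (n : ℕ) :
    ∀ᵐ T ∂simplyGenerated R.weightSeq n, R.IsTypical T := by
  rw [simplyGenerated, Measure.ae_sum_iff' R.measurableSet_isTypical]
  intro T
  by_cases hw : PlaneTree.weight R.weightSeq T.1 = 0
  · rw [ae_iff, Measure.smul_apply, hw]
    simp
  · refine Measure.ae_smul_measure ?_ _
    rw [ae_dirac_iff R.measurableSet_isTypical]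
    have hfin := finite_of_mem_ofSize T.2
    have htop := deg_ne_top_of_finite hfin
    refine ⟨fun v hv _ h => hw ?_, fun u v hu => absurd hu (htop u), fun v hv => absurd hv (htop v)⟩
    rw [PlaneTree.weight]
    rw [finprod_mem_eq_finite_toFinset_prod _ hfin]
    exact Finset.prod_eq_zero (hfin.mem_toFinset.2 hv) h

/-- If the mean is not one, then infinitely many weights are positive: otherwise `φ` is a
polynomial, and `τ` cannot be its infinite radius of convergence. -/
theorem exists_weight_ne_zero {w : ℕ → ℝ≥0} (h0 : 0 < w 0) (h2 : ∃ k, 2 ≤ k ∧ 0 < w k)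
    (h : ∑' k : ℕ, (k : ℝ≥0∞) * WeightSeq.offspring w h0 h2 k ≠ 1) (N : ℕ) :
    ∃ k, N ≤ k ∧ w k ≠ 0 := by
  by_contra! hcon
  have hφ0 := WeightSeq.phi_ne_zero h0 (WeightSeq.tau w)
  have hφ := (WeightSeq.tau_spec h0 h2).1
  have hsum : ∑' k : ℕ, (k : ℝ≥0∞) * WeightSeq.offspring w h0 h2 k =
      WeightSeq.tPhiDeriv w (WeightSeq.tau w) / WeightSeq.phi w (WeightSeq.tau w) := by
    rw [WeightSeq.tPhiDeriv, div_eq_mul_inv, ← ENNReal.tsum_mul_right]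
    refine tsum_congr fun k => ?_
    change (k : ℝ≥0∞) * ((w k : ℝ≥0∞) * WeightSeq.tau w ^ k / WeightSeq.phi w (WeightSeq.tau w)) = _
    rw [div_eq_mul_inv, mul_assoc, mul_assoc, mul_assoc]
  rw [hsum, Ne, ENNReal.div_eq_one_iff hφ0 hφ] at h
  have hτ := WeightSeq.tau_eq_radius_of_tPhiDeriv_lt h0 ((WeightSeq.tau_spec h0 h2).2.lt_of_ne h)
  refine WeightSeq.tau_ne_top h0 h2 ?_
  rw [hτ]
  refine ENNReal.eq_top_of_forall_nnreal_le fun t => ?_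
  refine WeightSeq.radius_ge_of_summable ?_
  refine summable_of_ne_finset_zero (s := Finset.range N) fun k hk => ?_
  rw [hcon k (by simpa using hk), zero_mul]

theorem ae_isTypical_law (h0 : 0 < R.weightSeq 0) (h2 : ∃ k, 2 ≤ k ∧ 0 < R.weightSeq k) :
    ∀ᵐ T ∂ModifiedGW.law (WeightSeq.offspring R.weightSeq h0 h2), R.IsTypical T := by
  refine ModifiedGW.ae_law (WeightSeq.offspring_mean_le _ h0 h2) R.measurableSet_isTypical
    fun s hs => ?_
  have hw : ∀ k, WeightSeq.offspring R.weightSeq h0 h2 k ≠ 0 → R.weightSeq k ≠ 0 := by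
    intro k hk h
    refine hk ?_
    change (R.weightSeq k : ℝ≥0∞) * _ / _ = 0
    rw [h, ENNReal.coe_zero, zero_mul, ENNReal.zero_div]
  refine ⟨fun v hv htop => ?_, fun u v => ModifiedGW.eq_of_deg_eq_top, fun v hv N => ?_⟩
  · rw [ModifiedGW.deg_tree hv, ModifiedGW.sampleDeg] at htop ⊢
    split_ifs at htop ⊢ with hS
    · obtain ⟨k, h1, -, h3⟩ := (hs v).2.resolve_left fun h => htop h.1
      rw [h1, ENat.toNat_natCast]
      exact hw k h3
    · rw [ENat.toNat_natCast]
      exact hw _ (hs v).1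
  · have h1 := (ModifiedGW.IsSpecial.of_deg_eq_top hv).2
    obtain ⟨-, hmean⟩ := (hs v).2.resolve_right fun ⟨k, h, _⟩ => by
      rw [h1] at h
      exact ENat.top_ne_natCast k h
    obtain ⟨k, hk, hwk⟩ := exists_weight_ne_zero h0 h2 hmean N
    exact ⟨k, hk, R.nonempty_of_weightSeq_ne_zero hwk⟩

end WeightedSpecies

/-! ### Lower bounds for local events of the tree -/

namespace PlaneTree

open WeightSeq Finset Filter

/-- The probability that the outdegrees of the limiting tree agree with those of `T₀` on a finite
set `F` of vertices is a lower bound for the limit of the probabilities that those of the simply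
generated trees do so, up to replacing an infinite outdegree by one that is at least `K`. -/
theorem eventually_lt_simplyGenerated_of_lt_law {w : ℕ → ℝ≥0} (h0 : 0 < w 0)
    (h2 : ∃ k, 2 ≤ k ∧ 0 < w k) {F : Finset UHVertex} (hF : ∀ i v, i :: v ∈ F → v ∈ F)
    {T₀ : PlaneTree} (hT₀ : ∀ u v, T₀.deg u = ⊤ → T₀.deg v = ⊤ → u = v) {K : ℕ}
    (hK : ∀ i v, i :: v ∈ F → i < K) {c : ℝ≥0∞}
    (hc : c < ModifiedGW.law (offspring w h0 h2)
      {T | ∀ v ∈ F, v ∈ T₀.verts → T.deg v = T₀.deg v}) :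
    ∀ᶠ n in admissible w, c < simplyGenerated w (n + 1)
      {T | ∀ v ∈ F, v ∈ T₀.verts →
        (T₀.deg v ≠ ⊤ → T.deg v = T₀.deg v) ∧ (T₀.deg v = ⊤ → (K : ℕ∞) ≤ T.deg v)} := by
  classical
  set G := F.filter (· ∈ T₀.verts) with hG
  set d : UHVertex → ℕ := fun v => if T₀.deg v = ⊤ then K else (T₀.deg v).toNat with hd
  have hmean := offspring_mean_le w h0 h2
  have hdeg : ∀ v, T₀.deg v ≠ ⊤ → T₀.deg v = d v := fun v hv => by
    simp only [hd, if_neg hv, ENat.natCast_toNat hv]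
  have hpat : ∀ d' : UHVertex → ℕ, (∀ v ∈ G, T₀.deg v ≠ ⊤ → d' v = d v) →
      (∀ v ∈ G, T₀.deg v = ⊤ → K ≤ d' v) → IsPattern G d' := by
    intro d' h1 h2 v hv
    rcases v with _ | ⟨i, u⟩
    · exact nil_mem_hull
    obtain ⟨hvF, hvT⟩ := Finset.mem_filter.1 hv
    obtain ⟨huT, hi⟩ := cons_mem_verts.1 hvT
    have hu : u ∈ G := Finset.mem_filter.2 ⟨hF i u hvF, huT⟩
    refine cons_mem_hull.2 ⟨hu, ?_⟩
    by_cases htop : T₀.deg u = ⊤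
    · exact (hK i u hvF).trans_le (h2 u hu htop)
    · rw [h1 u hu htop]
      rw [hdeg u htop] at hi
      exact_mod_cast hi
  by_cases htop : ∃ v₀ ∈ G, T₀.deg v₀ = ⊤
  · obtain ⟨v₀, hv₀, htop⟩ := htop
    have hne : ∀ v ∈ G.erase v₀, T₀.deg v ≠ ⊤ := fun v hv h =>
      (Finset.mem_erase.1 hv).1 (hT₀ v v₀ h htop)
    have hE : {T : PlaneTree | ∀ v ∈ F, v ∈ T₀.verts → T.deg v = T₀.deg v} ⊆
        {T | T ∈ extending (G.erase v₀) d ∧ T.deg v₀ = ⊤} := by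
      intro T hT
      have hT' : ∀ v ∈ G, T.deg v = T₀.deg v := fun v hv =>
        hT v (Finset.mem_filter.1 hv).1 (Finset.mem_filter.1 hv).2
      exact ⟨fun v hv => by rw [hT' v (Finset.mem_of_mem_erase hv), hdeg v (hne v hv)],
        by rw [hT' v₀ hv₀, htop]⟩
    have hb := (measure_mono hE).trans (ModifiedGW.law_extending_top_le hmean
      (hpat d (fun _ _ _ => rfl) fun v _ hv => by simp only [hd, if_pos hv]; exact le_rfl) hv₀)
    have hpat' : ∀ D, K ≤ D → IsPattern G (Function.update d v₀ D) := by
      intro D hD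
      refine hpat _ (fun v _ hv => ?_) fun v _ hv => ?_
      · rw [Function.update_of_ne]
        rintro rfl
        exact hv htop
      · rw [hT₀ v v₀ hv htop, Function.update_self]
        exact hD
    filter_upwards [eventually_lt_simplyGenerated_extendingGE h0 h2 hv₀ hpat' (hc.trans_le hb)]
      with n hn
    refine hn.trans_le (measure_mono fun T hT v hvF hvT => ?_)
    have hv : v ∈ G := Finset.mem_filter.2 ⟨hvF, hvT⟩
    constructor
    · intro h
      rw [hdeg v h]
      exact hT.1 v (Finset.mem_erase.2 ⟨fun e => h (e ▸ htop), hv⟩)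
    · intro h
      rw [hT₀ v v₀ h htop]
      exact hT.2
  · push Not at htop
    have hE : {T : PlaneTree | ∀ v ∈ F, v ∈ T₀.verts → T.deg v = T₀.deg v} ⊆ extending G d := by
      intro T hT v hv
      rw [hT v (Finset.mem_filter.1 hv).1 (Finset.mem_filter.1 hv).2, hdeg v (htop v hv)]
    have hp := hpat d (fun _ _ _ => rfl) fun v hv h => absurd h (htop v hv)
    have hb := (measure_mono hE).trans (ModifiedGW.law_extending_le hmean hp)
    filter_upwards [(tendsto_simplyGenerated_extending h0 h2 hp).eventually_const_lt
      (hc.trans_le hb)] with n hn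
    refine hn.trans_le (measure_mono fun T hT v hvF hvT => ?_)
    have hv : v ∈ G := Finset.mem_filter.2 ⟨hvF, hvT⟩
    exact ⟨fun h => (hT v hv).trans (hdeg v h).symm, fun h => absurd h (htop v hv)⟩

end PlaneTree

/-! ### Lower bounds for cylinder sets of enriched trees -/

namespace WeightedSpecies

open PlaneTree Filter WeightSeq

variable {R : WeightedSpecies.{u}}

/-- A neighbourhood of `∞` contains all structures of large size: there are only finitely many
structures of each size. -/
theorem exists_forall_le_size_mem {A : Set R.Label} (hA : IsOpen A)
    (h : (OnePoint.infty : R.Label) ∈ A) : ∃ N : ℕ, ∀ y : R.Label, (N : ℕ∞) ≤ size y → y ∈ A := by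
  obtain ⟨-, hK⟩ := (OnePoint.isOpen_iff_of_mem h).1 hA
  have hfin : (((↑) : R.Atom → R.Label) ⁻¹' A)ᶜ.Finite := hK.finite_of_discrete
  refine ⟨hfin.toFinset.sup (fun a => (size (a : R.Label)).toNat) + 1, fun y hy => ?_⟩
  induction y using OnePoint.rec with
  | infty => exact h
  | coe a =>
    by_contra hcon
    have h1 := Finset.le_sup (f := fun a : R.Atom => (size (a : R.Label)).toNat)
      (hfin.mem_toFinset.2 hcon)
    rw [← ENat.natCast_toNat (size_coe_ne_top a)] at hy
    exact absurd (Nat.cast_le.1 hy) (Nat.lt_succ_of_le h1).not_ge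

/-- The bound for a cylinder set around a point `x`. Only the trees that agree with a fixed typical
tree `T₀` contribute to the probability that the limit agrees with `x`, and finite enriched trees
with a large outdegree in place of an infinite one are close to it. -/
theorem eventually_lt_enrichedLaw_pi (h0 : 0 < R.weightSeq 0)
    (h2 : ∃ k, 2 ≤ k ∧ 0 < R.weightSeq k) {F : Finset UHVertex} (hF : ∀ i v, i :: v ∈ F → v ∈ F)
    {x : UHVertex → R.Label} {A : UHVertex → Set R.Label} (hA : ∀ v ∈ F, IsOpen (A v))
    (hx : ∀ v ∈ F, x v ∈ A v) {c : ℝ≥0∞}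
    (hc : c < R.enrichedLaw (ModifiedGW.law (offspring R.weightSeq h0 h2))
      ((F : Set UHVertex).pi fun v => {x v})) :
    ∀ᶠ n in admissible R.weightSeq,
      c < R.enrichedLaw (simplyGenerated R.weightSeq (n + 1)) ((F : Set UHVertex).pi A) := by
  simp only [enrichedLaw_pi] at hc ⊢
  have htyp := ae_isTypical_law h0 h2
  obtain ⟨T₀, hT₀, hne⟩ : ∃ T₀, R.IsTypical T₀ ∧ ∏ v ∈ F, R.labelLaw T₀ v {x v} ≠ 0 := by
    by_contra! hcon
    refine (ne_bot_of_gt hc) ((lintegral_congr_ae (g := fun _ => 0) ?_).trans lintegral_zero)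
    filter_upwards [htyp] with T hT using hcon T hT
  set q := ∏ v ∈ F, R.labelLaw T₀ v {x v} with hq
  have hx₀ : ∀ v ∈ F, (x v ≠ R.star ↔ v ∈ T₀.verts) ∧ size (x v) = T₀.deg v := fun v hv =>
    hT₀.of_labelLaw_ne_zero (Finset.prod_ne_zero_iff.1 hne v hv)
  have hq1 : q ≠ ∞ := ENNReal.prod_ne_top fun v _ => measure_ne_top _ _
  have hup : ∀ T, R.IsTypical T → ∏ v ∈ F, R.labelLaw T v {x v} ≤
      Set.indicator {T | ∀ v ∈ F, v ∈ T₀.verts → T.deg v = T₀.deg v} (fun _ => q) T := by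
    intro T hT
    by_cases h : ∏ v ∈ F, R.labelLaw T v {x v} = 0
    · rw [h]; exact zero_le
    have hxT : ∀ v ∈ F, (x v ≠ R.star ↔ v ∈ T.verts) ∧ size (x v) = T.deg v := fun v hv =>
      hT.of_labelLaw_ne_zero (Finset.prod_ne_zero_iff.1 h v hv)
    have hmem : T ∈ {T : PlaneTree | ∀ v ∈ F, v ∈ T₀.verts → T.deg v = T₀.deg v} :=
      fun v hv _ => (hxT v hv).2.symm.trans (hx₀ v hv).2
    rw [Set.indicator_of_mem hmem]
    refine (Finset.prod_congr rfl fun v hv => ?_).le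
    rw [R.labelLaw_congr ((hxT v hv).1.symm.trans (hx₀ v hv).1)
      ((hxT v hv).2.symm.trans (hx₀ v hv).2)]
  have hlaw : c / q < ModifiedGW.law (offspring R.weightSeq h0 h2)
      {T | ∀ v ∈ F, v ∈ T₀.verts → T.deg v = T₀.deg v} := by
    rw [ENNReal.div_lt_iff (Or.inl hne) (Or.inl hq1), mul_comm]
    refine hc.trans_le ((lintegral_mono_ae ?_).trans (lintegral_indicator_const_le _ _))
    filter_upwards [htyp] with T hT using hup T hT
  have hN : ∀ v, ∃ N : ℕ, v ∈ F → x v = OnePoint.infty →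
      ∀ y : R.Label, (N : ℕ∞) ≤ size y → y ∈ A v := by
    intro v
    by_cases h : v ∈ F ∧ x v = OnePoint.infty
    · obtain ⟨N, hN⟩ := exists_forall_le_size_mem (hA v h.1) (h.2 ▸ hx v h.1)
      exact ⟨N, fun _ _ => hN⟩
    · exact ⟨0, fun h1 h2 => absurd ⟨h1, h2⟩ h⟩
  choose N hN using hN
  -- `K` exceeds all indices of children in `F`, so that having at least `K` children means the same
  -- as having infinitely many, as far as the membership of vertices of `F` is concerned.
  set K := F.sup fun v => max (N v) (v.headD 0 + 1) with hKdef
  have hKN : ∀ v ∈ F, max (N v) (v.headD 0 + 1) ≤ K := fun v hv =>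
    Finset.le_sup (f := fun v : UHVertex => max (N v) (v.headD 0 + 1)) hv
  have hK : ∀ i v, i :: v ∈ F → i < K := fun i v hv =>
    (le_max_right _ _).trans (hKN _ hv)
  have hlow : ∀ T, R.IsTypical T → (∀ v ∈ F, v ∈ T₀.verts →
      (T₀.deg v ≠ ⊤ → T.deg v = T₀.deg v) ∧ (T₀.deg v = ⊤ → (K : ℕ∞) ≤ T.deg v)) →
      q ≤ ∏ v ∈ F, R.labelLaw T v (A v) := by
    intro T hT hE
    have hverts : ∀ v ∈ F, (v ∈ T.verts ↔ v ∈ T₀.verts) := by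
      intro v
      induction v with
      | nil => exact fun _ => iff_of_true T.nil_mem_verts T₀.nil_mem_verts
      | cons i u ih =>
        intro hv
        have hu := hF i u hv
        rw [cons_mem_verts, cons_mem_verts, ih hu]
        refine and_congr_right fun huT => ?_
        by_cases htop : T₀.deg u = ⊤
        · refine iff_of_true ?_ (by rw [htop]; exact ENat.natCast_lt_top i)
          exact lt_of_lt_of_le (by exact_mod_cast hK i u hv) ((hE u hu huT).2 htop)
        · rw [(hE u hu huT).1 htop]
    refine Finset.prod_le_prod' fun v hv => ?_
    by_cases htop : T₀.deg v = ⊤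
    · have hvT := mem_verts_of_deg_ne_zero (by rw [htop]; simp : T₀.deg v ≠ 0)
      have hxv : x v = OnePoint.infty := size_eq_top_iff.1 ((hx₀ v hv).2.trans htop)
      have h1 : R.labelLaw T v (A v) = 1 := by
        refine (mem_ae_iff_prob_eq_one MeasurableSet.of_discrete).1 ?_
        filter_upwards [hT.ae_labelLaw v] with y hy
        refine hN v hv hxv y ?_
        rw [hy.2]
        refine le_trans ?_ ((hE v hv hvT).2 htop)
        exact_mod_cast (le_max_left _ _).trans (hKN v hv)
      rw [h1]
      exact prob_le_one
    · rw [R.labelLaw_congr (hverts v hv) (T' := T₀) ?_]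
      · exact measure_mono (Set.singleton_subset_iff.2 (hx v hv))
      by_cases hvT : v ∈ T₀.verts
      · exact (hE v hv hvT).1 htop
      · rw [deg_eq_zero_of_notMem hvT, deg_eq_zero_of_notMem fun h => hvT ((hverts v hv).1 h)]
  filter_upwards [eventually_lt_simplyGenerated_of_lt_law h0 h2 hF hT₀.2 hK hlaw] with n hn
  rw [ENNReal.div_lt_iff (Or.inl hne) (Or.inl hq1), mul_comm] at hn
  refine hn.trans_le ?_
  refine (mul_le_mul' le_rfl (measure_mono_ae ?_)).trans (mul_meas_ge_le_lintegral₀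
    (Finset.measurable_prod _ fun v _ => R.measurable_labelLaw_apply v _).aemeasurable q)
  filter_upwards [ae_isTypical_simplyGenerated (R := R) (n + 1)] with T hT hE using hlow T hT hE

end WeightedSpecies

/-! ### From cylinder sets to open sets -/

section

open Filter

theorem eventually_lt_sum {α ι : Type*} {L : Filter α} {S : Finset ι} {f : α → ι → ℝ≥0∞}
    {a : ι → ℝ≥0∞} (h : ∀ y ∈ S, ∀ c < a y, ∀ᶠ n in L, c < f n y) {c : ℝ≥0∞}
    (hc : c < ∑ y ∈ S, a y) : ∀ᶠ n in L, c < ∑ y ∈ S, f n y := by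
  have hlim : Tendsto (fun n => ∑ y ∈ S, min (f n y) (a y)) L (𝓝 (∑ y ∈ S, a y)) := by
    refine tendsto_finsetSum _ fun y hy => tendsto_order.2 ⟨fun b hb => ?_, fun b hb => ?_⟩
    · filter_upwards [h y hy b hb] with n hn using lt_min hn hb
    · exact Eventually.of_forall fun n => (min_le_right _ _).trans_lt hb
  filter_upwards [hlim.eventually_const_lt hc] with n hn
  exact hn.trans_le (Finset.sum_le_sum fun y _ => min_le_left _ _)

/-- In a product of countable spaces, lower bounds for the measures of neighbourhoods in terms of
the measures of cylinders extend to open sets: an open set contains disjoint neighbourhoods of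
finitely many cylinders that carry almost all of its mass. -/
theorem eventually_lt_measure_of_isOpen {α ι X : Type*} [Countable ι] [Countable X]
    [TopologicalSpace X] [T2Space X] [MeasurableSpace X] [DiscreteMeasurableSpace X]
    {L : Filter α} {ρ : Measure (ι → X)} {ρs : α → Measure (ι → X)} {p : Finset ι → Prop}
    (hp : ∀ I, ∃ F, I ⊆ F ∧ p F)
    (h : ∀ F, p F → ∀ (x : ι → X) (A : ι → Set X), (∀ v ∈ F, IsOpen (A v)) → (∀ v ∈ F, x v ∈ A v) →
      ∀ c < ρ ((F : Set ι).pi fun v => {x v}), ∀ᶠ n in L, c < ρs n ((F : Set ι).pi A))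
    {V : Set (ι → X)} (hV : IsOpen V) {c : ℝ≥0∞} (hc : c < ρ V) : ∀ᶠ n in L, c < ρs n V := by
  classical
  -- the points that have a neighbourhood inside `V` which only restricts the coordinates in `F`
  set W : Finset ι → Set (ι → X) := fun F =>
    {x | ∃ A : ι → Set X, (∀ v ∈ F, IsOpen (A v) ∧ x v ∈ A v) ∧ (F : Set ι).pi A ⊆ V} with hW
  have hmono : Monotone W := by
    rintro F F' hFF' x ⟨A, hA, hAV⟩
    refine ⟨fun v => if v ∈ F then A v else Set.univ, fun v _ => ?_, fun y hy => hAV fun v hv => ?_⟩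
    · beta_reduce
      split_ifs with hv
      · exact hA v hv
      · exact ⟨isOpen_univ, trivial⟩
    · have := hy v (hFF' hv)
      beta_reduce at this
      rwa [if_pos (Finset.mem_coe.1 hv)] at this
  have hVW : V ⊆ ⋃ F, W F := fun x hx => by
    obtain ⟨F, A, hA⟩ := isOpen_pi_iff.1 hV x hx
    exact Set.mem_iUnion.2 ⟨F, A, hA⟩
  have h1 : c < ⨆ F, ρ (W F) := by
    rw [← hmono.directed_le.measure_iUnion]
    exact hc.trans_le (measure_mono hVW)
  obtain ⟨I, hI⟩ := lt_iSup_iff.1 h1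
  obtain ⟨F, hIF, hpF⟩ := hp I
  replace hI := hI.trans_le (measure_mono (hmono hIF))
  have hx : ∀ y : (F.restrict '' W F : Set (F → X)), ∃ x ∈ W F, F.restrict x = y := fun y => y.2
  choose x hxW hxy using hx
  choose A hA hAV using hxW
  have hcov : W F ⊆ ⋃ y, (F : Set ι).pi fun v => {x y v} := by
    intro z hz
    refine Set.mem_iUnion.2 ⟨⟨F.restrict z, Set.mem_image_of_mem _ hz⟩, fun v hv => ?_⟩
    exact (congrFun (hxy ⟨F.restrict z, Set.mem_image_of_mem _ hz⟩) ⟨v, hv⟩).symm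
  have h2 := hI.trans_le ((measure_mono hcov).trans (measure_iUnion_le _))
  rw [ENNReal.tsum_eq_iSup_sum] at h2
  obtain ⟨S, hS⟩ := lt_iSup_iff.1 h2
  obtain ⟨U, hU, hdisj⟩ := (S.image Subtype.val).finite_toSet.t2_separation
  have hbox : ∀ y : F → X, ∃ B : F → Set X, (∀ v, IsOpen (B v) ∧ y v ∈ B v) ∧
      Set.univ.pi B ⊆ U y := fun y => isOpen_pi_iff'.1 (hU y).2 y (hU y).1
  choose B hB hBU using hbox
  set C : (F.restrict '' W F : Set (F → X)) → ι → Set X := fun y v =>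
    if hv : v ∈ F then A y v ∩ B y ⟨v, hv⟩ else Set.univ with hC
  have hCA : ∀ y, (F : Set ι).pi (C y) ⊆ V := by
    intro y
    refine fun z hz => hAV y fun v hv => ?_
    have := hz v hv
    simp only [hC, dif_pos (Finset.mem_coe.1 hv)] at this
    exact this.1
  have hCU : ∀ y, ∀ z ∈ (F : Set ι).pi (C y), F.restrict z ∈ U y := by
    intro y z hz
    refine hBU y fun v _ => ?_
    have := hz v v.2
    simp only [hC, dif_pos v.2] at this
    exact this.2
  have hSS := eventually_lt_sum (L := L) (f := fun n y => ρs n ((F : Set ι).pi (C y)))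
    (fun y _ => h F hpF (x y) (C y) (fun v hv => ?_) fun v hv => ?_) hS
  rotate_left
  · simp only [hC, dif_pos hv]
    exact (hA y v hv).1.inter (hB y ⟨v, hv⟩).1
  · simp only [hC, dif_pos hv]
    refine ⟨(hA y v hv).2, ?_⟩
    have := (hB y ⟨v, hv⟩).2
    rwa [congrFun (hxy y).symm ⟨v, hv⟩] at this
  filter_upwards [hSS] with n hn
  refine hn.trans_le ?_
  rw [← measure_biUnion_finset]
  · exact measure_mono (Set.iUnion₂_subset fun y _ => hCA y)
  · intro y hy y' hy' hne
    refine Set.disjoint_left.2 fun z hz hz' => ?_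
    have := hdisj (Finset.mem_coe.2 (Finset.mem_image_of_mem _ hy))
      (Finset.mem_coe.2 (Finset.mem_image_of_mem _ hy')) fun e => hne (Subtype.ext e)
    exact Set.disjoint_left.1 this (hCU y z hz) (hCU y' z hz')
  · exact fun y _ => MeasurableSet.pi F.countable_toSet fun _ _ => MeasurableSet.of_discrete

end

/-! ### Convergence in distribution -/

namespace WeightedSpecies

open PlaneTree Filter WeightSeq

variable {R : WeightedSpecies.{u}}

/-- Each finite set of vertices is contained in one that is closed under taking parents. -/
theorem exists_suffix_closed (I : Finset UHVertex) :
    ∃ F, I ⊆ F ∧ ∀ i v, i :: v ∈ F → v ∈ F := by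
  classical
  refine ⟨I.biUnion fun v => v.tails.toFinset, fun v hv => ?_, fun i v h => ?_⟩
  · exact Finset.mem_biUnion.2 ⟨v, hv, by simp⟩
  · obtain ⟨b, hb, h⟩ := Finset.mem_biUnion.1 h
    refine Finset.mem_biUnion.2 ⟨b, hb, ?_⟩
    rw [List.mem_toFinset, List.mem_tails] at h ⊢
    exact (List.suffix_cons i v).trans h

theorem eventually_lt_enrichedLaw_of_isOpen (h0 : 0 < R.weightSeq 0)
    (h2 : ∃ k, 2 ≤ k ∧ 0 < R.weightSeq k) {V : Set (UHVertex → R.Label)} (hV : IsOpen V) {c : ℝ≥0∞}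
    (hc : c < R.enrichedLaw (ModifiedGW.law (offspring R.weightSeq h0 h2)) V) :
    ∀ᶠ n in admissible R.weightSeq, c < R.enrichedLaw (simplyGenerated R.weightSeq (n + 1)) V :=
  eventually_lt_measure_of_isOpen (fun I => exists_suffix_closed I)
    (fun _ hF _ _ hA hx _ hc => eventually_lt_enrichedLaw_pi h0 h2 hF hA hx hc) hV hc

theorem partitionFunction_zero (w : ℕ → ℝ≥0) : partitionFunction w 0 = 0 := by
  rw [partitionFunction_eq, forest_eq_zero w one_pos, ENNReal.coe_zero]

/-- The conditions that there are plane trees of positive weight with `n` vertices, and that there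
are configurations of `n - 1` balls in `n` boxes of positive weight, are the same. -/
theorem tendsto_pred_admissible (w : ℕ → ℝ≥0) :
    Tendsto (fun n : {n // 0 < partitionFunction w n} => n.1 - 1)
      (comap Subtype.val atTop) (admissible w) := by
  refine tendsto_inf.2 ⟨(tendsto_sub_atTop_nat 1).comp tendsto_comap, ?_⟩
  refine tendsto_principal.2 (Eventually.of_forall fun n => ?_)
  obtain ⟨_ | n, hn⟩ := n
  · exact absurd hn (by rw [partitionFunction_zero]; exact lt_irrefl _)
  · rw [Set.mem_ofPred_eq, Nat.add_sub_cancel, pos_iff_ne_zero]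
    refine fun h => hn.ne' ?_
    rw [partitionFunction_succ]
    rw [h, zero_div, ENNReal.coe_zero]

end WeightedSpecies

theorem mainTheorem1 (R : WeightedSpecies.{u}) (h0 : 0 < R.weightSeq 0)
    (h2 : ∃ k, 2 ≤ k ∧ 0 < R.weightSeq k) :
    ∃ (P : {n : ℕ // 0 < PlaneTree.partitionFunction R.weightSeq n} →
          ProbabilityMeasure R.EnrichedTree)
      (Q : ProbabilityMeasure R.EnrichedTree),
      (∀ n, (P n : Measure R.EnrichedTree).map Subtype.val =
        R.enrichedLaw (PlaneTree.simplyGenerated R.weightSeq n)) ∧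
      (Q : Measure R.EnrichedTree).map Subtype.val =
        R.enrichedLaw (ModifiedGW.law (WeightSeq.offspring R.weightSeq h0 h2)) ∧
      Filter.Tendsto P (Filter.comap Subtype.val Filter.atTop) (𝓝 Q) := by
  have := fun n : {n : ℕ // 0 < PlaneTree.partitionFunction R.weightSeq n} =>
    WeightedSpecies.isProbabilityMeasure_simplyGenerated R.weightSeq n.2
  have := ModifiedGW.isProbabilityMeasure_law (WeightSeq.offspring_mean_le R.weightSeq h0 h2)
  choose P hP using fun n : {n : ℕ // 0 < PlaneTree.partitionFunction R.weightSeq n} =>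
    WeightedSpecies.exists_map_eq_enrichedLaw (PlaneTree.simplyGenerated R.weightSeq n)
      (WeightedSpecies.ae_isTypical_simplyGenerated n.1)
  obtain ⟨Q, hQ⟩ := WeightedSpecies.exists_map_eq_enrichedLaw _
    (WeightedSpecies.ae_isTypical_law h0 h2)
  refine ⟨P, Q, hP, hQ, ?_⟩
  refine tendsto_of_forall_isOpen_le_liminf' fun G hG => ?_
  obtain ⟨V, hV, rfl⟩ := isOpen_induced_iff.1 hG
  have hval : Measurable (Subtype.val : R.EnrichedTree → UHVertex → R.Label) :=
    measurable_subtype_coe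
  have hPV : ∀ n, (P n : Measure R.EnrichedTree) (Subtype.val ⁻¹' V) =
      R.enrichedLaw (PlaneTree.simplyGenerated R.weightSeq (n.1 - 1 + 1)) V := by
    intro n
    have hn : n.1 ≠ 0 := fun h => by
      have := n.2
      rw [h, WeightedSpecies.partitionFunction_zero] at this
      exact lt_irrefl _ this
    rw [Nat.sub_add_cancel (Nat.one_le_iff_ne_zero.2 hn), ← hP n]
    exact (Measure.map_apply hval hV.measurableSet).symm
  have hQV : (Q : Measure R.EnrichedTree) (Subtype.val ⁻¹' V) =
      R.enrichedLaw (ModifiedGW.law (WeightSeq.offspring R.weightSeq h0 h2)) V := by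
    rw [← hQ]
    exact (Measure.map_apply hval hV.measurableSet).symm
  rw [hQV]
  refine le_of_forall_lt fun c hc => ?_
  obtain ⟨c', hcc', hc'⟩ := exists_between hc
  refine hcc'.trans_le (Filter.le_liminf_of_le (by isBoundedDefault) ?_)
  filter_upwards [(WeightedSpecies.tendsto_pred_admissible R.weightSeq).eventually
    (WeightedSpecies.eventually_lt_enrichedLaw_of_isOpen h0 h2 hV hc')] with n hn
  rw [hPV]
  exact hn.le
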